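/- **Setting.** Let $\varepsilon,\sigma,\alpha,\gamma,\chi>0$, let $y\in\mathbb R^2$, and let $\mathbf C_y:\mathbb R^2\to\mathbb R^2$ be a bounded, uniformly continuous $C^1$ map whose first order partial derivatives $\partial_{x_i}\mathbf C_y$ ($i=1,2$) are bounded and uniformly continuous. Put $g(x)=\frac1{2\pi\sigma^2}e^{-|x|^2/(2\sigma^2)}$ and consider the return-to-home model $$\begin{cases}u'(t)=\chi\int_{\mathbb R^2}w(t,x)\,dx-\gamma u(t),\\ \partial_t v(t,x)=\varepsilon^2\Delta_x v(t,x)-\nabla_x\cdot(v(t,x)\,\mathbf C_y(x))-\alpha v(t,x)+\gamma g(x-y)u(t),\\ \partial_t w(t,x)=\alpha v(t,x)-\chi w(t,x)\end{cases}$$ in $X=\mathbb R\times L^1(\mathbb R^2)\times L^1(\mathbb R^2)$, with positive cone $X_+=\mathbb R_+\times L^1_+(\mathbb R^2)\times L^1_+(\mathbb R^2)$. Let $A$ be the infinitesimal generator in $L^1(\mathbb R^2)$ of the heat semigroup, given for $t>0$ by convolution with $\frac1{4\pi\varepsilon^2t}e^{-|x|^2/(4\varepsilon^2t)}$. Let $\Pi_y$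 be the flow of $z'=\mathbf C_y(z)$, and let $B_y$ be the infinitesimal generator in $L^1(\mathbb R^2)$ of the semigroup $$T_{B_y}(t)(v)(x)=\exp\Big(-\int_0^t(\nabla\cdot\mathbf C_y)(\Pi_y(-s)x)\,ds\Big)\,v(\Pi_y(-t)x).$$ Define operators in $X$ by $$\mathcal A_y(u,v,w)=(-\gamma u,\ (A+B_y)v-\alpha v,\ \alpha v-\chi w),\qquad \mathcal C_y(u,v,w)=\Big(\chi\int_{\mathbb R^2}w\,dx,\ \gamma\,g(\cdot-y)\,u,\ 0\Big),$$ where $\mathcal A_y$ has domain $\mathbb R\times(D(A)\cap D(B_y))\times L^1(\mathbb R^2)$ and $\mathcal C_y$ is defined on all of $X$. **Proposition (omega-limit sets).** The operator $\mathcal A_y+\mathcal C_y$ is the infinitesimal generator of a strongly continuous semigroup $T=\{T(t)\}_{t\ge0}$ of bounded linear operators on $X$. For every $x_0=(u_0,v_0,w_0)\in X$ the omega-limit set $$\omega(x_0)=\bigcap_{t\ge0}\overline{\{T(s)x_0:\ s\ge t\}}$$ is a nonempty compact subset of $X$. If moreover $x_0\in X_+$ and $u_0+\int_{\mathbb R^2}v_0\,dx+\int_{\mathbb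 R^2}w_0\,dx=n(y)$, then $$\omega(x_0)\subseteq\Big\{(u,v,w)\in X_+:\ u+\int_{\mathbb R^2}v\,dx+\int_{\mathbb R^2}w\,dx=n(y)\Big\}.$$ -/

import Mathlib

open MeasureTheory Filter Topology
open scoped NNReal

noncomputable section

namespace ReturnHome

/-! ### Strongly continuous semigroups and infinitesimal generators -/

/-- The graph of the infinitesimal generator of a family of maps `T t`, `t ≥ 0`, on a normed space:
`(x, f)` belongs to it iff `(T t x - x) / t → f` in norm as `t ↓ 0`. -/
def generatorGraph {X : Type*} [NormedAddCommGroup X] [NormedSpace ℝ X]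
    (T : ℝ≥0 → X → X) : Set (X × X) :=
  {p | Tendsto (fun t : ℝ≥0 => (t : ℝ)⁻¹ • (T t p.1 - p.1)) (𝓝[>] 0) (𝓝 p.2)}

/-- A strongly continuous semigroup of bounded linear operators. -/
structure C0Semigroup (X : Type*) [NormedAddCommGroup X] [NormedSpace ℝ X] where
  op : ℝ≥0 → X →L[ℝ] X
  op_zero : op 0 = ContinuousLinearMap.id ℝ X
  op_add : ∀ s t : ℝ≥0, op (s + t) = (op s).comp (op t)
  strongly_continuous : ∀ x : X, Continuous fun t : ℝ≥0 => op t x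

/-- The operator with graph `G` is the infinitesimal generator of the semigroup `T`. -/
def C0Semigroup.IsGeneratedBy {X : Type*} [NormedAddCommGroup X] [NormedSpace ℝ X]
    (T : C0Semigroup X) (G : Set (X × X)) : Prop :=
  generatorGraph (fun t x => T.op t x) = G

/-! ### The plane and `L¹` -/

/-- The plane `ℝ²` with its Euclidean norm and Lebesgue measure. -/
abbrev Plane : Type := EuclideanSpace ℝ (Fin 2)

/-- `L¹(ℝ²)`. -/
abbrev L1 : Type := Lp ℝ 1 (volume : Measure Plane)

open Classical in
/-- The class in `L¹(ℝ²)` of an integrable function (and `0` if the function is not integrable; this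
case does not occur below for the parameters considered in the theorem). -/
def classL1 (f : Plane → ℝ) : L1 :=
  if h : Integrable f volume then h.toL1 f else 0

/-! ### Diffusion -/

/-- The heat kernel `K(t, x) = exp (-|x|² / (4 ε² t)) / (4 π ε² t)`. -/
def heatKernel (ε t : ℝ) (x : Plane) : ℝ :=
  1 / (4 * Real.pi * ε ^ 2 * t) * Real.exp (-‖x‖ ^ 2 / (4 * ε ^ 2 * t))

/-- The heat semigroup on `L¹(ℝ²)`. -/
def heatOp (ε : ℝ) (t : ℝ≥0) (v : L1) : L1 :=
  if t = 0 then v else classL1 fun x => ∫ z, heatKernel ε t (x - z) * v z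

/-- The graph of `A`, the infinitesimal generator of the heat semigroup (that is, the realization of
`ε² Δ` in `L¹(ℝ²)`). -/
def diffusionGraph (ε : ℝ) : Set (L1 × L1) := generatorGraph (heatOp ε)

/-! ### Convection -/

/-- The assumption on a velocity field: it is bounded, uniformly continuous and `C¹`, with bounded
and uniformly continuous first order partial derivatives. -/
structure RegularVelocity (c : Plane → Plane) : Prop where
  uniformContinuous : UniformContinuous c
  bounded : ∃ M : ℝ, ∀ x, ‖c x‖ ≤ M
  contDiff : ContDiff ℝ 1 c
  partial_bounded : ∀ i : Fin 2, ∃ M : ℝ, ∀ x,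
    ‖fderiv ℝ c x (EuclideanSpace.single i 1)‖ ≤ M
  partial_uniformContinuous : ∀ i : Fin 2,
    UniformContinuous fun x => fderiv ℝ c x (EuclideanSpace.single i 1)

/-- The divergence `∂₁ c₁ + ∂₂ c₂`. -/
def divergence (c : Plane → Plane) (x : Plane) : ℝ :=
  ∑ i : Fin 2, (fderiv ℝ c x (EuclideanSpace.single i 1)) i

/-- The flow `Π(t) z` of the ordinary differential equation `z' = c(z)`: the solution on `ℝ` that
starts at `z` (it exists and is unique when `c` is bounded and Lipschitz). -/
def flow (c : Plane → Plane) (t : ℝ) (z : Plane) : Plane :=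
  Classical.epsilon
    (fun ζ : ℝ → Plane => ζ 0 = z ∧ ∀ s : ℝ, HasDerivAt ζ (c (ζ s)) s) t

/-- The solution operators, integrated along the characteristics, of `∂ₜ v = - ∇ · (v c)`. -/
def transportOp (c : Plane → Plane) (t : ℝ≥0) (v : L1) : L1 :=
  classL1 fun x =>
    Real.exp (-∫ s in (0 : ℝ)..t, divergence c (flow c (-s) x)) * v (flow c (-(t : ℝ)) x)

/-- The graph of `B`, the infinitesimal generator of the transport semigroup (that is, the
realization of `v ↦ - ∇ · (v c)` in `L¹(ℝ²)`). -/
def convectionGraph (c : Plane → Plane) : Set (L1 × L1) := generatorGraph (transportOp c)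

/-! ### The full system -/

/-- The state space `X = ℝ × L¹(ℝ²) × L¹(ℝ²)`. Its norm here is the maximum of the three norms, which
is equivalent to their sum; only the topology matters below. -/
abbrev State : Type := ℝ × L1 × L1

/-- The positive cone `X₊`. -/
def positiveCone : Set State := {p | 0 ≤ p.1 ∧ 0 ≤ p.2.1 ∧ 0 ≤ p.2.2}

/-- The total number of individuals `u + ∫ v + ∫ w`. -/
def totalMass (p : State) : ℝ := p.1 + (∫ x, p.2.1 x) + ∫ x, p.2.2 x

/-- The centered Gaussian density on `ℝ²` with standard deviation `σ`. -/
def gaussian (σ : ℝ) (x : Plane) : ℝ :=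
  1 / (2 * Real.pi * σ ^ 2) * Real.exp (-(x 0 ^ 2 + x 1 ^ 2) / (2 * σ ^ 2))

/-- The graph of
`(u, v, w) ↦ (- γ u, (A + B) v - α v, α v - χ w)`, whose domain is `ℝ × (D(A) ∩ D(B)) × L¹(ℝ²)`. -/
def uncoupledGraph (ε α γ χ : ℝ) (c : Plane → Plane) : Set (State × State) :=
  {p | ∃ (u : ℝ) (v w a b : L1), (v, a) ∈ diffusionGraph ε ∧ (v, b) ∈ convectionGraph c ∧
    p = ((u, v, w), (-(γ * u), (a + b) - α • v, α • v - χ • w))}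

/-- The bounded operator `(u, v, w) ↦ (χ ∫ w, γ g(· - y) u, 0)`. -/
def couplingOp (σ γ χ : ℝ) (y : Plane) (p : State) : State :=
  (χ * ∫ x, p.2.2 x, (γ * p.1) • classL1 (fun x => gaussian σ (x - y)), 0)

/-- The graph of the operator of the full system, the sum of the two operators above. -/
def systemGraph (ε σ α γ χ : ℝ) (c : Plane → Plane) (y : Plane) : Set (State × State) :=
  {p | ∃ q : State, (p.1, q) ∈ uncoupledGraph ε α γ χ c ∧ p.2 = q + couplingOp σ γ χ y p.1}

/-- The omega-limit set `⋂_{t ≥ 0} closure {T(s) x₀ : s ≥ t}` of the trajectory of `x₀`. -/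
def omegaLimitSet {X : Type*} [NormedAddCommGroup X] [NormedSpace ℝ X]
    (T : C0Semigroup X) (x₀ : X) : Set X :=
  ⋂ t : ℝ≥0, closure {x | ∃ s : ℝ≥0, t ≤ s ∧ x = T.op s x₀}

end ReturnHome

end

/-! ### Abstract semigroup theory: exponentials, generators, Hille–Yosida, compactness of orbits. -/

namespace ReturnHome

/-! ### Exponentials of bounded operators -/

section Exponential

variable {X : Type*} [NormedAddCommGroup X] [NormedSpace ℝ X] [CompleteSpace X]

/-! The coupling between the compartments has finite rank, so the full generator is a compact
perturbation of the uncoupled one, whose semigroup `S` decays exponentially. In the variation of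
constants formula `T(τ)z = S(τ)z + ∫₀^τ S(τ - s) B T(s)z ds` with `z = T(t - τ)x`, the first term is
small uniformly in `t` once `τ` is large, and the integral stays in one compact set because `B` is
compact and the orbit is bounded. Hence orbits are relatively compact (`totallyBounded_orbit`), and
an omega-limit set is a decreasing intersection of nonempty compact sets. Positivity and total mass
are invariant for the resolvents, and the Yosida approximation hands closed convex invariant sets on
to the semigroup (`exists_semigroup_of_dissipative`). Since a generator determines its semigroup
(`op_eq_of_generatorGraph_eq`), the conclusions hold for every semigroup with the given generator.

What the system needs from `A + B` is collected in `MarkovGenerator`. Dissipativity in `L¹`,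
positivity and conservation all follow from two facts: the integral of `(A + B)v` vanishes, and its
integral over `{v < 0}` is nonnegative. Both are checked for `A` and `B` separately
(`generatorGraph_sign`), because heat and transport preserve mass and do not increase the negative
part. For transport this is only needed up to `o(t)`, so the density factor is compared with the
Jacobian of the flow to first order, and Rademacher's theorem replaces smoothness of the flow.

The range condition is perturbative. A heat kernel of age `s`, transported for time `t`, moves in
`L¹` by `O(t (1 + s^(-1/2)))` (`VelocityBounds.exists_transport_kernelAt_bound`). Since `s^(-1/2)`
is integrable at zero, the heat resolvent `R_l` maps into `D(B)` and `‖B R_l‖ → 0`. Then `l - A - B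
= (1 - B R_l)(l - A)` on the range of `R_l`, a Neumann series inverts the first factor, and `D(A) ∩
D(B)` is exactly the domain required: no closure is taken. -/

theorem exp_add_of_commute_clm {A B : X →L[ℝ] X} (h : Commute A B) :
    NormedSpace.exp (A + B) = NormedSpace.exp A * NormedSpace.exp B := by
  let : NormedAlgebra ℚ (X →L[ℝ] X) := NormedAlgebra.restrictScalars ℚ ℝ _
  exact NormedSpace.exp_add_of_commute h

/-- The operator `exp (s (Q - 1))` is an infinite convex combination of the powers of `Q`. -/
theorem exp_smul_sub_one_mem {Q : X →L[ℝ] X} {S : Set X} (hS : IsClosed S) (hc : Convex ℝ S)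
    (hQ : ∀ x ∈ S, Q x ∈ S) {s : ℝ} (hs : 0 ≤ s) {x : X} (hx : x ∈ S) :
    NormedSpace.exp (s • (Q - 1)) x ∈ S := by
  have hpow : ∀ n : ℕ, (Q ^ n) x ∈ S := by
    intro n
    induction n with
    | zero => simpa using hx
    | succ n ih => rw [pow_succ']; exact hQ _ ih
  have h1 : HasSum (fun n : ℕ => (s ^ n / n.factorial) • (Q ^ n) x)
      (NormedSpace.exp (s • Q) x) := by
    have h := NormedSpace.exp_series_hasSum_exp' (𝕂 := ℝ) (s • Q)
    have h' := h.mapL (ContinuousLinearMap.apply ℝ X x)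
    convert h' using 2 with n
    · simp [smul_pow, smul_smul, div_eq_inv_mul]
    · rfl
  have h2 : HasSum (fun n : ℕ => s ^ n / n.factorial) (Real.exp s) := by
    rw [Real.exp_eq_exp_ℝ]
    exact NormedSpace.expSeries_div_hasSum_exp s
  have h3 : NormedSpace.exp (s • (Q - 1)) x = (Real.exp s)⁻¹ • NormedSpace.exp (s • Q) x := by
    have e1 : s • (Q - 1) = (algebraMap ℝ (X →L[ℝ] X) (-s)) + s • Q := by
      rw [Algebra.algebraMap_eq_smul_one]; module
    rw [e1, exp_add_of_commute_clm (Algebra.commute_algebraMap_left _ _), ← NormedSpace.algebraMap_exp_comm,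
      ← Real.exp_eq_exp_ℝ, Real.exp_neg, Algebra.algebraMap_eq_smul_one]
    simp
  -- The partial sums are divided by the partial sums of `e^s`. Taking `n + 1` terms keeps the
  -- weight `1` at index `0`, so the total weight is positive even for `s = 0`.
  have h4 : Tendsto (fun n : ℕ => (Finset.range (n + 1)).centerMass
      (fun k => s ^ k / k.factorial) (fun k => (Q ^ k) x)) atTop
      (𝓝 (NormedSpace.exp (s • (Q - 1)) x)) := by
    rw [h3]
    exact (((tendsto_add_atTop_iff_nat 1).2 h2.tendsto_sum_nat).inv₀ (Real.exp_pos s).ne').smul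
      ((tendsto_add_atTop_iff_nat 1).2 h1.tendsto_sum_nat)
  refine hS.mem_of_tendsto h4 (Eventually.of_forall fun n => ?_)
  refine hc.centerMass_mem (fun i _ => by positivity) ?_ (fun i _ => hpow i)
  exact Finset.sum_pos' (fun i _ => by positivity) ⟨0, by simp, by simp⟩

theorem hasDerivAt_exp_smul_apply (A : X →L[ℝ] X) (x : X) (t : ℝ) :
    HasDerivAt (fun s : ℝ => NormedSpace.exp (s • A) x) (NormedSpace.exp (t • A) (A x)) t := by
  have h := hasDerivAt_exp_smul_const (𝕂 := ℝ) A t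
  have := (ContinuousLinearMap.apply ℝ X x).hasFDerivAt.comp_hasDerivAt t h
  simpa [Function.comp_def] using this

/-- Comparison of two commuting contraction groups. -/
theorem norm_exp_smul_sub_le {A B : X →L[ℝ] X} (hAB : Commute A B) {M : ℝ}
    (hA : ∀ t : ℝ, 0 ≤ t → ∀ x, ‖NormedSpace.exp (t • A) x‖ ≤ M * ‖x‖)
    (hB : ∀ t : ℝ, 0 ≤ t → ∀ x, ‖NormedSpace.exp (t • B) x‖ ≤ M * ‖x‖) (hM : 0 ≤ M)
    {t : ℝ} (ht : 0 ≤ t) (x : X) :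
    ‖NormedSpace.exp (t • A) x - NormedSpace.exp (t • B) x‖ ≤ M * (M * ‖A x - B x‖) * t := by
  have hd : ∀ s : ℝ, HasDerivAt
      (fun s : ℝ => NormedSpace.exp (t • B) (NormedSpace.exp (s • (A - B)) x))
      (NormedSpace.exp (t • B) (NormedSpace.exp (s • (A - B)) ((A - B) x))) s := fun s =>
    (NormedSpace.exp (t • B)).hasFDerivAt.comp_hasDerivAt s (hasDerivAt_exp_smul_apply (A - B) x s)
  -- The path `s ↦ e^{tB} e^{s(A - B)} x` joins `e^{tB} x` to `e^{tA} x`. In this regrouped form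
  -- both exponents are nonnegative, so the assumed bounds apply to its derivative.
  have key : ∀ s ∈ Set.Icc (0 : ℝ) t, ∀ y, NormedSpace.exp (t • B) (NormedSpace.exp (s • (A - B)) y)
      = NormedSpace.exp ((t - s) • B) (NormedSpace.exp (s • A) y) := by
    intro s _ y
    have c1 : Commute (t • B) (s • (A - B)) :=
      ((hAB.symm.sub_right (Commute.refl B)).smul_left t).smul_right s
    have c2 : Commute ((t - s) • B) (s • A) := (hAB.symm.smul_left _).smul_right s
    have : NormedSpace.exp (t • B) * NormedSpace.exp (s • (A - B))
        = NormedSpace.exp ((t - s) • B) * NormedSpace.exp (s • A) := by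
      rw [← exp_add_of_commute_clm c1, ← exp_add_of_commute_clm c2]
      congr 1; module
    exact congrArg (fun L : X →L[ℝ] X => L y) this
  have h := norm_image_sub_le_of_norm_deriv_le_segment' (a := 0) (b := t)
    (f := fun s : ℝ => NormedSpace.exp (t • B) (NormedSpace.exp (s • (A - B)) x))
    (C := M * (M * ‖A x - B x‖)) (fun s _ => (hd s).hasDerivWithinAt) ?_ t ⟨ht, le_rfl⟩
  · rw [key t ⟨ht, le_rfl⟩] at h
    simpa [NormedSpace.exp_zero] using h
  · intro s hs
    rw [key s ⟨hs.1, hs.2.le⟩]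
    refine (hB _ (by linarith [hs.2]) _).trans (mul_le_mul_of_nonneg_left ?_ hM)
    simpa using hA s hs.1 ((A - B) x)

end Exponential

/-! ### Uniformly bounded families of operators -/

section Bounded

variable {X Y : Type*} [NormedAddCommGroup X] [NormedSpace ℝ X] [NormedAddCommGroup Y]
  [NormedSpace ℝ Y]

theorem cauchySeq_apply_of_dense {L : ℕ → X →L[ℝ] Y} {M : ℝ} (hL : ∀ n x, ‖L n x‖ ≤ M * ‖x‖)
    {D : Set X} (hD : Dense D) (h : ∀ x ∈ D, CauchySeq fun n => L n x) (x : X) :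
    CauchySeq fun n => L n x := by
  rw [Metric.cauchySeq_iff']
  intro e he
  have hM : 0 ≤ |M| + 1 := by positivity
  obtain ⟨z, hz, hxz⟩ := Metric.dense_iff.1 hD x (e / (4 * (|M| + 1))) (by positivity)
  obtain ⟨k, hk⟩ := Metric.cauchySeq_iff'.1 (h z hxz) (e / 4) (by positivity)
  refine ⟨k, fun n hn => ?_⟩
  have hb : ∀ n, ‖L n x - L n z‖ ≤ e / 4 := fun n => by
    rw [← map_sub]
    rw [Metric.mem_ball, dist_comm, dist_eq_norm] at hz
    calc ‖L n (x - z)‖ ≤ M * ‖x - z‖ := hL n _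
      _ ≤ (|M| + 1) * (e / (4 * (|M| + 1))) := by
        apply mul_le_mul _ hz.le (norm_nonneg _) hM
        linarith [le_abs_self M]
      _ = e / 4 := by field_simp
  have h1 := hk n hn
  rw [dist_eq_norm] at h1 ⊢
  calc ‖L n x - L k x‖ = ‖(L n x - L n z) + (L n z - L k z) - (L k x - L k z)‖ := by congr 1; abel
    _ ≤ ‖L n x - L n z‖ + ‖L n z - L k z‖ + ‖L k x - L k z‖ :=
      (norm_sub_le _ _).trans (add_le_add_left (norm_add_le _ _) _)
    _ < e := by linarith [hb n, hb k]

theorem tendsto_apply_of_dense {ι : Type*} {l : Filter ι} {L : ι → X →L[ℝ] Y} {L₀ : X →L[ℝ] Y}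
    {M : ℝ} (hL : ∀ n x, ‖L n x‖ ≤ M * ‖x‖) (hL₀ : ∀ x, ‖L₀ x‖ ≤ M * ‖x‖)
    {D : Set X} (hD : Dense D) (h : ∀ x ∈ D, Tendsto (fun n => L n x) l (𝓝 (L₀ x))) (x : X) :
    Tendsto (fun n => L n x) l (𝓝 (L₀ x)) := by
  rw [Metric.tendsto_nhds]
  intro e he
  have hM : 0 ≤ |M| + 1 := by positivity
  obtain ⟨z, hz, hxz⟩ := Metric.dense_iff.1 hD x (e / (4 * (|M| + 1))) (by positivity)
  rw [Metric.mem_ball, dist_comm, dist_eq_norm] at hz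
  have hb : ∀ K : X →L[ℝ] Y, (∀ x, ‖K x‖ ≤ M * ‖x‖) → ‖K x - K z‖ ≤ e / 4 := fun K hK => by
    rw [← map_sub]
    calc ‖K (x - z)‖ ≤ M * ‖x - z‖ := hK _
      _ ≤ (|M| + 1) * (e / (4 * (|M| + 1))) := by
        apply mul_le_mul _ hz.le (norm_nonneg _) hM
        linarith [le_abs_self M]
      _ = e / 4 := by field_simp
  filter_upwards [Metric.tendsto_nhds.1 (h z hxz) (e / 4) (by positivity)] with n h1
  rw [dist_eq_norm] at h1 ⊢
  calc ‖L n x - L₀ x‖ = ‖(L n x - L n z) + (L n z - L₀ z) - (L₀ x - L₀ z)‖ := by congr 1; abel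
    _ ≤ ‖L n x - L n z‖ + ‖L n z - L₀ z‖ + ‖L₀ x - L₀ z‖ :=
      (norm_sub_le _ _).trans (add_le_add_left (norm_add_le _ _) _)
    _ < e := by linarith [hb _ (hL n), hb _ hL₀]

theorem exists_limit_of_cauchySeq [CompleteSpace Y] {L : ℕ → X →L[ℝ] Y} {M : ℝ}
    (hL : ∀ n x, ‖L n x‖ ≤ M * ‖x‖) (h : ∀ x, CauchySeq fun n => L n x) :
    ∃ L₀ : X →L[ℝ] Y, (∀ x, ‖L₀ x‖ ≤ M * ‖x‖) ∧ ∀ x, Tendsto (fun n => L n x) atTop (𝓝 (L₀ x)) := by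
  choose f hf using fun x => cauchySeq_tendsto_of_complete (h x)
  have hb : ∀ x, ‖f x‖ ≤ M * ‖x‖ := fun x =>
    le_of_tendsto (hf x).norm (Eventually.of_forall fun n => hL n x)
  let F : X →ₗ[ℝ] Y :=
    { toFun := f
      map_add' := fun x y => tendsto_nhds_unique (hf (x + y))
        (by simpa using (hf x).add (hf y))
      map_smul' := fun c x => tendsto_nhds_unique (hf (c • x))
        (by simpa using (hf x).const_smul c) }
  exact ⟨F.mkContinuous M hb, hb, hf⟩

end Bounded

/-! ### Infinitesimal generators -/

section Generator

variable {X : Type*} [NormedAddCommGroup X] [NormedSpace ℝ X]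

theorem mem_generatorGraph_iff {T : ℝ≥0 → X → X} {x a : X} :
    (x, a) ∈ generatorGraph T ↔
      Tendsto (fun t : ℝ => t⁻¹ • (T t.toNNReal x - x)) (𝓝[>] 0) (𝓝 a) := by
  have h := NNReal.map_coe_nhdsGT 0
  rw [NNReal.coe_zero] at h
  rw [← h, tendsto_map'_iff]
  simp [generatorGraph, Function.comp_def]

theorem mem_generatorGraph_iff_hasDerivWithinAt {T : ℝ≥0 → X → X} {x a : X} (h0 : T 0 x = x) :
    (x, a) ∈ generatorGraph T ↔
      HasDerivWithinAt (fun t : ℝ => T t.toNNReal x) a (Set.Ioi 0) 0 := by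
  rw [hasDerivWithinAt_iff_tendsto_slope' (by simp), mem_generatorGraph_iff]
  simp [slope_fun_def, h0]

/-- Additivity is asked only for small `t`, since the transport operators will be shown to be linear
only near time zero. -/
theorem add_mem_generatorGraph {T : ℝ≥0 → X → X} {x a y b : X}
    (hT : ∀ᶠ t in 𝓝[>] (0 : ℝ≥0), T t (x + y) = T t x + T t y)
    (hx : (x, a) ∈ generatorGraph T) (hy : (y, b) ∈ generatorGraph T) :
    (x + y, a + b) ∈ generatorGraph T := by
  refine (Tendsto.add hx hy).congr' ?_
  filter_upwards [hT] with t ht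
  simp only [ht]; module

theorem smul_mem_generatorGraph {T : ℝ≥0 → X → X} {x a : X} (c : ℝ)
    (hT : ∀ᶠ t in 𝓝[>] (0 : ℝ≥0), T t (c • x) = c • T t x)
    (hx : (x, a) ∈ generatorGraph T) : (c • x, c • a) ∈ generatorGraph T := by
  refine (Tendsto.const_smul hx c).congr' ?_
  filter_upwards [hT] with t ht
  simp only [ht]; module

theorem generatorGraph_unique {T : ℝ≥0 → X → X} {x a b : X}
    (ha : (x, a) ∈ generatorGraph T) (hb : (x, b) ∈ generatorGraph T) : a = b :=
  tendsto_nhds_unique ha hb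

theorem C0Semigroup.op_zero_apply (T : C0Semigroup X) (x : X) : T.op 0 x = x := by
  simp [T.op_zero]

theorem C0Semigroup.op_add_apply (T : C0Semigroup X) (s t : ℝ≥0) (x : X) :
    T.op (s + t) x = T.op s (T.op t x) := by
  simp [T.op_add]

theorem C0Semigroup.continuous_real (T : C0Semigroup X) (x : X) :
    Continuous fun t : ℝ => T.op t.toNNReal x :=
  (T.strongly_continuous x).comp continuous_real_toNNReal

/-- The orbit of a point of the domain of the generator stays in the domain and is
differentiable from the right. -/
theorem C0Semigroup.op_mem_generatorGraph (T : C0Semigroup X) {x a : X}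
    (h : (x, a) ∈ generatorGraph fun t x => T.op t x) (s : ℝ≥0) :
    (T.op s x, T.op s a) ∈ generatorGraph fun t x => T.op t x := by
  have := ((T.op s).continuous.tendsto a).comp h
  refine this.congr fun t => ?_
  simp only [Function.comp, map_smul, map_sub]
  rw [← T.op_add_apply, ← T.op_add_apply, add_comm]

theorem C0Semigroup.hasDerivWithinAt_op (T : C0Semigroup X) {x a : X}
    (h : (x, a) ∈ generatorGraph fun t x => T.op t x) {s : ℝ} (hs : 0 ≤ s) :
    HasDerivWithinAt (fun t : ℝ => T.op t.toNNReal x) (T.op s.toNNReal a) (Set.Ioi s) s := by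
  have h1 := (mem_generatorGraph_iff_hasDerivWithinAt (T := fun t x => T.op t x)
    (T.op_zero_apply _)).1 (T.op_mem_generatorGraph h s.toNNReal)
  have h2 : HasDerivWithinAt (fun t : ℝ => t - s) 1 (Set.Ioi s) s :=
    ((hasDerivAt_id s).sub_const s).hasDerivWithinAt
  have h3 := HasDerivWithinAt.scomp_of_eq (t' := Set.Ioi 0) s h1 h2
    (fun t (ht : s < t) => sub_pos.2 ht) (by simp)
  rw [one_smul] at h3
  refine h3.congr (fun t (ht : s < t) => ?_) ?_
  · simp only [Function.comp]
    rw [← T.op_add_apply, ← Real.toNNReal_add (by linarith) hs, sub_add_cancel]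
  · simp [T.op_zero_apply]

/-- Operators in the generator of an asymptotically contractive family are dissipative. -/
theorem seminorm_le_of_mem_generatorGraph {T : ℝ≥0 → X → X} {N : Seminorm ℝ X}
    (hN : Continuous N) (hT : ∀ t x, N (T t x) ≤ N x) {x a : X}
    (h : (x, a) ∈ generatorGraph T) {l : ℝ} (hl : 0 < l) : l * N x ≤ N (l • x - a) := by
  have h1 : Tendsto (fun t : ℝ≥0 => N (l • x - (t : ℝ)⁻¹ • (T t x - x))) (𝓝[>] 0)
      (𝓝 (N (l • x - a))) := (hN.tendsto _).comp (Tendsto.sub tendsto_const_nhds h)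
  refine ge_of_tendsto h1 ?_
  filter_upwards [self_mem_nhdsWithin] with t (ht : 0 < t)
  have ht' : (0 : ℝ) < t := ht
  have e : l • x - (t : ℝ)⁻¹ • (T t x - x) = (l + (t : ℝ)⁻¹) • x - (t : ℝ)⁻¹ • T t x := by module
  have h2 := N.add_le' (l • x - (t : ℝ)⁻¹ • (T t x - x)) ((t : ℝ)⁻¹ • T t x)
  have h3 : l • x - (t : ℝ)⁻¹ • (T t x - x) + (t : ℝ)⁻¹ • T t x = (l + (t : ℝ)⁻¹) • x := by module
  change N _ ≤ N _ + N _ at h2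
  rw [h3, map_smul_eq_mul, map_smul_eq_mul, Real.norm_of_nonneg (by positivity),
    Real.norm_of_nonneg (by positivity)] at h2
  have h4 := mul_le_mul_of_nonneg_left (hT t x) (inv_nonneg.2 ht'.le)
  linarith

end Generator

end ReturnHome

namespace ReturnHome

/-! ### The generation theorem -/

section Generation

variable {X : Type*} [NormedAddCommGroup X] [NormedSpace ℝ X]

/-- The operator `l (l - G)⁻¹` of a dissipative operator `G` for which `l - G` is surjective. -/
theorem exists_scaled_resolvent (G : Submodule ℝ (X × X)) {N : Seminorm ℝ X} {K : ℝ}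
    (hK : 0 ≤ K) (hN1 : ∀ x, N x ≤ K * ‖x‖) (hN2 : ∀ x, ‖x‖ ≤ K * N x)
    {l : ℝ} (hl : 0 < l) (hdiss : ∀ p ∈ G, l * N p.1 ≤ N (l • p.1 - p.2))
    (hsurj : ∀ f, ∃ p ∈ G, l • p.1 - p.2 = f) :
    ∃ Q : X →L[ℝ] X, (∀ f, (l⁻¹ • Q f, Q f - f) ∈ G) ∧ (∀ f, N (Q f) ≤ N f) ∧
      ∀ p ∈ G, Q (l • p.1 - p.2) = l • p.1 := by
  choose r hrG hr using hsurj
  have huniq : ∀ p ∈ G, ∀ q ∈ G, l • p.1 - p.2 = l • q.1 - q.2 → p.1 = q.1 := by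
    intro p hp q hq h
    have h1 := hdiss (p - q) (G.sub_mem hp hq)
    have h2 : l • (p - q).1 - (p - q).2 = 0 := by
      rw [Prod.fst_sub, Prod.snd_sub, smul_sub, sub_sub_sub_comm, h, sub_self]
    rw [h2, map_zero] at h1
    have h3 : N (p - q).1 ≤ 0 := by
      by_contra h4; push Not at h4
      exact absurd h1 (not_le.2 (mul_pos hl h4))
    have h4 := (hN2 (p - q).1).trans (mul_nonpos_of_nonneg_of_nonpos hK h3)
    exact sub_eq_zero.1 (norm_le_zero_iff.1 h4)
  have hbound : ∀ f, N (l • (r f).1) ≤ N f := fun f => by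
    have := hdiss _ (hrG f)
    rwa [hr f, ← Real.norm_of_nonneg hl.le, ← map_smul_eq_mul] at this
  let F : X →ₗ[ℝ] X :=
    { toFun := fun f => l • (r f).1
      map_add' := fun f g => by
        rw [← smul_add, huniq _ (hrG (f + g)) _ (G.add_mem (hrG f) (hrG g)) ?_, Prod.fst_add]
        rw [hr, Prod.fst_add, Prod.snd_add, smul_add, add_sub_add_comm, hr, hr]
      map_smul' := fun c f => by
        rw [RingHom.id_apply, smul_comm c l,
          huniq _ (hrG (c • f)) _ (G.smul_mem c (hrG f)) ?_, Prod.smul_fst]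
        rw [hr, Prod.smul_fst, Prod.smul_snd, smul_comm, ← smul_sub, hr] }
  refine ⟨F.mkContinuous (K * K) fun f => ?_, fun f => ?_, hbound, fun p hp => ?_⟩
  · calc ‖l • (r f).1‖ ≤ K * N (l • (r f).1) := hN2 _
      _ ≤ K * (K * ‖f‖) := mul_le_mul_of_nonneg_left ((hbound f).trans (hN1 f)) hK
      _ = K * K * ‖f‖ := by ring
  · change (l⁻¹ • l • (r f).1, l • (r f).1 - f) ∈ G
    rw [inv_smul_smul₀ hl.ne']
    have : l • (r f).1 - f = (r f).2 := by
      nth_rw 2 [← hr f]; abel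
    rw [this]; exact hrG f
  · change l • (r (l • p.1 - p.2)).1 = l • p.1
    rw [huniq _ (hrG _) _ hp (hr _)]

/-- Evaluating each operator on the pair of `G` produced by the other gives two forms of the
resolvent identity. Their sum is `(l - m)(QR - RQ)f = 0`. -/
theorem commute_scaled_resolvent {G : Submodule ℝ (X × X)} {l m : ℝ} (hl : 0 < l) (hm : 0 < m)
    (hlm : l ≠ m) {Q R : X →L[ℝ] X}
    (hQ1 : ∀ f, (l⁻¹ • Q f, Q f - f) ∈ G) (hQ2 : ∀ p ∈ G, Q (l • p.1 - p.2) = l • p.1)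
    (hR1 : ∀ f, (m⁻¹ • R f, R f - f) ∈ G) (hR2 : ∀ p ∈ G, R (m • p.1 - p.2) = m • p.1) :
    Commute Q R := by
  refine ContinuousLinearMap.ext fun f => ?_
  have h1 := congrArg (fun x => m • x) (hQ2 _ (hR1 f))
  have h2 := congrArg (fun x => l • x) (hR2 _ (hQ1 f))
  simp only [map_sub, map_smul, smul_sub, smul_smul] at h1 h2
  rw [mul_comm l m⁻¹, mul_inv_cancel_left₀ hm.ne'] at h1
  rw [mul_comm m l⁻¹, mul_inv_cancel_left₀ hl.ne'] at h2
  change Q (R f) = R (Q f)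
  have h3 : (l - m) • (Q (R f) - R (Q f)) = 0 := by
    have : (l - m) • (Q (R f) - R (Q f)) = (l • Q (R f) - (m • Q (R f) - m • Q f)) +
      (m • R (Q f) - (l • R (Q f) - l • R f)) - m • Q f - l • R f := by module
    rw [this, h1, h2]; abel
  rcases smul_eq_zero.1 h3 with h | h
  · exact absurd (sub_eq_zero.1 h) hlm
  · exact sub_eq_zero.1 h

/-- A semigroup that is a limit of the exponentials of the Yosida approximations. -/
theorem exists_semigroup_of_yosida [CompleteSpace X] {G : Submodule ℝ (X × X)} {M : ℝ}
    (hM : 0 ≤ M) {A : ℕ → X →L[ℝ] X} (hA : ∀ n m, Commute (A n) (A m))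
    (hbound : ∀ n, ∀ t : ℝ, 0 ≤ t → ∀ x, ‖NormedSpace.exp (t • A n) x‖ ≤ M * ‖x‖)
    (hlim : ∀ p ∈ G, Tendsto (fun n => A n p.1) atTop (𝓝 p.2))
    (hlim' : ∀ p ∈ G, ∀ n, ‖A n p.1‖ ≤ M * ‖p.2‖)
    (hdense : Dense {x | ∃ a, (x, a) ∈ G}) :
    ∃ T : C0Semigroup X, (∀ p ∈ G, p ∈ generatorGraph fun t x => T.op t x) ∧
      (∀ t x, ‖T.op t x‖ ≤ M * ‖x‖) ∧
      ∀ (t : ℝ≥0) x, Tendsto (fun n => NormedSpace.exp ((t : ℝ) • A n) x) atTop (𝓝 (T.op t x)) := by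
  -- On the domain, `A n x` converges and the difference of the exponentials is at most `M² t ‖A n x
  -- - A k x‖`. The uniform bound extends this to all `x` by density.
  have hcauchy : ∀ (t : ℝ≥0) x, CauchySeq fun n => NormedSpace.exp ((t : ℝ) • A n) x := by
    intro t
    refine cauchySeq_apply_of_dense (fun n => hbound n t t.2) hdense ?_
    rintro x ⟨a, hxa⟩
    have h1 := (hlim _ hxa).cauchySeq
    rw [Metric.cauchySeq_iff'] at h1 ⊢
    intro e he
    obtain ⟨k, hk⟩ := h1 (e / (M * M * t + 1)) (by positivity)
    refine ⟨k, fun n hn => ?_⟩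
    rw [dist_eq_norm]
    have h2 := norm_exp_smul_sub_le (hA n k) (hbound n) (hbound k) hM t.2 x
    have h3 := hk n hn
    rw [dist_eq_norm] at h3
    have h4 : (0 : ℝ) ≤ M * M * t := by positivity
    calc _ ≤ M * M * t * ‖A n x - A k x‖ := h2.trans (le_of_eq (by rw [NNReal.val_eq_coe]; ring))
      _ ≤ M * M * t * (e / (M * M * t + 1)) := mul_le_mul_of_nonneg_left h3.le h4
      _ < e := by rw [← mul_div_assoc, div_lt_iff₀ (by positivity)]; nlinarith
  choose U hU1 hU2 using fun t : ℝ≥0 => exists_limit_of_cauchySeq (fun n => hbound n t t.2)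
    (hcauchy t)
  have h0 : U 0 = ContinuousLinearMap.id ℝ X := by
    refine ContinuousLinearMap.ext fun x => tendsto_nhds_unique (hU2 0 x) ?_
    simp [NormedSpace.exp_zero]
  have hadd : ∀ s t, U (s + t) = (U s).comp (U t) := by
    intro s t
    refine ContinuousLinearMap.ext fun x => tendsto_nhds_unique (hU2 _ x) ?_
    have e : ∀ n, NormedSpace.exp (((s + t : ℝ≥0) : ℝ) • A n) x =
        NormedSpace.exp ((s : ℝ) • A n) (NormedSpace.exp ((t : ℝ) • A n) x - U t x) +
        NormedSpace.exp ((s : ℝ) • A n) (U t x) := by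
      intro n
      rw [← map_add, sub_add_cancel, NNReal.coe_add, add_smul, exp_add_of_commute_clm]
      · rfl
      · exact ((Commute.refl (A n)).smul_left _).smul_right _
    simp_rw [e]
    have h1 : Tendsto (fun n => NormedSpace.exp ((s : ℝ) • A n)
        (NormedSpace.exp ((t : ℝ) • A n) x - U t x)) atTop (𝓝 0) := by
      refine squeeze_zero_norm (fun n => hbound n s s.2 _) ?_
      have h2 : Tendsto (fun n => NormedSpace.exp ((t : ℝ) • A n) x - U t x) atTop (𝓝 0) := by
        simpa using (hU2 t x).sub_const (U t x)
      simpa using h2.norm.const_mul M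
    simpa using h1.add (hU2 s (U t x))
  have hint : ∀ p ∈ G, ∀ n, ∀ t : ℝ, 0 ≤ t → NormedSpace.exp (t • A n) p.1 - p.1 =
      ∫ s in (0 : ℝ)..t, NormedSpace.exp (s • A n) (A n p.1) := by
    intro p _ n t _
    rw [intervalIntegral.integral_eq_sub_of_hasDerivAt
      (fun s _ => hasDerivAt_exp_smul_apply (A n) p.1 s)]
    · simp [NormedSpace.exp_zero]
    · refine Continuous.intervalIntegrable ?_ _ _
      exact continuous_iff_continuousAt.2 fun s =>
        (hasDerivAt_exp_smul_apply (A n) (A n p.1) s).continuousAt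
  have hcont : ∀ x, Continuous fun t => U t x := by
    have hlip : ∀ p ∈ G, Continuous fun t => U t p.1 := by
      intro p hp
      refine continuous_iff_continuousAt.2 fun t => ?_
      refine tendsto_iff_norm_sub_tendsto_zero.2 ?_
      have hle : ∀ n, ∀ s t : ℝ, 0 ≤ s → s ≤ t → ‖NormedSpace.exp (t • A n) p.1 -
          NormedSpace.exp (s • A n) p.1‖ ≤ M * (M * ‖p.2‖) * (t - s) := by
        intro n s t hs hst
        refine norm_image_sub_le_of_norm_deriv_le_segment' (a := s) (b := t)
          (fun r _ => (hasDerivAt_exp_smul_apply (A n) p.1 r).hasDerivWithinAt) ?_ t ⟨hst, le_rfl⟩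
        intro r hr
        exact (hbound n r (hs.trans hr.1) _).trans (mul_le_mul_of_nonneg_left (hlim' p hp n) hM)
      have hle' : ∀ n, ∀ s t : ℝ≥0, ‖NormedSpace.exp ((s : ℝ) • A n) p.1 -
          NormedSpace.exp ((t : ℝ) • A n) p.1‖ ≤ M * (M * ‖p.2‖) * |(s : ℝ) - t| := by
        intro n s t
        rcases le_total (s : ℝ) t with h | h
        · rw [norm_sub_rev, abs_sub_comm, abs_of_nonneg (sub_nonneg.2 h)]
          exact hle n s t s.2 h
        · rw [abs_of_nonneg (sub_nonneg.2 h)]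
          exact hle n t s t.2 h
      have hle'' : ∀ s : ℝ≥0, ‖U s p.1 - U t p.1‖ ≤ M * (M * ‖p.2‖) * |(s : ℝ) - t| := fun s =>
        le_of_tendsto ((hU2 s p.1).sub (hU2 t p.1)).norm (Eventually.of_forall fun n => hle' n s t)
      refine squeeze_zero (fun _ => norm_nonneg _) hle'' ?_
      have : Continuous fun s : ℝ≥0 => M * (M * ‖p.2‖) * |(s : ℝ) - t| := by fun_prop
      simpa using this.tendsto t
    intro x
    refine continuous_iff_continuousAt.2 fun t => ?_
    refine tendsto_apply_of_dense (fun s => hU1 s) (hU1 t) hdense ?_ x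
    rintro z ⟨a, hza⟩
    exact (hlip _ hza).continuousAt
  -- Passing to the limit in the integrated equation, rather than in the derivative, identifies the
  -- right derivative of the orbit at zero as `p.2`.
  have hlimint : ∀ p ∈ G, ∀ t : ℝ≥0, U t p.1 - p.1 =
      ∫ s in (0 : ℝ)..t, U s.toNNReal p.2 := by
    intro p hp t
    refine tendsto_nhds_unique ((hU2 t p.1).sub_const p.1) ?_
    simp_rw [fun n => hint p hp n t t.2]
    refine intervalIntegral.tendsto_integral_filter_of_dominated_convergence
      (fun _ => M * (M * ‖p.2‖)) ?_ ?_ (by simp) ?_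
    · refine Eventually.of_forall fun n => Continuous.aestronglyMeasurable ?_
      exact continuous_iff_continuousAt.2 fun s =>
        (hasDerivAt_exp_smul_apply (A n) (A n p.1) s).continuousAt
    · refine Eventually.of_forall fun n => Eventually.of_forall fun s hs => ?_
      rw [Set.uIoc_of_le (NNReal.coe_nonneg t)] at hs
      exact (hbound n s hs.1.le _).trans (mul_le_mul_of_nonneg_left (hlim' p hp n) hM)
    · refine Eventually.of_forall fun s hs => ?_
      rw [Set.uIoc_of_le (NNReal.coe_nonneg t)] at hs
      have h1 : Tendsto (fun n => NormedSpace.exp (s • A n) (A n p.1 - p.2)) atTop (𝓝 0) := by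
        refine squeeze_zero_norm (fun n => hbound n s hs.1.le _) ?_
        simpa using ((hlim p hp).sub_const p.2).norm.const_mul M
      have h2 := h1.add (hU2 s.toNNReal p.2)
      simpa [Real.coe_toNNReal s hs.1.le] using h2
  refine ⟨⟨U, h0, hadd, hcont⟩, fun p hp => ?_, hU1, hU2⟩
  have hc : Continuous fun t : ℝ => U t.toNNReal p.2 := (hcont p.2).comp continuous_real_toNNReal
  rw [show p = (p.1, p.2) from rfl, mem_generatorGraph_iff_hasDerivWithinAt (by simp [h0])]
  have h1 := (intervalIntegral.integral_hasDerivAt_right (hc.intervalIntegrable 0 0)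
    (hc.stronglyMeasurableAtFilter _ _) hc.continuousAt).add_const p.1
  have h2 := h1.hasDerivWithinAt (s := Set.Ioi 0)
  simp only [Real.toNNReal_zero, h0, ContinuousLinearMap.id_apply] at h2
  refine h2.congr (fun t (ht : 0 < t) => ?_) ?_
  · have := hlimint p hp t.toNNReal
    rw [Real.coe_toNNReal t ht.le] at this
    rw [← this]; simp
  · simp [h0]

/-- **Hille–Yosida theorem** for an operator that is dissipative for an equivalent norm. Closed
convex sets that are invariant under the operators `l (l - G)⁻¹` are invariant under the
semigroup. -/
theorem exists_semigroup_of_dissipative [CompleteSpace X] (G : Submodule ℝ (X × X))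
    {N : Seminorm ℝ X} {K : ℝ} (hK : 0 ≤ K)
    (hN1 : ∀ x, N x ≤ K * ‖x‖) (hN2 : ∀ x, ‖x‖ ≤ K * N x)
    (hdiss : ∀ p ∈ G, ∀ l : ℝ, 0 < l → l * N p.1 ≤ N (l • p.1 - p.2))
    {l₀ : ℝ} (hsurj : ∀ l : ℝ, l₀ < l → ∀ f, ∃ p ∈ G, l • p.1 - p.2 = f)
    (hdense : Dense {x | ∃ a, (x, a) ∈ G}) :
    ∃ T : C0Semigroup X, T.IsGeneratedBy (G : Set (X × X)) ∧ (∀ t x, N (T.op t x) ≤ N x) ∧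
      ∀ S : Set X, IsClosed S → Convex ℝ S →
        (∀ p ∈ G, ∀ l : ℝ, 0 < l → l • p.1 - p.2 ∈ S → l • p.1 ∈ S) →
        ∀ t, ∀ x ∈ S, T.op t x ∈ S := by
  have hNc : Continuous N := by
    refine Seminorm.continuous_of_le (q := K.toNNReal • normSeminorm ℝ X) ?_ fun x => ?_
    · exact (continuous_norm (E := X)).const_smul K.toNNReal
    · simpa [NNReal.smul_def, hK] using hN1 x
  -- A sequence above both `l₀` and `0`, tending to infinity, with distinct terms so that different
  -- resolvents commute.
  let l : ℕ → ℝ := fun n => max l₀ 0 + 1 + n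
  have hl0 : ∀ n, l₀ < l n := fun n => by
    have := le_max_left l₀ 0
    have h2 : (0 : ℝ) ≤ n := n.cast_nonneg
    simp only [l]; linarith
  have hlpos : ∀ n, 0 < l n := fun n => by
    have := le_max_right l₀ 0
    have h2 : (0 : ℝ) ≤ n := n.cast_nonneg
    simp only [l]; linarith
  choose Q hQ1 hQ2 hQ3 using fun n => exists_scaled_resolvent G hK hN1 hN2 (hlpos n)
    (fun p hp => hdiss p hp _ (hlpos n)) (hsurj (l n) (hl0 n))
  have hcomm : ∀ n m, Commute (Q n) (Q m) := fun n m => by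
    rcases eq_or_ne n m with rfl | h
    · exact Commute.refl _
    · exact commute_scaled_resolvent (hlpos n) (hlpos m) (by simpa [l] using h)
        (hQ1 n) (hQ3 n) (hQ1 m) (hQ3 m)
  -- The Yosida approximation; on the domain of `G` it equals `Q n` applied to the image, hence
  -- tends to `G`.
  let A : ℕ → X →L[ℝ] X := fun n => l n • (Q n - 1)
  have hAQ : ∀ p ∈ G, ∀ n, A n p.1 = Q n p.2 := fun p hp n => by
    have := hQ3 n p hp
    rw [map_sub, map_smul] at this
    simp only [A, smul_apply, sub_apply,
      one_apply_eq_self, smul_sub, ← this]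
    abel
  have hexp : ∀ n (t : ℝ), t • A n = (t * l n) • (Q n - 1) := fun n t => by
    simp only [A, smul_smul]
  have hinv : ∀ S : Set X, IsClosed S → Convex ℝ S → ∀ n, (∀ x ∈ S, Q n x ∈ S) →
      ∀ t : ℝ, 0 ≤ t → ∀ x ∈ S, NormedSpace.exp (t • A n) x ∈ S := by
    intro S hS hc n h t ht x hx
    rw [hexp]
    exact exp_smul_sub_one_mem hS hc h (mul_nonneg ht (hlpos n).le) hx
  have hNexp : ∀ n, ∀ t : ℝ, 0 ≤ t → ∀ x, N (NormedSpace.exp (t • A n) x) ≤ N x := by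
    intro n t ht x
    -- Contractivity is itself an instance of invariance of a closed convex set, here the `N`-ball
    -- of radius `N x`.
    have := hinv (N.closedBall 0 (N x)) ?_ (N.convex_closedBall 0 _) n ?_ t ht x ?_
    · simpa [Seminorm.mem_closedBall_zero] using this
    · simp only [Seminorm.closedBall_zero_eq]
      exact isClosed_le hNc continuous_const
    · intro z hz
      rw [Seminorm.mem_closedBall_zero] at hz ⊢
      exact (hQ2 n z).trans hz
    · simp
  have hbd : ∀ (L : X → X), (∀ x, N (L x) ≤ N x) → ∀ x, ‖L x‖ ≤ K * K * ‖x‖ := fun L hL x => by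
    calc ‖L x‖ ≤ K * N (L x) := hN2 _
      _ ≤ K * (K * ‖x‖) := mul_le_mul_of_nonneg_left ((hL x).trans (hN1 x)) hK
      _ = K * K * ‖x‖ := by ring
  have hQlim : ∀ x, Tendsto (fun n => Q n x) atTop (𝓝 x) := by
    have hMx : ∀ x : X, ‖(ContinuousLinearMap.id ℝ X) x‖ ≤ max (K * K) 1 * ‖x‖ := fun x => by
      simpa using mul_le_mul_of_nonneg_right (le_max_right (K * K) 1) (norm_nonneg x)
    refine tendsto_apply_of_dense (L₀ := ContinuousLinearMap.id ℝ X)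
      (fun n x => (hbd _ (hQ2 n) x).trans
        (mul_le_mul_of_nonneg_right (le_max_left _ 1) (norm_nonneg x))) hMx hdense ?_
    rintro x ⟨a, hxa⟩
    have e : ∀ n, Q n x = x + (l n)⁻¹ • Q n a := fun n => by
      have := hAQ _ hxa n
      simp only [A, smul_apply, sub_apply,
        one_apply_eq_self] at this
      rw [← this, inv_smul_smul₀ (hlpos n).ne']; abel
    simp_rw [e]
    have hl : Tendsto (fun n => (l n)⁻¹) atTop (𝓝 0) :=
      (tendsto_atTop_add_const_left _ _ tendsto_natCast_atTop_atTop).inv_tendsto_atTop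
    have : Tendsto (fun n => (l n)⁻¹ • Q n a) atTop (𝓝 0) := by
      refine squeeze_zero_norm (a := fun n => (l n)⁻¹ * (K * K * ‖a‖)) (fun n => ?_) ?_
      · rw [norm_smul, Real.norm_of_nonneg (inv_nonneg.2 (hlpos n).le)]
        exact mul_le_mul_of_nonneg_left (hbd _ (hQ2 n) a) (inv_nonneg.2 (hlpos n).le)
      · simpa using hl.mul_const (K * K * ‖a‖)
    simpa using this.const_add x
  obtain ⟨T, hT1, hT2, hT3⟩ := exists_semigroup_of_yosida (G := G) (A := A)
    (mul_nonneg hK hK)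
    (fun n m => (((hcomm n m).sub_left (Commute.one_left _)).sub_right
      (Commute.one_right _)).smul_left _ |>.smul_right _)
    (fun n t ht => hbd _ (hNexp n t ht))
    (fun p hp => by simp_rw [hAQ p hp]; exact hQlim p.2)
    (fun p hp n => by rw [hAQ p hp]; exact hbd _ (hQ2 n) _) hdense
  have hTN : ∀ t x, N (T.op t x) ≤ N x := fun t x =>
    le_of_tendsto ((hNc.tendsto _).comp (hT3 t x)) (Eventually.of_forall fun n => hNexp n t t.2 x)
  refine ⟨T, ?_, hTN, fun S hS hc hSG t x hx => ?_⟩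
  -- The generator of `T` extends `G` and is dissipative, so `l - generator` is injective; as `l -
  -- G` is already onto, the extension cannot be proper.
  · refine Set.Subset.antisymm (fun p hp => ?_) hT1
    obtain ⟨q, hq, hpq⟩ := hsurj (l 0) (hl0 0) (l 0 • p.1 - p.2)
    have h1 : p + (-1 : ℝ) • q ∈ generatorGraph fun t x => T.op t x :=
      add_mem_generatorGraph (Eventually.of_forall fun t => map_add _ _ _) hp
        (smul_mem_generatorGraph (-1) (Eventually.of_forall fun t => map_smul _ _ _) (hT1 q hq))
    have h2 := seminorm_le_of_mem_generatorGraph hNc hTN h1 (hlpos 0)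
    have h3 : l 0 • (p.1 + (-1 : ℝ) • q.1) - (p.2 + (-1 : ℝ) • q.2) = 0 := by
      have : l 0 • (p.1 + (-1 : ℝ) • q.1) - (p.2 + (-1 : ℝ) • q.2) =
        (l 0 • p.1 - p.2) - (l 0 • q.1 - q.2) := by module
      rw [this, hpq, sub_self]
    change l 0 * N (p.1 + (-1 : ℝ) • q.1) ≤ N (l 0 • (p.1 + (-1 : ℝ) • q.1) -
      (p.2 + (-1 : ℝ) • q.2)) at h2
    rw [h3, map_zero] at h2
    have h4 : N (p.1 + (-1 : ℝ) • q.1) ≤ 0 := by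
      by_contra h5; push Not at h5
      exact absurd h2 (not_le.2 (mul_pos (hlpos 0) h5))
    have h5 := norm_le_zero_iff.1 ((hN2 _).trans (mul_nonpos_of_nonneg_of_nonpos hK h4))
    have h6 : p.1 = q.1 := by
      have : p.1 = (p.1 + (-1 : ℝ) • q.1) + q.1 := by module
      rw [this, h5, zero_add]
    have h7 : p.2 = q.2 := by rw [h6] at hpq; simpa using hpq.symm
    rw [SetLike.mem_coe, show p = q from Prod.ext h6 h7]; exact hq
  · refine hS.mem_of_tendsto (hT3 t x) (Eventually.of_forall fun n => hinv S hS hc n ?_ t t.2 x hx)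
    intro z hz
    have := hSG _ (hQ1 n z) (l n) (hlpos n)
    rw [smul_inv_smul₀ (hlpos n).ne', sub_sub_cancel] at this
    exact this hz

end Generation

end ReturnHome

namespace ReturnHome

/-! ### Variation of constants, uniqueness and omega-limit sets -/

section Orbits

variable {X : Type*} [NormedAddCommGroup X] [NormedSpace ℝ X]

theorem C0Semigroup.tendsto_op (S : C0Semigroup X) {M : ℝ} (hS : ∀ t x, ‖S.op t x‖ ≤ M * ‖x‖)
    {ι : Type*} {l : Filter ι} {r : ι → ℝ≥0} {r₀ : ℝ≥0} {y : ι → X} {y₀ : X}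
    (hr : Tendsto r l (𝓝 r₀)) (hy : Tendsto y l (𝓝 y₀)) :
    Tendsto (fun i => S.op (r i) (y i)) l (𝓝 (S.op r₀ y₀)) := by
  have h1 : Tendsto (fun i => S.op (r i) (y i - y₀)) l (𝓝 0) := by
    refine squeeze_zero_norm (fun i => hS _ _) ?_
    simpa using (hy.sub_const y₀).norm.const_mul M
  have h2 := ((S.strongly_continuous y₀).tendsto r₀).comp hr
  simpa [Function.comp_def] using h1.add h2

theorem C0Semigroup.continuous_uncurry_op (S : C0Semigroup X) {M : ℝ}
    (hS : ∀ t x, ‖S.op t x‖ ≤ M * ‖x‖) : Continuous fun p : ℝ≥0 × X => S.op p.1 p.2 :=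
  continuous_iff_continuousAt.2 fun _ =>
    S.tendsto_op hS continuous_fst.continuousAt continuous_snd.continuousAt

/-- **Variation of constants formula** for a bounded perturbation of a generator. -/
theorem op_sub_op_eq_integral [CompleteSpace X] (T S : C0Semigroup X) {M : ℝ}
    (hS : ∀ t x, ‖S.op t x‖ ≤ M * ‖x‖) (B : X →L[ℝ] X)
    (hTS : ∀ x a, (x, a) ∈ generatorGraph (fun t x => T.op t x) →
      (x, a - B x) ∈ generatorGraph fun t x => S.op t x)
    {x a : X} (hx : (x, a) ∈ generatorGraph fun t x => T.op t x) (τ : ℝ≥0) :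
    T.op τ x - S.op τ x =
      ∫ s in (0 : ℝ)..τ, S.op (τ - s).toNNReal (B (T.op s.toNNReal x)) := by
  have hcont : ∀ L : X →L[ℝ] X,
      Continuous fun s : ℝ => S.op (τ - s).toNNReal (L (T.op s.toNNReal x)) := fun L =>
    (S.continuous_uncurry_op hS).comp ((continuous_real_toNNReal.comp
      (continuous_const.sub continuous_id)).prodMk (L.continuous.comp (T.continuous_real x)))
  rw [intervalIntegral.integral_eq_sub_of_hasDeriv_right
    (f := fun s : ℝ => S.op (τ - s).toNNReal (T.op s.toNNReal x))]
  · simp [T.op_zero_apply, S.op_zero_apply]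
  · exact (hcont (ContinuousLinearMap.id ℝ X)).continuousOn
  · intro s hs
    rw [min_eq_left τ.coe_nonneg, max_eq_right τ.coe_nonneg] at hs
    rw [hasDerivWithinAt_iff_tendsto_slope' (by simp)]
    have h1 := (hasDerivWithinAt_iff_tendsto_slope' (by simp)).1 (T.hasDerivWithinAt_op hx hs.1.le)
    have h2 := (mem_generatorGraph_iff (T := fun t x => S.op t x)).1
      (hTS _ _ (T.op_mem_generatorGraph hx s.toNNReal))
    have h3 : Tendsto (fun r : ℝ => r - s) (𝓝[>] s) (𝓝[>] 0) := by
      refine tendsto_nhdsWithin_iff.2 ⟨?_, ?_⟩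
      · have : Continuous fun r : ℝ => r - s := by fun_prop
        simpa using (this.tendsto s).mono_left nhdsWithin_le_nhds
      · filter_upwards [self_mem_nhdsWithin] with r (hr : s < r) using sub_pos.2 hr
    -- The right derivative of `r ↦ S(τ - r) T(r) x` combines that of `T`, namely `T(s)a`, with
    -- minus the generator of `S`, namely `T(s)a - B T(s)x`. Only `B T(s)x` survives.
    have h4 := h1.sub (h2.comp h3)
    rw [sub_sub_cancel] at h4
    have h5 : Tendsto (fun r : ℝ => (τ - r).toNNReal) (𝓝[>] s) (𝓝 (τ - s).toNNReal) := by
      have : Continuous fun r : ℝ => ((τ : ℝ) - r).toNNReal := by fun_prop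
      exact (this.tendsto s).mono_left nhdsWithin_le_nhds
    refine (S.tendsto_op hS h5 h4).congr' ?_
    filter_upwards [Ioo_mem_nhdsGT hs.2] with r hr
    have e1 : (τ - s : ℝ).toNNReal = (τ - r : ℝ).toNNReal + (r - s).toNNReal := by
      rw [← Real.toNNReal_add (by linarith [hr.2]) (by linarith [hr.1])]; congr 1; ring
    simp only [slope_def_module, Function.comp]
    rw [e1, S.op_add_apply, ← map_sub, ← map_smul, ← smul_sub, sub_sub_sub_cancel_right]
  · exact (hcont B).intervalIntegrable _ _

/-- A semigroup is determined by its generator. -/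
theorem op_eq_of_generatorGraph_eq [CompleteSpace X] (T S : C0Semigroup X) {M : ℝ}
    (hS : ∀ t x, ‖S.op t x‖ ≤ M * ‖x‖)
    (hTS : generatorGraph (fun t x => T.op t x) = generatorGraph fun t x => S.op t x)
    (hdense : Dense {x | ∃ a, (x, a) ∈ generatorGraph fun t x => S.op t x}) (t : ℝ≥0) :
    T.op t = S.op t := by
  refine ContinuousLinearMap.coeFn_injective
    (Continuous.ext_on hdense (T.op t).continuous (S.op t).continuous ?_)
  rintro x ⟨a, hxa⟩
  have := op_sub_op_eq_integral T S hS 0 (fun x a h => by rw [hTS] at h; simpa using h)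
    (hTS ▸ hxa) t
  simpa [sub_eq_zero] using this

theorem totallyBounded_of_forall_approx {Y : Type*} [PseudoMetricSpace Y] {s : Set Y}
    (h : ∀ e > 0, ∃ K, TotallyBounded K ∧ ∀ x ∈ s, ∃ y ∈ K, dist x y < e) : TotallyBounded s := by
  rw [Metric.totallyBounded_iff]
  intro e he
  obtain ⟨K, hK, hs⟩ := h (e / 2) (by positivity)
  obtain ⟨F, hF, hKF⟩ := Metric.totallyBounded_iff.1 hK (e / 2) (by positivity)
  refine ⟨F, hF, fun x hx => ?_⟩
  obtain ⟨y, hy, hxy⟩ := hs x hx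
  obtain ⟨z, hz, hyz⟩ := Set.mem_iUnion₂.1 (hKF hy)
  refine Set.mem_iUnion₂.2 ⟨z, hz, ?_⟩
  rw [Metric.mem_ball] at hyz ⊢
  linarith [dist_triangle x y z]

/-- The orbits of a bounded semigroup are relatively compact if its generator is a compact
perturbation of the generator of a stable semigroup. -/
theorem totallyBounded_orbit [CompleteSpace X] (T S : C0Semigroup X) {M : ℝ}
    (hT : ∀ t x, ‖T.op t x‖ ≤ M * ‖x‖) (hS : ∀ t x, ‖S.op t x‖ ≤ M * ‖x‖)
    (hstable : ∀ e > 0, ∃ t, 0 < t ∧ ∀ x, ‖S.op t x‖ ≤ e * ‖x‖)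
    (B : X →L[ℝ] X) (hB : IsCompactOperator B)
    (hTS : ∀ x a, (x, a) ∈ generatorGraph (fun t x => T.op t x) →
      (x, a - B x) ∈ generatorGraph fun t x => S.op t x)
    (hdense : Dense {x | ∃ a, (x, a) ∈ generatorGraph fun t x => T.op t x}) (x : X) :
    TotallyBounded (Set.range fun t => T.op t x) := by
  have hdom : ∀ x a, (x, a) ∈ generatorGraph (fun t x => T.op t x) →
      TotallyBounded (Set.range fun t => T.op t x) := by
    intro x a hxa
    refine totallyBounded_of_forall_approx fun e he => ?_
    -- All points of the orbit have norm at most `M ‖x‖`, so this `τ`, independent of `t`, makes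
    -- `S(τ)` smaller than `e` along the whole orbit. The absolute value and the `1` keep the
    -- denominator positive before the sign of `M ‖x‖` is known.
    obtain ⟨τ, hτ, hSτ⟩ := hstable (e / (2 * (M * ‖x‖ + 1 + |M * ‖x‖|)))
      (by have := neg_abs_le (M * ‖x‖); exact div_pos he (by linarith))
    obtain ⟨K, hK, hBK⟩ := hB.image_closedBall_subset_compact (M * ‖x‖)
    have hK' : IsCompact ((fun p : ℝ≥0 × X => S.op p.1 p.2) '' (Set.Icc 0 τ ×ˢ K)) :=
      (isCompact_Icc.prod hK).image (S.continuous_uncurry_op hS)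
    let H := closure (convexHull ℝ ((fun p : ℝ≥0 × X => S.op p.1 p.2) '' (Set.Icc 0 τ ×ˢ K)))
    have hHt : TotallyBounded H := hK'.totallyBounded.convexHull.closure
    have hHc : IsCompact H := isCompact_iff_totallyBounded_isComplete.2 ⟨hHt, isClosed_closure.isComplete⟩
    refine ⟨(fun t => T.op t x) '' Set.Icc 0 τ ∪ (fun z => (τ : ℝ) • z) '' H,
      TotallyBounded.union ?_ ?_, ?_⟩
    · exact (isCompact_Icc.image (T.strongly_continuous x)).totallyBounded
    · exact (hHc.image (continuous_const_smul (τ : ℝ))).totallyBounded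
    rintro _ ⟨t, rfl⟩
    rcases le_total t τ with ht | ht
    · exact ⟨T.op t x, Or.inl ⟨t, ⟨zero_le, ht⟩, rfl⟩, by simpa using he⟩
    set y := T.op (t - τ) x with hy
    have hty : T.op t x = T.op τ y := by
      rw [hy, ← T.op_add_apply, add_tsub_cancel_of_le ht]
    have hvar := op_sub_op_eq_integral T S hS B hTS (T.op_mem_generatorGraph hxa (t - τ)) τ
    have hτ' : (0 : ℝ) < τ := hτ
    have hcont : Continuous fun s : ℝ => S.op (τ - s).toNNReal (B (T.op s.toNNReal y)) :=
      (S.continuous_uncurry_op hS).comp ((continuous_real_toNNReal.comp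
        (continuous_const.sub continuous_id)).prodMk (B.continuous.comp (T.continuous_real y)))
    -- The integrand takes values in the compact set of all `S(r)k` with `r ≤ τ` and `k ∈ K`. Its
    -- average lies in the closed convex hull `H`, which is still compact, and the integral is `τ`
    -- times the average.
    have hmem : (⨍ s in Set.Ioc (0 : ℝ) τ, S.op (τ - s).toNNReal (B (T.op s.toNNReal y))) ∈ H := by
      refine ((convex_convexHull ℝ _).closure).set_average_mem isClosed_closure
        (by simpa using hτ.ne') (by simp) ?_ (hcont.integrableOn_Icc.mono_set Set.Ioc_subset_Icc_self)
      filter_upwards [ae_restrict_mem measurableSet_Ioc] with s hs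
      refine subset_closure (subset_convexHull ℝ _ ⟨((τ - s).toNNReal, B (T.op s.toNNReal y)),
        ⟨⟨zero_le, ?_⟩, hBK ⟨_, ?_, rfl⟩⟩, rfl⟩)
      · rw [Real.toNNReal_le_iff_le_coe]; linarith [hs.1]
      · rw [mem_closedBall_zero_iff, hy, ← T.op_add_apply]
        exact hT _ _
    refine ⟨_, Or.inr ⟨_, hmem, rfl⟩, ?_⟩
    beta_reduce
    rw [setAverage_eq, measureReal_def, Real.volume_Ioc, sub_zero, ENNReal.toReal_ofReal hτ'.le,
      smul_inv_smul₀ hτ'.ne', ← intervalIntegral.integral_of_le hτ'.le, ← hvar, ← hy, hty,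
      dist_eq_norm, sub_sub_cancel]
    have h1 : ‖y‖ ≤ M * ‖x‖ := hT _ _
    have h2 : 0 ≤ M * ‖x‖ := (norm_nonneg _).trans h1
    rw [abs_of_nonneg h2] at hSτ
    calc _ ≤ _ := hSτ y
      _ ≤ e / (2 * (M * ‖x‖ + 1 + M * ‖x‖)) * (M * ‖x‖) :=
        mul_le_mul_of_nonneg_left h1 (by positivity)
      _ < e := by
        rw [div_mul_eq_mul_div, div_lt_iff₀ (by positivity)]; nlinarith
  -- An arbitrary orbit is followed uniformly in time by the orbit of a nearby point of the domain,
  -- since `T` is bounded.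
  refine totallyBounded_of_forall_approx fun e he => ?_
  obtain ⟨z, hz, a, hza⟩ := Metric.dense_iff.1 hdense x (e / (|M| + 1)) (by positivity)
  refine ⟨_, hdom z a hza, ?_⟩
  rintro _ ⟨t, rfl⟩
  refine ⟨_, ⟨t, rfl⟩, ?_⟩
  rw [Metric.mem_ball, dist_comm, dist_eq_norm] at hz
  rw [dist_eq_norm, ← map_sub]
  calc _ ≤ M * ‖x - z‖ := hT _ _
    _ ≤ |M| * ‖x - z‖ := mul_le_mul_of_nonneg_right (le_abs_self M) (norm_nonneg _)
    _ ≤ |M| * (e / (|M| + 1)) := mul_le_mul_of_nonneg_left hz.le (abs_nonneg _)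
    _ < e := by rw [← mul_div_assoc, div_lt_iff₀ (by positivity)]; nlinarith [abs_nonneg M]

theorem omegaLimitSet_subset {T : C0Semigroup X} {x : X} {S : Set X} (hS : IsClosed S)
    (h : ∀ t, T.op t x ∈ S) : omegaLimitSet T x ⊆ S := by
  refine (Set.iInter_subset _ 0).trans (hS.closure_subset_iff.2 ?_)
  rintro _ ⟨s, -, rfl⟩
  exact h s

theorem omegaLimitSet_nonempty_isCompact [CompleteSpace X] {T : C0Semigroup X} {x : X}
    (h : TotallyBounded (Set.range fun t => T.op t x)) :
    (omegaLimitSet T x).Nonempty ∧ IsCompact (omegaLimitSet T x) := by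
  have hK : IsCompact (closure (Set.range fun t => T.op t x)) :=
    isCompact_iff_totallyBounded_isComplete.2 ⟨h.closure, isClosed_closure.isComplete⟩
  have hsub : ∀ t : ℝ≥0, closure {z | ∃ s : ℝ≥0, t ≤ s ∧ z = T.op s x} ⊆
      closure (Set.range fun t => T.op t x) := fun t => closure_mono (by
    rintro _ ⟨s, -, rfl⟩; exact ⟨s, rfl⟩)
  constructor
  · refine IsCompact.nonempty_iInter_of_directed_nonempty_isCompact_isClosed _ ?_
      (fun t => ⟨_, subset_closure ⟨t, le_rfl, rfl⟩⟩)
      (fun t => hK.of_isClosed_subset isClosed_closure (hsub t)) (fun t => isClosed_closure)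
    refine directed_of_isDirected_le fun t r htr => closure_mono ?_
    rintro _ ⟨s, hs, rfl⟩
    exact ⟨s, htr.trans hs, rfl⟩
  · exact hK.of_isClosed_subset (isClosed_iInter fun t => isClosed_closure)
      ((Set.iInter_subset _ 0).trans (hsub 0))

/-- The semigroup `e^{- d t} S(t)`. -/
noncomputable def C0Semigroup.rescale (S : C0Semigroup X) (d : ℝ) : C0Semigroup X where
  op t := Real.exp (-(d * t)) • S.op t
  op_zero := by simp [S.op_zero]
  op_add s t := by
    refine ContinuousLinearMap.ext fun x => ?_
    simp [S.op_add, smul_smul, ← Real.exp_add, mul_add, add_comm]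
  strongly_continuous x := by
    have := S.strongly_continuous x
    simp only [smul_apply]
    fun_prop

theorem C0Semigroup.mem_generatorGraph_rescale (S : C0Semigroup X) (d : ℝ) {x a : X}
    (h : (x, a) ∈ generatorGraph fun t x => S.op t x) :
    (x, a - d • x) ∈ generatorGraph fun t x => (S.rescale d).op t x := by
  rw [mem_generatorGraph_iff_hasDerivWithinAt ((S.rescale d).op_zero_apply x)]
  have h1 := (mem_generatorGraph_iff_hasDerivWithinAt (T := fun t x => S.op t x)
    (S.op_zero_apply x)).1 h
  have h2 : HasDerivWithinAt (fun t : ℝ => Real.exp (-(d * t))) (-d) (Set.Ioi 0) 0 := by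
    have : HasDerivAt (fun t : ℝ => Real.exp (-(d * t))) (Real.exp (-(d * 0)) * (-(d * 1))) 0 :=
      (((hasDerivAt_id (0 : ℝ)).const_mul d).neg).exp
    simpa using this.hasDerivWithinAt (s := Set.Ioi 0)
  have h3 := h2.fun_smul h1
  have e : a - d • x = Real.exp (-(d * 0)) • a + (-d) • S.op (Real.toNNReal 0) x := by
    simp [S.op_zero_apply, sub_eq_add_neg]
  rw [e]
  refine h3.congr (fun t (ht : 0 < t) => ?_) ?_
  · simp [C0Semigroup.rescale, Real.coe_toNNReal t ht.le]
  · simp [C0Semigroup.rescale]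

end Orbits

end ReturnHome

/-! ### The coupled system over an abstract mass preserving, positive generator. -/

namespace ReturnHome

/-! ### Integrals of elements of `L¹` -/

section Integrals

theorem L1_integrable (v : L1) : Integrable v volume := L1.integrable_coeFn v

theorem L1_norm_eq (v : L1) : ‖v‖ = ∫ x, |v x| := by
  rw [L1.norm_eq_integral_norm]; rfl

theorem L1_integral_add (v w : L1) : ∫ x, (v + w) x = (∫ x, v x) + ∫ x, w x := by
  rw [← integral_add (L1_integrable v) (L1_integrable w)]
  exact integral_congr_ae (Lp.coeFn_add v w)

theorem L1_integral_smul (c : ℝ) (v : L1) : ∫ x, (c • v) x = c * ∫ x, v x := by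
  rw [← integral_const_mul]
  exact integral_congr_ae (Lp.coeFn_smul c v)

/-- The integral, as a continuous linear functional on `L¹`. -/
noncomputable def integralL1 : L1 →L[ℝ] ℝ :=
  LinearMap.mkContinuous
    { toFun := fun v => ∫ x, v x
      map_add' := L1_integral_add
      map_smul' := L1_integral_smul } 1 fun v => by
    rw [one_mul, L1_norm_eq]
    exact abs_integral_le_integral_abs

theorem integralL1_apply (v : L1) : integralL1 v = ∫ x, v x := rfl

theorem abs_integralL1_le (v : L1) : |integralL1 v| ≤ ‖v‖ := by
  rw [L1_norm_eq]; exact abs_integral_le_integral_abs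

/-- The integral of the negative part. -/
noncomputable def negInt (v : L1) : ℝ := ∫ x, max (-v x) 0

theorem integrable_negPart (v : L1) : Integrable (fun x => max (-v x) 0) volume :=
  (L1_integrable v).neg_part

theorem negInt_nonneg (v : L1) : 0 ≤ negInt v := integral_nonneg fun _ => le_max_right _ _

theorem nonneg_of_negInt_eq_zero {v : L1} (h : negInt v = 0) : 0 ≤ v := by
  have h := (integral_eq_zero_iff_of_nonneg (f := fun x => max (-v x) 0)
    (fun _ => le_max_right _ _) (integrable_negPart v)).1 h
  rw [← Lp.coeFn_nonneg]
  filter_upwards [h] with x hx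
  have := le_max_left (-v x) 0
  simp only [Pi.zero_apply] at hx ⊢
  linarith

theorem negInt_anti {v w : L1} (h : v ≤ w) : negInt w ≤ negInt v := by
  refine integral_mono_ae (integrable_negPart w) (integrable_negPart v) ?_
  filter_upwards [(Lp.coeFn_le v w).2 h] with x hx
  exact max_le_max (neg_le_neg hx) le_rfl

theorem negInt_smul {c : ℝ} (hc : 0 ≤ c) (v : L1) : negInt (c • v) = c * negInt v := by
  rw [negInt, negInt, ← integral_const_mul]
  refine integral_congr_ae ?_
  filter_upwards [Lp.coeFn_smul c v] with x hx
  rw [hx, Pi.smul_apply, smul_eq_mul, mul_max_of_nonneg _ _ hc, mul_zero, mul_neg]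

/-- Reduces norm estimates to one-sided estimates applied to `v` and to `-v`. -/
theorem norm_eq_negInt_add (v : L1) : ‖v‖ = negInt v + negInt (-v) := by
  rw [negInt, negInt, ← integral_add (integrable_negPart v) (integrable_negPart (-v)), L1_norm_eq]
  refine integral_congr_ae ?_
  filter_upwards [Lp.coeFn_neg v] with x hx
  simp only [hx, Pi.neg_apply, neg_neg]
  rcases le_total 0 (v x) with h | h
  · rw [abs_of_nonneg h, max_eq_right (by linarith), max_eq_left h, zero_add]
  · rw [abs_of_nonpos h, max_eq_left (by linarith), max_eq_right h, add_zero]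

theorem neg_negInt_le_integralL1 (v : L1) : -negInt v ≤ integralL1 v := by
  rw [negInt, ← integral_neg]
  refine integral_mono (integrable_negPart v).neg (L1_integrable v) fun x => ?_
  have := le_max_left (-v x) 0
  change -(max (-v x) 0) ≤ v x
  linarith

theorem negInt_smul_le (c : ℝ) {g : L1} (hg : 0 ≤ g) : negInt (c • g) ≤ max (-c) 0 * ‖g‖ := by
  rw [negInt, L1_norm_eq, ← integral_const_mul]
  refine integral_mono_ae (integrable_negPart _) ((L1_integrable g).abs.const_mul _) ?_
  filter_upwards [Lp.coeFn_smul c g, (Lp.coeFn_nonneg g).2 hg] with x hx hgx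
  simp only [Pi.zero_apply] at hgx
  rw [hx, Pi.smul_apply, smul_eq_mul, abs_of_nonneg hgx, max_mul_of_nonneg _ _ hgx, zero_mul,
    neg_mul]

theorem norm_eq_integralL1_of_nonneg {g : L1} (hg : 0 ≤ g) : ‖g‖ = integralL1 g := by
  rw [L1_norm_eq, integralL1_apply]
  refine integral_congr_ae ?_
  filter_upwards [(Lp.coeFn_nonneg g).2 hg] with x hx using abs_of_nonneg hx

theorem measurableSet_neg (v : L1) : MeasurableSet {x | v x < 0} :=
  (Lp.stronglyMeasurable v).measurable measurableSet_Iio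

theorem negInt_eq_setIntegral (v : L1) : negInt v = ∫ x in {x | v x < 0}, -v x := by
  rw [negInt, ← integral_indicator (measurableSet_neg v)]
  congr 1; ext x
  by_cases h : v x < 0
  · rw [Set.indicator_of_mem (by exact h), max_eq_left (by linarith)]
  · rw [Set.indicator_of_notMem (by exact h), max_eq_right (by linarith)]

/-- Resolvent estimate for the negative parts. -/
theorem mul_negInt_le {v a : L1} (h : 0 ≤ ∫ x in {x | v x < 0}, a x) (c : ℝ) :
    c * negInt v ≤ negInt (c • v - a) := by
  -- Over `{v < 0}` the integral of `-(c v - a)` is `c * negInt v` plus the nonnegative integral of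
  -- `a`; over any set it is at most the integral of the negative part.
  have h1 : c * negInt v ≤ ∫ x in {x | v x < 0}, -(c • v - a) x := by
    have e : ∫ x in {x | v x < 0}, -(c • v - a) x =
        c * negInt v + ∫ x in {x | v x < 0}, a x := by
      have i1 : Integrable (fun x => c * -v x) volume := (L1_integrable v).neg.const_mul c
      rw [negInt_eq_setIntegral, ← integral_const_mul, ← integral_add i1.integrableOn
        (L1_integrable a).integrableOn]
      refine integral_congr_ae (ae_restrict_of_ae ?_)
      filter_upwards [Lp.coeFn_sub (c • v) a, Lp.coeFn_smul c v] with x h1 h2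
      rw [h1, Pi.sub_apply, h2, Pi.smul_apply, smul_eq_mul]; ring
    linarith
  refine h1.trans ?_
  rw [negInt, ← integral_indicator (measurableSet_neg v)]
  refine integral_mono ((L1_integrable _).neg.indicator (measurableSet_neg v))
    (integrable_negPart _) fun x => ?_
  by_cases h : v x < 0
  · rw [Set.indicator_of_mem (by exact h)]; exact le_max_left _ _
  · rw [Set.indicator_of_notMem (by exact h)]; exact le_max_right _ _

end Integrals

/-! ### The full system, for an abstract transport and diffusion operator -/

/-- The properties of the operator `A + B` that are used: it generates a semigroup of positive,
mass preserving operators. -/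
structure MarkovGenerator (E : Submodule ℝ (L1 × L1)) : Prop where
  setIntegral_nonneg : ∀ p ∈ E, 0 ≤ ∫ x in {x | p.1 x < 0}, p.2 x
  integral_eq_zero : ∀ p ∈ E, integralL1 p.2 = 0
  surjective : ∃ l₀ : ℝ, 0 ≤ l₀ ∧ ∀ l, l₀ < l → ∀ f, ∃ p ∈ E, l • p.1 - p.2 = f
  dense : Dense {v | ∃ a, (v, a) ∈ E}

section System

variable {E : Submodule ℝ (L1 × L1)}

theorem MarkovGenerator.mul_negInt_le (hE : MarkovGenerator E) {p : L1 × L1} (hp : p ∈ E) (c : ℝ) :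
    c * negInt p.1 ≤ negInt (c • p.1 - p.2) :=
  ReturnHome.mul_negInt_le (hE.setIntegral_nonneg p hp) c

/-- Dissipativity in `L¹` is the sum of the one-sided estimates for `p` and for `-p`. -/
theorem MarkovGenerator.mul_norm_le (hE : MarkovGenerator E) {p : L1 × L1} (hp : p ∈ E) (c : ℝ) :
    c * ‖p.1‖ ≤ ‖c • p.1 - p.2‖ := by
  have h1 := hE.mul_negInt_le hp c
  have h2 := hE.mul_negInt_le (E.neg_mem hp) c
  have e : c • (-p).1 - (-p).2 = -(c • p.1 - p.2) := by
    rw [Prod.fst_neg, Prod.snd_neg]; module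
  rw [e, Prod.fst_neg] at h2
  rw [norm_eq_negInt_add p.1, norm_eq_negInt_add (c • p.1 - p.2)]
  linarith

/-- The operator `(u, v, w) ↦ (χ ∫ w, γ u g, 0)`. -/
noncomputable def couplingCLM (γ χ : ℝ) (g : L1) : State →L[ℝ] State :=
  ContinuousLinearMap.prod
    (χ • integralL1.comp ((ContinuousLinearMap.snd ℝ L1 L1).comp (ContinuousLinearMap.snd ℝ ℝ _)))
    (ContinuousLinearMap.prod
      (((γ • ContinuousLinearMap.fst ℝ ℝ (L1 × L1))).smulRight g) 0)

theorem couplingCLM_apply (γ χ : ℝ) (g : L1) (p : State) :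
    couplingCLM γ χ g p = (χ * integralL1 p.2.2, (γ * p.1) • g, 0) := rfl

/-- The operator sees a state only through two numbers, so it factors through `ℝ × ℝ`, where bounded
sets are relatively compact. -/
theorem isCompactOperator_couplingCLM (γ χ : ℝ) (g : L1) :
    IsCompactOperator (couplingCLM γ χ g) := by
  let L : State →L[ℝ] ℝ × ℝ := ContinuousLinearMap.prod
    (χ • integralL1.comp ((ContinuousLinearMap.snd ℝ L1 L1).comp (ContinuousLinearMap.snd ℝ ℝ _)))
    (γ • ContinuousLinearMap.fst ℝ ℝ (L1 × L1))
  have hc : Continuous fun q : ℝ × ℝ => ((q.1, q.2 • g, 0) : State) := by fun_prop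
  refine ⟨(fun q : ℝ × ℝ => ((q.1, q.2 • g, 0) : State)) '' Metric.closedBall 0 1,
    (isCompact_closedBall _ _).image hc, ?_⟩
  filter_upwards [L.continuous.continuousAt.preimage_mem_nhds
    (by simpa using Metric.closedBall_mem_nhds (0 : ℝ × ℝ) one_pos)] with p hp
  exact ⟨L p, hp, rfl⟩

/-- The graph of `(u, v, w) ↦ (- γ u, E v - α v, α v - χ w) + L (u, v, w)`. -/
def systemSubmodule (E : Submodule ℝ (L1 × L1)) (α γ χ : ℝ) (L : State →L[ℝ] State) :
    Submodule ℝ (State × State) where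
  carrier := {p | (p.1.2.1, (p.2 - L p.1).2.1 + α • p.1.2.1) ∈ E ∧
    (p.2 - L p.1).1 = -(γ * p.1.1) ∧ (p.2 - L p.1).2.2 = α • p.1.2.1 - χ • p.1.2.2}
  add_mem' := by
    rintro p q ⟨h1, h2, h3⟩ ⟨h4, h5, h6⟩
    have e : (p + q).2 - L (p + q).1 = (p.2 - L p.1) + (q.2 - L q.1) := by
      rw [Prod.fst_add, Prod.snd_add, map_add]; abel
    simp only [Set.mem_ofPred_eq, e]
    refine ⟨?_, ?_, ?_⟩
    · convert E.add_mem h1 h4 using 1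
      refine Prod.ext rfl ?_
      simp only [Prod.snd_add, Prod.fst_add, smul_add]; abel
    · rw [Prod.fst_add, h2, h5, Prod.fst_add, Prod.fst_add]; ring
    · simp only [Prod.snd_add, Prod.fst_add, smul_add, h3, h6]; abel
  zero_mem' := by
    simp only [Set.mem_ofPred_eq, Prod.fst_zero, Prod.snd_zero, map_zero, sub_zero, smul_zero,
      add_zero, mul_zero, neg_zero, and_self, and_true]
    exact E.zero_mem
  smul_mem' := by
    rintro c p ⟨h1, h2, h3⟩
    have e : (c • p).2 - L (c • p).1 = c • (p.2 - L p.1) := by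
      rw [Prod.smul_fst, Prod.smul_snd, map_smul, smul_sub]
    simp only [Set.mem_ofPred_eq, e]
    refine ⟨?_, ?_, ?_⟩
    · convert E.smul_mem c h1 using 1
      refine Prod.ext rfl ?_
      simp only [Prod.smul_snd, Prod.smul_fst, smul_add, smul_comm c α]
    · rw [Prod.smul_fst, h2, Prod.smul_fst, Prod.smul_fst, smul_eq_mul, smul_eq_mul]; ring
    · simp only [Prod.smul_snd, Prod.smul_fst, h3]
      rw [smul_sub, smul_comm c α, smul_comm c χ]

theorem mem_systemSubmodule {α γ χ : ℝ} {L : State →L[ℝ] State} {p : State × State} :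
    p ∈ systemSubmodule E α γ χ L ↔ ∃ (u : ℝ) (v w a : L1), (v, a) ∈ E ∧
      p = ((u, v, w), (-(γ * u), a - α • v, α • v - χ • w) + L (u, v, w)) := by
  constructor
  · rintro ⟨h1, h2, h3⟩
    refine ⟨p.1.1, p.1.2.1, p.1.2.2, _, h1, Prod.ext rfl ?_⟩
    change p.2 = _ + L p.1
    rw [← sub_eq_iff_eq_add]
    refine Prod.ext h2 (Prod.ext ?_ h3)
    simp
  · rintro ⟨u, v, w, a, h, rfl⟩
    refine ⟨?_, ?_, ?_⟩
    · simpa using h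
    · simp
    · simp

theorem dense_domain_systemSubmodule (hE : MarkovGenerator E) (α γ χ : ℝ)
    (L : State →L[ℝ] State) : Dense {x | ∃ a, (x, a) ∈ systemSubmodule E α γ χ L} := by
  refine (dense_univ.prod (hE.dense.prod dense_univ)).mono ?_
  rintro ⟨u, v, w⟩ ⟨-, ⟨a, ha⟩, -⟩
  exact ⟨_, mem_systemSubmodule.2 ⟨u, v, w, a, ha, rfl⟩⟩

/-- The weighted norm `|u| + k ‖v‖ + ‖w‖`. -/
noncomputable def weightedNorm (k : ℝ≥0) : Seminorm ℝ State :=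
  (normSeminorm ℝ ℝ).comp (LinearMap.fst ℝ ℝ (L1 × L1)) +
    (k • (normSeminorm ℝ L1).comp ((LinearMap.fst ℝ L1 L1).comp (LinearMap.snd ℝ ℝ (L1 × L1))) +
      (normSeminorm ℝ L1).comp ((LinearMap.snd ℝ L1 L1).comp (LinearMap.snd ℝ ℝ (L1 × L1))))

theorem weightedNorm_apply (k : ℝ≥0) (p : State) :
    weightedNorm k p = |p.1| + (k * ‖p.2.1‖ + ‖p.2.2‖) := rfl

theorem weightedNorm_le (k : ℝ≥0) (p : State) : weightedNorm k p ≤ (k + 2) * ‖p‖ := by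
  have h1 : |p.1| ≤ ‖p‖ := norm_fst_le p
  have h2 : ‖p.2.1‖ ≤ ‖p‖ := (norm_fst_le p.2).trans (norm_snd_le p)
  have h3 : ‖p.2.2‖ ≤ ‖p‖ := (norm_snd_le p.2).trans (norm_snd_le p)
  rw [weightedNorm_apply]
  nlinarith [mul_le_mul_of_nonneg_left h2 k.coe_nonneg]

theorem norm_le_weightedNorm {k : ℝ≥0} (hk : 1 ≤ k) (p : State) :
    ‖p‖ ≤ (k + 2) * weightedNorm k p := by
  have hk' : (1 : ℝ) ≤ k := hk
  have h0 : ‖p‖ ≤ weightedNorm k p := by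
    rw [weightedNorm_apply, Prod.norm_def, Prod.norm_def]
    have h1 := abs_nonneg p.1
    have h2 := norm_nonneg p.2.1
    have h3 := norm_nonneg p.2.2
    refine max_le ?_ (max_le ?_ ?_)
    · rw [Real.norm_eq_abs]; nlinarith
    · nlinarith
    · nlinarith
  nlinarith [apply_nonneg (weightedNorm k) p]

/-- One estimate serves two purposes: `θ = 1`, `δ = 0`, `k = 1` is the full system, and `θ = 0`, `δ
> 0`, `k = 2` is the uncoupled one shifted by its decay rate. The three component estimates are
added with weights `1`, `k`, `1`; the hypotheses `h1`, `h2`, `h3` say that the leftover coefficients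
of `|u|`, `‖v‖`, `‖w‖` have the right sign. -/
theorem systemSubmodule_dissipative (hE : MarkovGenerator E) {α γ χ θ δ : ℝ} {k : ℝ≥0} {g : L1}
    (hα : 0 < α) (hγ : 0 < γ) (hχ : 0 < χ) (hθ : 0 ≤ θ) (hk : 1 ≤ k) (hg : ‖g‖ ≤ 1)
    (h1 : δ + k * (θ * γ) ≤ γ) (h2 : k * δ + α ≤ k * α) (h3 : δ + θ * χ ≤ χ)
    {p : State × State}
    (hp : p ∈ systemSubmodule E α γ χ
      (θ • couplingCLM γ χ g + δ • ContinuousLinearMap.id ℝ State)) {l : ℝ} (hl : 0 < l) :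
    l * weightedNorm k p.1 ≤ weightedNorm k (l • p.1 - p.2) := by
  obtain ⟨u, v, w, a, ha, rfl⟩ := mem_systemSubmodule.1 hp
  have hk' : (1 : ℝ) ≤ k := hk
  simp only [weightedNorm_apply, add_apply, smul_apply, couplingCLM_apply,
    ContinuousLinearMap.id_apply, Prod.fst_sub, Prod.snd_sub, Prod.fst_add, Prod.snd_add,
    Prod.smul_fst, Prod.smul_snd, smul_zero, smul_eq_mul, zero_add]
  set f₁ : ℝ := l * u - (-(γ * u) + (θ * (χ * integralL1 w) + δ * u)) with hf₁
  set f₂ : L1 := l • v - (a - α • v + (θ • (γ * u) • g + δ • v)) with hf₂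
  set f₃ : L1 := l • w - (α • v - χ • w + δ • w) with hf₃
  have d1 : 0 < l + γ - δ := by nlinarith [mul_nonneg hθ hγ.le]
  have d2 : 0 < l + α - δ := by nlinarith
  have d3 : 0 < l + χ - δ := by nlinarith [mul_nonneg hθ hχ.le]
  have b1 : (l + γ - δ) * |u| ≤ |f₁| + θ * χ * ‖w‖ := by
    have e : (l + γ - δ) * u = f₁ + θ * χ * integralL1 w := by rw [hf₁]; ring
    calc (l + γ - δ) * |u| = |f₁ + θ * χ * integralL1 w| := by
          rw [← e, abs_mul, abs_of_pos d1]
      _ ≤ |f₁| + |θ * χ * integralL1 w| := abs_add_le _ _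
      _ ≤ |f₁| + θ * χ * ‖w‖ := by
        rw [abs_mul, abs_of_nonneg (mul_nonneg hθ hχ.le)]
        gcongr; exact abs_integralL1_le w
  have b2 : (l + α - δ) * ‖v‖ ≤ ‖f₂‖ + θ * γ * |u| := by
    have e : (l + α - δ) • v - a = f₂ + (θ * γ * u) • g := by rw [hf₂]; module
    calc (l + α - δ) * ‖v‖ ≤ ‖f₂ + (θ * γ * u) • g‖ := e ▸ hE.mul_norm_le ha _
      _ ≤ ‖f₂‖ + ‖(θ * γ * u) • g‖ := norm_add_le _ _
      _ ≤ ‖f₂‖ + θ * γ * |u| := by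
        rw [norm_smul, Real.norm_eq_abs, abs_mul, abs_of_nonneg (mul_nonneg hθ hγ.le)]
        exact add_le_add_right (mul_le_of_le_one_right (by positivity) hg) _
  have b3 : (l + χ - δ) * ‖w‖ ≤ ‖f₃‖ + α * ‖v‖ := by
    have e : (l + χ - δ) • w = f₃ + α • v := by rw [hf₃]; module
    calc (l + χ - δ) * ‖w‖ = ‖f₃ + α • v‖ := by
          rw [← e, norm_smul, Real.norm_of_nonneg d3.le]
      _ ≤ ‖f₃‖ + α * ‖v‖ := by
        refine (norm_add_le _ _).trans ?_
        rw [norm_smul, Real.norm_of_nonneg hα.le]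
  have b2' := mul_le_mul_of_nonneg_left b2 k.coe_nonneg
  have c1 := mul_le_mul_of_nonneg_right h1 (abs_nonneg u)
  have c2 := mul_le_mul_of_nonneg_right h2 (norm_nonneg v)
  have c3 := mul_le_mul_of_nonneg_right h3 (norm_nonneg w)
  linarith

/-- Elimination: for given `u`, the component `v` is the solution `p` for the data plus a multiple
of the solution `q` for the source `g`, and `w` is explicit in `v`. This leaves one scalar equation
for `u`. With `m = l - δ` the shift disappears. -/
theorem systemSubmodule_surjective (hE : MarkovGenerator E) {α γ χ θ δ : ℝ} {g : L1}
    (hα : 0 < α) (hγ : 0 < γ) (hχ : 0 < χ) (hθ : 0 ≤ θ) (hθ1 : θ ≤ 1) (hg : integralL1 g = 1) :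
    ∃ l₀ : ℝ, ∀ l, l₀ < l → ∀ f, ∃ p ∈ systemSubmodule E α γ χ
      (θ • couplingCLM γ χ g + δ • ContinuousLinearMap.id ℝ State), l • p.1 - p.2 = f := by
  obtain ⟨l₀, hl₀, hs⟩ := hE.surjective
  refine ⟨l₀ + δ, fun l hl f => ?_⟩
  obtain ⟨m, rfl⟩ : ∃ m, l = m + δ := ⟨l - δ, by ring⟩
  have hm : l₀ < m := by linarith
  have hm0 : 0 < m := lt_of_le_of_lt hl₀ hm
  obtain ⟨p, hp, hp'⟩ := hs (m + α) (by linarith) f.2.1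
  obtain ⟨q, hq, hq'⟩ := hs (m + α) (by linarith) g
  have hqm : (m + α) * integralL1 q.1 = 1 := by
    have := congrArg integralL1 hq'
    rwa [map_sub, map_smul, hE.integral_eq_zero q hq, sub_zero, hg, smul_eq_mul] at this
  have hqm' : integralL1 q.1 = (m + α)⁻¹ := eq_inv_of_mul_eq_one_right hqm
  -- The coefficient of `u` after elimination. The feedback through `v` and `w` is `γ` times `θ²`,
  -- `α / (m + α)` and `χ / (m + χ)`, all at most one, so `d ≥ m > 0`. The mass `(m + α)⁻¹` of `q`
  -- comes from conservation.
  set d : ℝ := m + γ - θ * χ * (α * (θ * γ) * (m + α)⁻¹) * (m + χ)⁻¹ with hd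
  have hd0 : 0 < d := by
    have e1 : α * (m + α)⁻¹ ≤ 1 := by
      rw [← div_eq_mul_inv, div_le_one (by positivity)]; linarith
    have e2 : χ * (m + χ)⁻¹ ≤ 1 := by
      rw [← div_eq_mul_inv, div_le_one (by positivity)]; linarith
    have e3 : (θ * θ) * ((α * (m + α)⁻¹) * (χ * (m + χ)⁻¹)) ≤ 1 :=
      mul_le_one₀ (by nlinarith) (by positivity)
        (mul_le_one₀ e1 (by positivity) e2)
    have e4 := mul_le_mul_of_nonneg_right e3 hγ.le
    have e5 : θ * χ * (α * (θ * γ) * (m + α)⁻¹) * (m + χ)⁻¹ =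
      (θ * θ) * ((α * (m + α)⁻¹) * (χ * (m + χ)⁻¹)) * γ := by ring
    rw [hd, e5]; linarith
  set u : ℝ := d⁻¹ * (f.1 + θ * χ * (m + χ)⁻¹ * (integralL1 f.2.2 + α * integralL1 p.1)) with hu
  set v : L1 := p.1 + (θ * γ * u) • q.1 with hv
  set w : L1 := (m + χ)⁻¹ • (f.2.2 + α • v) with hw
  refine ⟨_, mem_systemSubmodule.2 ⟨u, v, w, p.2 + (θ * γ * u) • q.2,
    E.add_mem hp (E.smul_mem (θ * γ * u) hq), rfl⟩, ?_⟩
  have hmχ : m + χ ≠ 0 := by positivity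
  have ew : (m + χ) • w = f.2.2 + α • v := by rw [hw, smul_inv_smul₀ hmχ]
  have eu : d * u = f.1 + θ * χ * (m + χ)⁻¹ * (integralL1 f.2.2 + α * integralL1 p.1) := by
    rw [hu, mul_inv_cancel_left₀ hd0.ne']
  have ewi : integralL1 w = (m + χ)⁻¹ * (integralL1 f.2.2 + α * (integralL1 p.1 +
      θ * γ * u * (m + α)⁻¹)) := by
    rw [hw, map_smul, map_add, map_smul, hv, map_add, map_smul, hqm']; rfl
  have ev : (m + α) • v - (p.2 + (θ * γ * u) • q.2) = f.2.1 + (θ * γ * u) • g := by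
    rw [hv, ← hp', ← hq']; module
  simp only [add_apply, smul_apply, couplingCLM_apply, ContinuousLinearMap.id_apply]
  refine Prod.ext ?_ (Prod.ext ?_ ?_)
  · simp only [Prod.fst_sub, Prod.fst_add, Prod.smul_fst, smul_eq_mul]
    rw [ewi]
    rw [hd] at eu
    linear_combination eu
  · simp only [Prod.fst_sub, Prod.fst_add, Prod.smul_fst, Prod.snd_sub, Prod.snd_add,
      Prod.smul_snd]
    have : f.2.1 = (m + α) • v - (p.2 + (θ * γ * u) • q.2) - (θ * γ * u) • g := by
      rw [ev]; abel
    rw [this]; module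
  · simp only [Prod.snd_sub, Prod.snd_add, Prod.smul_snd, smul_zero, zero_add]
    have : f.2.2 = (m + χ) • w - α • v := by rw [ew]; abel
    rw [this]; module

/-- The negative parts of `u`, `v`, `w` bound each other cyclically with the exchange rates `χ`,
`γ`, `α`. On summation the rates cancel, leaving `l` times the total negative part at most zero. -/
theorem systemSubmodule_positive (hE : MarkovGenerator E) {α γ χ : ℝ} {g : L1}
    (hα : 0 < α) (hγ : 0 < γ) (hχ : 0 < χ) (hg0 : 0 ≤ g) (hg : integralL1 g = 1)
    {p : State × State} (hp : p ∈ systemSubmodule E α γ χ (couplingCLM γ χ g)) {l : ℝ} (hl : 0 < l)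
    (h : l • p.1 - p.2 ∈ positiveCone) : p.1 ∈ positiveCone := by
  obtain ⟨u, v, w, a, ha, rfl⟩ := mem_systemSubmodule.1 hp
  obtain ⟨h1, h2, h3⟩ := h
  simp only [couplingCLM_apply, Prod.fst_sub, Prod.snd_sub, Prod.fst_add, Prod.snd_add,
    Prod.smul_fst, Prod.smul_snd, smul_eq_mul, add_zero] at h1 h2 h3
  have b1 : (l + γ) * max (-u) 0 ≤ χ * negInt w := by
    have := mul_le_mul_of_nonneg_left (neg_negInt_le_integralL1 w) hχ.le
    rcases max_cases (-u) 0 with ⟨h4, h5⟩ | ⟨h4, h5⟩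
    · rw [h4]; linarith
    · rw [h4, mul_zero]; exact mul_nonneg hχ.le (negInt_nonneg w)
  have b2 : (l + α) * negInt v ≤ γ * max (-u) 0 := by
    refine (hE.mul_negInt_le ha (l + α)).trans ?_
    have e : (γ * u) • g ≤ (l + α) • v - a := by
      rw [← sub_nonneg]
      convert h2 using 1; module
    refine (negInt_anti e).trans ((negInt_smul_le _ hg0).trans ?_)
    rw [norm_eq_integralL1_of_nonneg hg0, hg, mul_one, ← mul_neg, mul_max_of_nonneg _ _ hγ.le,
      mul_zero]
  have b3 : (l + χ) * negInt w ≤ α * negInt v := by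
    rw [← negInt_smul (by positivity), ← negInt_smul hα.le]
    refine negInt_anti ?_
    rw [← sub_nonneg]
    convert h3 using 1; module
  have n1 : 0 ≤ max (-u) 0 := le_max_right _ _
  have n2 := negInt_nonneg v
  have n3 := negInt_nonneg w
  have hsum : l * (max (-u) 0 + negInt v + negInt w) ≤ 0 := by linarith
  have hs : max (-u) 0 + negInt v + negInt w ≤ 0 := by
    by_contra h5; push Not at h5
    exact absurd hsum (not_le.2 (mul_pos hl h5))
  refine ⟨?_, nonneg_of_negInt_eq_zero (by linarith), nonneg_of_negInt_eq_zero (by linarith)⟩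
  have := le_max_left (-u) 0
  change 0 ≤ u
  linarith

theorem totalMass_eq (p : State) : totalMass p = p.1 + integralL1 p.2.1 + integralL1 p.2.2 := rfl

theorem totalMass_eq_zero (hE : MarkovGenerator E) {α γ χ : ℝ} {g : L1} (hg : integralL1 g = 1)
    {p : State × State} (hp : p ∈ systemSubmodule E α γ χ (couplingCLM γ χ g)) :
    totalMass p.2 = 0 := by
  obtain ⟨u, v, w, a, ha, rfl⟩ := mem_systemSubmodule.1 hp
  have := hE.integral_eq_zero _ ha
  simp only [totalMass_eq, couplingCLM_apply, Prod.fst_add, Prod.snd_add, map_add, map_sub,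
    map_smul, map_zero, hg, smul_eq_mul]
  simp only at this
  rw [this]; ring

theorem continuous_totalMass : Continuous totalMass :=
  (continuous_fst.add (integralL1.continuous.comp (continuous_fst.comp continuous_snd))).add
    (integralL1.continuous.comp (continuous_snd.comp continuous_snd))

theorem isClosed_positiveCone : IsClosed positiveCone := by
  simp only [positiveCone, Set.ofPred_and]
  exact (isClosed_le continuous_const continuous_fst).inter
    ((isClosed_le continuous_const (continuous_fst.comp continuous_snd)).inter
      (isClosed_le continuous_const (continuous_snd.comp continuous_snd)))

theorem L1_smul_nonneg {c : ℝ} (hc : 0 ≤ c) {v : L1} (hv : 0 ≤ v) : 0 ≤ c • v := by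
  rw [← Lp.coeFn_nonneg] at hv ⊢
  filter_upwards [hv, Lp.coeFn_smul c v] with x h1 h2
  rw [h2]
  exact mul_nonneg hc h1

theorem smul_mem_positiveCone {c : ℝ} (hc : 0 ≤ c) {p : State} (hp : p ∈ positiveCone) :
    c • p ∈ positiveCone :=
  ⟨mul_nonneg hc hp.1, L1_smul_nonneg hc hp.2.1, L1_smul_nonneg hc hp.2.2⟩

theorem convex_positiveCone : Convex ℝ positiveCone := by
  intro p hp q hq a b ha hb _
  have h1 := smul_mem_positiveCone ha hp
  have h2 := smul_mem_positiveCone hb hq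
  exact ⟨add_nonneg h1.1 h2.1, add_nonneg h1.2.1 h2.2.1, add_nonneg h1.2.2 h2.2.2⟩

theorem convex_totalMass_eq (m : ℝ) : Convex ℝ {p | totalMass p = m} := by
  intro p hp q hq a b _ _ hab
  simp only [Set.mem_ofPred_eq, totalMass_eq, Prod.fst_add, Prod.snd_add, Prod.smul_fst,
    Prod.smul_snd, map_add, map_smul, smul_eq_mul] at hp hq ⊢
  linear_combination a * hp + b * hq + m * hab

/-- Well-posedness and omega-limit sets for the full system. -/
theorem exists_semigroup_and_omegaLimitSet (hE : MarkovGenerator E) {α γ χ : ℝ} {g : L1}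
    (hα : 0 < α) (hγ : 0 < γ) (hχ : 0 < χ) (hg0 : 0 ≤ g) (hg : integralL1 g = 1) :
    (∃ T : C0Semigroup State, T.IsGeneratedBy
      (systemSubmodule E α γ χ (couplingCLM γ χ g) : Set (State × State))) ∧
    ∀ T : C0Semigroup State, T.IsGeneratedBy
      (systemSubmodule E α γ χ (couplingCLM γ χ g) : Set (State × State)) →
      ∀ x₀ : State, (omegaLimitSet T x₀).Nonempty ∧ IsCompact (omegaLimitSet T x₀) ∧
        (x₀ ∈ positiveCone → ∀ m, totalMass x₀ = m →
          omegaLimitSet T x₀ ⊆ {p | p ∈ positiveCone ∧ totalMass p = m}) := by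
  have hgn : ‖g‖ ≤ 1 := by rw [norm_eq_integralL1_of_nonneg hg0, hg]
  have hcoup : couplingCLM γ χ g =
      (1 : ℝ) • couplingCLM γ χ g + (0 : ℝ) • ContinuousLinearMap.id ℝ State := by
    rw [one_smul, zero_smul, add_zero]
  obtain ⟨l₀, hs⟩ := systemSubmodule_surjective (δ := 0) hE hα hγ hχ zero_le_one le_rfl hg
  rw [← hcoup] at hs
  -- In the unweighted norm the exchange terms balance exactly: the three weight conditions hold
  -- with equality.
  obtain ⟨T, hT, hTN, hTS⟩ := exists_semigroup_of_dissipative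
    (systemSubmodule E α γ χ (couplingCLM γ χ g)) (N := weightedNorm 1) (K := (1 : ℝ≥0) + 2)
    (by positivity) (weightedNorm_le 1) (norm_le_weightedNorm le_rfl)
    (fun p hp l hl => by
      rw [hcoup] at hp
      exact systemSubmodule_dissipative hE hα hγ hχ zero_le_one le_rfl hgn (by simp) (by simp)
        (by simp) hp hl)
    hs (dense_domain_systemSubmodule hE α γ χ _)
  refine ⟨⟨T, hT⟩, fun T' hT' => ?_⟩
  have hbound : ∀ (k : ℝ≥0), 1 ≤ k → ∀ U : C0Semigroup State,
      (∀ t x, weightedNorm k (U.op t x) ≤ weightedNorm k x) →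
      ∀ t x, ‖U.op t x‖ ≤ ((k : ℝ) + 2) * (k + 2) * ‖x‖ := fun k hk U hU t x => by
    calc ‖U.op t x‖ ≤ (k + 2) * weightedNorm k (U.op t x) := norm_le_weightedNorm hk _
      _ ≤ (k + 2) * ((k + 2) * ‖x‖) := by
        gcongr; exact (hU t x).trans (weightedNorm_le k x)
      _ = _ := by ring
  have hdense : Dense {x | ∃ a, (x, a) ∈ generatorGraph fun t x => T.op t x} := by
    have h1 : generatorGraph (fun t x => T.op t x) = _ := hT
    rw [h1]; exact dense_domain_systemSubmodule hE α γ χ _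
  have hTT : ∀ t, T'.op t = T.op t := fun t =>
    op_eq_of_generatorGraph_eq T' T (hbound 1 le_rfl T hTN) (Eq.trans hT' hT.symm) hdense t
  have homega : ∀ x, omegaLimitSet T' x = omegaLimitSet T x := fun x => by
    simp only [omegaLimitSet, hTT]
  -- the uncoupled system is exponentially stable
  set δ : ℝ := min γ (min (α / 2) χ) with hδ
  have hδ0 : 0 < δ := lt_min hγ (lt_min (by positivity) hχ)
  have hδ1 : δ ≤ γ := min_le_left _ _
  have hδ2 : δ ≤ α / 2 := (min_le_right _ _).trans (min_le_left _ _)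
  have hδ3 : δ ≤ χ := (min_le_right _ _).trans (min_le_right _ _)
  obtain ⟨l₁, hs₁⟩ := systemSubmodule_surjective (δ := δ) hE hα hγ hχ le_rfl zero_le_one hg
  -- Without coupling, the only transfer is `α ‖v‖` from `v` to `w`. Weight `2` on `v` pays for it
  -- when `2δ + α ≤ 2α`, whence the `α / 2` in `δ`. As `S` is a contraction semigroup for the
  -- generator shifted by `δ`, multiplying it by `e^{-δt}` gives decay.
  obtain ⟨S, hS, hSN, -⟩ := exists_semigroup_of_dissipative
    (systemSubmodule E α γ χ ((0 : ℝ) • couplingCLM γ χ g + δ • ContinuousLinearMap.id ℝ State))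
    (N := weightedNorm 2) (K := (2 : ℝ≥0) + 2)
    (by positivity) (weightedNorm_le 2) (norm_le_weightedNorm one_le_two)
    (fun p hp l hl => systemSubmodule_dissipative hE hα hγ hχ le_rfl one_le_two hgn
        (by simpa using hδ1) (by norm_num; linarith) (by simpa using hδ3) hp hl)
    hs₁ (dense_domain_systemSubmodule hE α γ χ _)
  have hSb : ∀ t x, ‖S.op t x‖ ≤ 16 * ‖x‖ := fun t x =>
    (hbound 2 one_le_two S hSN t x).trans_eq (by norm_num)
  have hTb : ∀ t x, ‖T.op t x‖ ≤ 9 * ‖x‖ := fun t x =>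
    (hbound 1 le_rfl T hTN t x).trans_eq (by norm_num)
  have hSd : ∀ t x, ‖(S.rescale δ).op t x‖ ≤ Real.exp (-(δ * t)) * (16 * ‖x‖) := fun t x => by
    change ‖Real.exp (-(δ * t)) • S.op t x‖ ≤ _
    rw [norm_smul, Real.norm_of_nonneg (Real.exp_pos _).le]
    exact mul_le_mul_of_nonneg_left (hSb t x) (Real.exp_pos _).le
  intro x₀
  rw [homega]
  have htb := totallyBounded_orbit T (S.rescale δ) (M := 16)
    (fun t x => (hTb t x).trans (by gcongr; norm_num))
    (fun t x => (hSd t x).trans (mul_le_of_le_one_left (by positivity)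
      (Real.exp_le_one_iff.2 (neg_nonpos.2 (mul_nonneg hδ0.le t.2)))))
    (fun e he => by
      have h1 : Tendsto (fun t : ℝ => Real.exp (-(δ * t)) * 16) atTop (𝓝 (0 * 16)) :=
        (Real.tendsto_exp_neg_atTop_nhds_zero.comp
          (tendsto_id.const_mul_atTop hδ0)).mul_const 16
      rw [zero_mul] at h1
      obtain ⟨t, ht, ht'⟩ := ((h1.eventually (gt_mem_nhds he)).and (eventually_gt_atTop 0)).exists
      refine ⟨⟨t, ht'.le⟩, ht', fun x => (hSd _ x).trans ?_⟩
      rw [← mul_assoc]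
      exact mul_le_mul_of_nonneg_right ht.le (norm_nonneg x))
    (couplingCLM γ χ g) (isCompactOperator_couplingCLM γ χ g)
    (fun x a hxa => by
      have h1 : (x, a) ∈ systemSubmodule E α γ χ (couplingCLM γ χ g) := by
        rw [← SetLike.mem_coe, ← show generatorGraph (fun t x => T.op t x) = _ from hT]; exact hxa
      obtain ⟨u, v, w, b, hb, h2⟩ := mem_systemSubmodule.1 h1
      obtain ⟨rfl, rfl⟩ := Prod.mk.inj h2
      have h3 : ((u, v, w), (-(γ * u), b - α • v, α • v - χ • w) + δ • (u, v, w)) ∈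
          generatorGraph fun t x => S.op t x := by
        rw [show generatorGraph (fun t x => S.op t x) = _ from hS, SetLike.mem_coe,
          mem_systemSubmodule]
        exact ⟨u, v, w, b, hb, by simp⟩
      have h4 := S.mem_generatorGraph_rescale δ h3
      rw [add_sub_cancel_right] at h4 ⊢
      exact h4) hdense x₀
  obtain ⟨h1, h2⟩ := omegaLimitSet_nonempty_isCompact htb
  refine ⟨h1, h2, fun hx m hm => Set.subset_inter ?_ ?_⟩
  · refine omegaLimitSet_subset isClosed_positiveCone fun t => ?_
    exact hTS _ isClosed_positiveCone convex_positiveCone (fun p hp l hl hpl =>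
      smul_mem_positiveCone hl.le (systemSubmodule_positive hE hα hγ hχ hg0 hg hp hl hpl)) t x₀ hx
  · have hc : IsClosed {p | totalMass p = m} := isClosed_eq continuous_totalMass continuous_const
    refine omegaLimitSet_subset hc fun t => ?_
    refine hTS _ hc (convex_totalMass_eq m) (fun p hp l hl hpl => ?_) t x₀ hm
    -- The generator produces no mass, so `l • p.1 - p.2` and `l • p.1` have the same total mass.
    have h3 := totalMass_eq_zero hE hg hp
    simp only [Set.mem_ofPred_eq, totalMass_eq, Prod.fst_sub, Prod.snd_sub, map_sub] at hpl h3 ⊢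
    linarith

end System

end ReturnHome

/-! ### The heat semigroup on `L¹` and Laplace transforms. -/

namespace ReturnHome

/-! ### The heat kernel -/

section Kernel

theorem integral_exp_neg_mul_sq {b : ℝ} (hb : 0 < b) :
    ∫ x : Plane, Real.exp (-b * ‖x‖ ^ 2) = Real.pi / b := by
  rw [GaussianFourier.integral_rexp_neg_mul_sq_norm hb]
  simp

theorem integrable_exp_neg_mul_sq {b : ℝ} (hb : 0 < b) :
    Integrable (fun x : Plane => Real.exp (-b * ‖x‖ ^ 2)) volume := by
  -- A non-integrable function has integral `0` by convention, whereas this integral is the positive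
  -- number `π / b`.
  by_contra h
  have h1 := integral_exp_neg_mul_sq hb
  rw [integral_undef h] at h1
  exact (div_pos Real.pi_pos hb).ne h1

variable {ε : ℝ}

theorem heatKernel_eq (ε t : ℝ) (x : Plane) : heatKernel ε t x =
    1 / (4 * Real.pi * ε ^ 2 * t) * Real.exp (-(1 / (4 * ε ^ 2 * t)) * ‖x‖ ^ 2) := by
  rw [heatKernel]; congr 2; ring

theorem heatKernel_nonneg (ε : ℝ) {t : ℝ} (ht : 0 ≤ t) (x : Plane) : 0 ≤ heatKernel ε t x := by
  have := Real.pi_pos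
  rw [heatKernel]; positivity

theorem continuous_heatKernel (ε t : ℝ) : Continuous (heatKernel ε t) := by
  unfold heatKernel; fun_prop

theorem integrable_heatKernel (hε : 0 < ε) {t : ℝ} (ht : 0 < t) :
    Integrable (heatKernel ε t) volume := by
  simp_rw [funext (heatKernel_eq ε t)]
  exact (integrable_exp_neg_mul_sq (by positivity)).const_mul _

theorem integral_heatKernel (hε : 0 < ε) {t : ℝ} (ht : 0 < t) :
    ∫ x, heatKernel ε t x = 1 := by
  have := Real.pi_pos
  simp_rw [heatKernel_eq]
  rw [integral_const_mul, integral_exp_neg_mul_sq (by positivity)]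
  field_simp

/-- Completing the square in `y`: the product is a constant times a Gaussian centred at `(s / (t +
s)) x`. -/
theorem integral_heatKernel_mul (hε : 0 < ε) {s t : ℝ} (hs : 0 < s) (ht : 0 < t) (x : Plane) :
    ∫ y, heatKernel ε t (x - y) * heatKernel ε s y = heatKernel ε (t + s) x := by
  have hpi := Real.pi_pos
  have e : ∀ y : Plane, heatKernel ε t (x - y) * heatKernel ε s y =
      (1 / (4 * Real.pi * ε ^ 2 * t) * (1 / (4 * Real.pi * ε ^ 2 * s)) *
        Real.exp (-(1 / (4 * ε ^ 2 * (t + s))) * ‖x‖ ^ 2)) *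
        Real.exp (-((t + s) / (4 * ε ^ 2 * t * s)) * ‖y - (s / (t + s)) • x‖ ^ 2) := by
    intro y
    have key : -(1 / (4 * ε ^ 2 * t)) * ‖x - y‖ ^ 2 + -(1 / (4 * ε ^ 2 * s)) * ‖y‖ ^ 2 =
        -(1 / (4 * ε ^ 2 * (t + s))) * ‖x‖ ^ 2 +
          -((t + s) / (4 * ε ^ 2 * t * s)) * ‖y - (s / (t + s)) • x‖ ^ 2 := by
      rw [norm_sub_sq_real, norm_sub_sq_real, norm_smul, Real.norm_of_nonneg (by positivity),
        inner_smul_right, real_inner_comm]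
      field_simp
      ring
    rw [heatKernel_eq, heatKernel_eq, mul_mul_mul_comm, ← Real.exp_add, key, Real.exp_add]
    ring
  simp_rw [e]
  rw [integral_const_mul, integral_sub_right_eq_self
    (fun y : Plane => Real.exp (-((t + s) / (4 * ε ^ 2 * t * s)) * ‖y‖ ^ 2)),
    integral_exp_neg_mul_sq (by positivity), heatKernel_eq]
  field_simp

/-- Moves the time dependence from the kernel to its argument. The resulting formula also makes
sense at `t = 0` and has a dominating function independent of `t`, which yields strong continuity.
-/
theorem integral_heatKernel_smul {F : Type*} [NormedAddCommGroup F] [NormedSpace ℝ F] (ε : ℝ)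
    {t : ℝ} (ht : 0 < t) (f : Plane → F) :
    ∫ z, heatKernel ε 1 z • f (Real.sqrt t • z) = ∫ z, heatKernel ε t z • f z := by
  have hs : 0 < Real.sqrt t := Real.sqrt_pos.2 ht
  have e : ∀ z : Plane, heatKernel ε 1 z • f (Real.sqrt t • z) =
      t • (heatKernel ε t (Real.sqrt t • z) • f (Real.sqrt t • z)) := by
    intro z
    rw [smul_smul]
    congr 1
    rw [heatKernel, heatKernel, norm_smul, Real.norm_of_nonneg hs.le, mul_pow, Real.sq_sqrt ht.le]
    have h1 : -(t * ‖z‖ ^ 2) / (4 * ε ^ 2 * t) = -‖z‖ ^ 2 / (4 * ε ^ 2 * 1) := by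
      rw [mul_one, ← mul_neg, mul_comm t, mul_div_mul_right _ _ ht.ne']
    have h2 : 1 / (4 * Real.pi * ε ^ 2 * 1) = t * (1 / (4 * Real.pi * ε ^ 2 * t)) := by
      rw [mul_one, mul_one_div, mul_comm _ t, ← div_div t t, div_self ht.ne']
    rw [h1, h2, mul_assoc]
  simp_rw [e]
  rw [integral_smul, Measure.integral_comp_smul volume (fun z => heatKernel ε t z • f z)]
  rw [finrank_euclideanSpace_fin, Real.sq_sqrt ht.le, abs_of_pos (inv_pos.2 ht), smul_inv_smul₀
    ht.ne']

end Kernel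

/-! ### Integration and translation in `L¹` -/

section Translation

theorem coeFn_classL1 {f : Plane → ℝ} (hf : Integrable f volume) : classL1 f =ᵐ[volume] f := by
  rw [classL1, dif_pos hf]; exact Integrable.coeFn_toL1 hf

theorem classL1_congr {f g : Plane → ℝ} (h : f =ᵐ[volume] g) : classL1 f = classL1 g := by
  by_cases hf : Integrable f volume
  · have hg := hf.congr h
    exact Lp.ext ((coeFn_classL1 hf).trans (h.trans (coeFn_classL1 hg).symm))
  · have hg : ¬Integrable g volume := fun hg => hf (hg.congr h.symm)
    rw [classL1, classL1, dif_neg hf, dif_neg hg]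

theorem eq_classL1_of_ae_eq {f : Plane → ℝ} {v : L1} (h : v =ᵐ[volume] f) : v = classL1 f :=
  Lp.ext (h.trans (coeFn_classL1 ((L1_integrable v).congr h)).symm)

/-- The integral over a set, as a continuous linear functional on `L¹`. -/
noncomputable def setIntegralL1 (S : Set Plane) : L1 →L[ℝ] ℝ :=
  LinearMap.mkContinuous
    { toFun := fun v => ∫ x in S, v x
      map_add' := fun v w => by
        rw [← integral_add (L1_integrable v).integrableOn (L1_integrable w).integrableOn]
        exact integral_congr_ae (ae_restrict_of_ae (Lp.coeFn_add v w))
      map_smul' := fun c v => by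
        rw [RingHom.id_apply, smul_eq_mul, ← integral_const_mul]
        exact integral_congr_ae (ae_restrict_of_ae (Lp.coeFn_smul c v)) } 1 fun v => by
    rw [one_mul, L1_norm_eq]
    exact abs_integral_le_integral_abs.trans (setIntegral_le_integral (L1_integrable v).abs
      (Eventually.of_forall fun x => abs_nonneg _))

theorem setIntegralL1_apply (S : Set Plane) (v : L1) : setIntegralL1 S v = ∫ x in S, v x := rfl

theorem neg_negInt_le_setIntegralL1 (S : Set Plane) (v : L1) : -negInt v ≤ setIntegralL1 S v := by
  have h1 : ∫ x in S, max (-v x) 0 ≤ negInt v :=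
    setIntegral_le_integral (integrable_negPart v) (Eventually.of_forall fun x => le_max_right _ _)
  have h2 : ∫ x in S, -max (-v x) 0 ≤ setIntegralL1 S v := by
    refine integral_mono (integrable_negPart v).neg.integrableOn (L1_integrable v).integrableOn
      fun x => ?_
    have := le_max_left (-v x) 0
    change -(max (-v x) 0) ≤ v x
    linarith
  rw [integral_neg] at h2
  linarith

/-- A Bochner integral in `L¹` can be computed pointwise. -/
theorem integral_L1_ae_eq {α : Type*} [MeasurableSpace α] {μ : Measure α} [SFinite μ]
    {F : α → L1} {f : α → Plane → ℝ} (hF : Integrable F μ)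
    (hf : Integrable (Function.uncurry f) (μ.prod volume)) (h : ∀ a, F a =ᵐ[volume] f a) :
    (∫ a, F a ∂μ : L1) =ᵐ[volume] fun x => ∫ a, f a x ∂μ := by
  refine Integrable.ae_eq_of_forall_setIntegral_eq _ _ (L1_integrable _) hf.integral_prod_right ?_
  intro S _ _
  rw [← setIntegralL1_apply, ← ContinuousLinearMap.integral_comp_comm _ hF]
  have e : ∀ a, setIntegralL1 S (F a) = ∫ x in S, f a x := fun a =>
    integral_congr_ae (ae_restrict_of_ae (h a))
  simp_rw [e]
  refine integral_integral_swap (hf.mono_measure ?_)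
  nth_rw 2 [← Measure.restrict_univ (μ := μ)]
  nth_rw 1 [← Measure.restrict_univ (μ := μ)]
  rw [Measure.prod_restrict]
  conv_rhs => rw [Measure.restrict_univ]
  exact Measure.restrict_le_self

/-- Translation in `L¹`. -/
noncomputable def translate (z : Plane) : L1 →ₗᵢ[ℝ] L1 :=
  Lp.compMeasurePreservingₗᵢ ℝ (fun x => x - z) (measurePreserving_sub_right volume z)

theorem coeFn_translate (z : Plane) (v : L1) : translate z v =ᵐ[volume] fun x => v (x - z) :=
  Lp.coeFn_compMeasurePreserving v (measurePreserving_sub_right volume z)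

theorem continuous_translate (v : L1) : Continuous fun z => translate z v := by
  have h : Continuous fun z : Plane => (⟨fun x => x - z, by fun_prop⟩ : C(Plane, Plane)) :=
    ContinuousMap.continuous_of_continuous_uncurry _ (by
      simp only [Function.uncurry_def, ContinuousMap.coe_mk]; fun_prop)
  exact (continuous_const (y := v)).compMeasurePreservingLp h
    (fun z => measurePreserving_sub_right volume z) (by simp)

theorem norm_translate (z : Plane) (v : L1) : ‖translate z v‖ = ‖v‖ := (translate z).norm_map v

theorem translate_zero (v : L1) : translate 0 v = v := by
  refine Lp.ext ?_
  filter_upwards [coeFn_translate 0 v] with x hx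
  rw [hx, sub_zero]

theorem integralL1_translate (z : Plane) (v : L1) : integralL1 (translate z v) = integralL1 v := by
  rw [integralL1_apply, integral_congr_ae (coeFn_translate z v),
    integral_sub_right_eq_self (fun x => v x)]; rfl

theorem negInt_translate (z : Plane) (v : L1) : negInt (translate z v) = negInt v := by
  rw [negInt, negInt, ← integral_sub_right_eq_self (fun x => max (-v x) 0) z]
  refine integral_congr_ae ?_
  filter_upwards [coeFn_translate z v] with x hx
  rw [hx]

theorem translate_classL1 (z : Plane) {f : Plane → ℝ} (hf : Integrable f volume) :
    translate z (classL1 f) = classL1 fun x => f (x - z) := by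
  refine eq_classL1_of_ae_eq ((coeFn_translate z _).trans ?_)
  exact (measurePreserving_sub_right volume z).quasiMeasurePreserving.ae_eq (coeFn_classL1 hf)

end Translation

/-! ### The heat semigroup -/

section Heat

variable {ε : ℝ}

theorem integrable_heatKernel_smul_translate (hε : 0 < ε) (v : L1) (t r : ℝ) (ht : 0 < t) :
    Integrable (fun z => heatKernel ε t z • translate (r • z) v) volume := by
  refine ((integrable_heatKernel hε ht).mul_const ‖v‖).mono' ?_ (Eventually.of_forall fun z => ?_)
  · exact ((continuous_heatKernel ε t).smul
      ((continuous_translate v).comp (continuous_const_smul r))).aestronglyMeasurable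
  · rw [norm_smul, norm_translate, Real.norm_of_nonneg (heatKernel_nonneg ε ht.le z)]

theorem norm_integral_heatKernel_smul_le (hε : 0 < ε) (v : L1) (r : ℝ) :
    ‖∫ z, heatKernel ε 1 z • translate (r • z) v‖ ≤ ‖v‖ := by
  calc _ ≤ ∫ z, ‖heatKernel ε 1 z • translate (r • z) v‖ := norm_integral_le_integral_norm _
    _ = ∫ z, heatKernel ε 1 z * ‖v‖ := by
      congr 1; ext z
      rw [norm_smul, norm_translate, Real.norm_of_nonneg (heatKernel_nonneg ε zero_le_one z)]
    _ = ‖v‖ := by rw [integral_mul_const, integral_heatKernel hε one_pos, one_mul]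

/-- The heat semigroup, as an average of translations. -/
noncomputable def heatCLM (hε : 0 < ε) (t : ℝ≥0) : L1 →L[ℝ] L1 :=
  LinearMap.mkContinuous
    { toFun := fun v => ∫ z, heatKernel ε 1 z • translate (Real.sqrt t • z) v
      map_add' := fun v w => by
        simp_rw [map_add, smul_add]
        exact integral_add (integrable_heatKernel_smul_translate hε v 1 _ one_pos)
          (integrable_heatKernel_smul_translate hε w 1 _ one_pos)
      map_smul' := fun c v => by
        simp_rw [map_smul, smul_comm _ c]
        exact integral_smul c _ } 1 fun v => by
    rw [one_mul]; exact norm_integral_heatKernel_smul_le hε v _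

theorem heatCLM_apply (hε : 0 < ε) (t : ℝ≥0) (v : L1) :
    heatCLM hε t v = ∫ z, heatKernel ε 1 z • translate (Real.sqrt t • z) v := rfl

theorem norm_heatCLM_le (hε : 0 < ε) (t : ℝ≥0) (v : L1) : ‖heatCLM hε t v‖ ≤ ‖v‖ :=
  norm_integral_heatKernel_smul_le hε v _

theorem heatCLM_zero (hε : 0 < ε) (v : L1) : heatCLM hε 0 v = v := by
  rw [heatCLM_apply]
  simp only [NNReal.coe_zero, Real.sqrt_zero, zero_smul, translate_zero]
  rw [integral_smul_const, integral_heatKernel hε one_pos, one_smul]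

theorem continuous_heatCLM (hε : 0 < ε) (v : L1) : Continuous fun t => heatCLM hε t v := by
  refine continuous_of_dominated (bound := fun z => heatKernel ε 1 z * ‖v‖)
    (fun t => (integrable_heatKernel_smul_translate hε v 1 _ one_pos).aestronglyMeasurable)
    (fun t => Eventually.of_forall fun z => ?_)
    ((integrable_heatKernel hε one_pos).mul_const _) (Eventually.of_forall fun z => ?_)
  · rw [norm_smul, norm_translate, Real.norm_of_nonneg (heatKernel_nonneg ε zero_le_one z)]
  · have h : Continuous fun t : ℝ≥0 => Real.sqrt t • z := by fun_prop
    exact ((continuous_translate v).comp h).const_smul (heatKernel ε 1 z)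

theorem heatCLM_eq_of_pos (hε : 0 < ε) {t : ℝ≥0} (ht : 0 < t) (v : L1) :
    heatCLM hε t v = ∫ z, heatKernel ε t z • translate z v :=
  integral_heatKernel_smul ε (NNReal.coe_pos.2 ht) (fun z => translate z v)

theorem integrable_heat_convolution (hε : 0 < ε) {t : ℝ} (ht : 0 < t) {v : Plane → ℝ}
    (hv : Integrable v volume) : Integrable (Function.uncurry fun z x : Plane =>
      v z * heatKernel ε t (x - z)) (volume.prod volume) := by
  have := (hv.convolution_integrand (ContinuousLinearMap.mul ℝ ℝ)
    (integrable_heatKernel hε ht)).swap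
  exact this

theorem heatCLM_ae_eq (hε : 0 < ε) {t : ℝ≥0} (ht : 0 < t) (v : L1) :
    heatCLM hε t v =ᵐ[volume] fun x => ∫ z, heatKernel ε t (x - z) * v z := by
  have ht' : (0 : ℝ) < t := ht
  rw [heatCLM_eq_of_pos hε ht]
  have h1 : Integrable (Function.uncurry fun z x : Plane => heatKernel ε t z * v (x - z))
      (volume.prod volume) :=
    ((integrable_heatKernel hε ht').convolution_integrand (ContinuousLinearMap.mul ℝ ℝ)
      (L1_integrable v)).swap
  refine (integral_L1_ae_eq (f := fun z x => heatKernel ε t z * v (x - z)) ?_ h1 fun z => ?_).trans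
    (Eventually.of_forall fun x => ?_)
  · simpa using integrable_heatKernel_smul_translate hε v t 1 ht'
  · filter_upwards [Lp.coeFn_smul (heatKernel ε t z) (translate z v), coeFn_translate z v]
      with x h1 h2
    rw [h1, Pi.smul_apply, h2, smul_eq_mul]
  · change ∫ z, heatKernel ε t z * v (x - z) = ∫ z, heatKernel ε t (x - z) * v z
    rw [← integral_sub_left_eq_self _ volume x]
    simp

theorem heatOp_eq (hε : 0 < ε) (t : ℝ≥0) (v : L1) : heatOp ε t v = heatCLM hε t v := by
  rw [heatOp]
  split_ifs with h
  · rw [h, heatCLM_zero]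
  · exact (eq_classL1_of_ae_eq (heatCLM_ae_eq hε (pos_iff_ne_zero.2 h) v)).symm

/-- The class of the heat kernel centered at `z`. -/
noncomputable def kernelAt (ε t : ℝ) (z : Plane) : L1 := translate z (classL1 (heatKernel ε t))

theorem kernelAt_eq (hε : 0 < ε) {t : ℝ} (ht : 0 < t) (z : Plane) :
    kernelAt ε t z = classL1 fun x => heatKernel ε t (x - z) :=
  translate_classL1 z (integrable_heatKernel hε ht)

theorem coeFn_kernelAt (hε : 0 < ε) {t : ℝ} (ht : 0 < t) (z : Plane) :
    kernelAt ε t z =ᵐ[volume] fun x => heatKernel ε t (x - z) := by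
  rw [kernelAt_eq hε ht]
  exact coeFn_classL1 ((integrable_heatKernel hε ht).comp_sub_right z)

theorem norm_kernelAt (hε : 0 < ε) {t : ℝ} (ht : 0 < t) (z : Plane) : ‖kernelAt ε t z‖ = 1 := by
  rw [L1_norm_eq, ← integral_heatKernel hε ht, ← integral_sub_right_eq_self (heatKernel ε t) z]
  refine integral_congr_ae ?_
  filter_upwards [coeFn_kernelAt hε ht z] with x hx
  rw [hx, abs_of_nonneg (heatKernel_nonneg ε ht.le _)]

theorem integrable_smul_kernelAt (hε : 0 < ε) {t : ℝ} (ht : 0 < t) (v : L1) :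
    Integrable (fun z => v z • kernelAt ε t z) volume := by
  refine (L1_integrable v).norm.mono' ?_ (Eventually.of_forall fun z => ?_)
  · exact (L1_integrable v).aestronglyMeasurable.smul
      (continuous_translate _).aestronglyMeasurable
  · rw [norm_smul, norm_kernelAt hε ht, mul_one]

/-- The heat semigroup, as a superposition of heat kernels. -/
theorem heatCLM_eq_integral_kernelAt (hε : 0 < ε) {t : ℝ≥0} (ht : 0 < t) (v : L1) :
    heatCLM hε t v = ∫ z, v z • kernelAt ε t z := by
  have ht' : (0 : ℝ) < t := ht
  refine Lp.ext ((heatCLM_ae_eq hε ht v).trans ?_)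
  refine ((integral_L1_ae_eq (f := fun z x => v z * heatKernel ε t (x - z))
    (integrable_smul_kernelAt hε ht' v) (integrable_heat_convolution hε ht' (L1_integrable v))
    fun z => ?_).trans (Eventually.of_forall fun x => ?_)).symm
  · filter_upwards [Lp.coeFn_smul (v z) (kernelAt ε t z), coeFn_kernelAt hε ht' z] with x h1 h2
    rw [h1, Pi.smul_apply, h2, smul_eq_mul]
  · simp only [mul_comm]

/-- The semigroup law on heat kernels. It extends to `L¹` because every `heatCLM hε t v` with `t >
0` is a superposition of kernels and bounded operators commute with the integral. -/
theorem heatCLM_kernelAt (hε : 0 < ε) {s t : ℝ≥0} (hs : 0 < s) (ht : 0 < t) (z : Plane) :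
    heatCLM hε t (kernelAt ε s z) = kernelAt ε (t + s) z := by
  have hs' : (0 : ℝ) < s := hs
  have ht' : (0 : ℝ) < t := ht
  rw [kernelAt_eq hε (add_pos ht' hs')]
  refine eq_classL1_of_ae_eq ((heatCLM_ae_eq hε ht _).trans (Eventually.of_forall fun x => ?_))
  have e : ∫ y, heatKernel ε t (x - y) * kernelAt ε s z y =
      ∫ y, heatKernel ε t (x - y) * heatKernel ε s (y - z) := by
    refine integral_congr_ae ?_
    filter_upwards [coeFn_kernelAt hε hs' z] with y hy
    rw [hy]
  simp only [e]
  rw [← integral_heatKernel_mul hε hs' ht', ← integral_sub_right_eq_self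
    (fun y => heatKernel ε t (x - z - y) * heatKernel ε s y) z]
  simp only [sub_sub_sub_cancel_right]

/-- The heat semigroup on `L¹`. -/
noncomputable def heatSemigroup (hε : 0 < ε) : C0Semigroup L1 where
  op := heatCLM hε
  op_zero := ContinuousLinearMap.ext (heatCLM_zero hε)
  op_add s t := by
    refine ContinuousLinearMap.ext fun v => ?_
    rcases eq_or_ne s 0 with rfl | hs
    · simp [heatCLM_zero]
    rcases eq_or_ne t 0 with rfl | ht
    · simp [heatCLM_zero]
    have hs' := pos_iff_ne_zero.2 hs
    have ht' := pos_iff_ne_zero.2 ht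
    rw [ContinuousLinearMap.comp_apply, heatCLM_eq_integral_kernelAt hε ht',
      heatCLM_eq_integral_kernelAt hε (add_pos hs' ht')]
    refine Eq.trans ?_ (ContinuousLinearMap.integral_comp_comm (heatCLM hε s)
      (integrable_smul_kernelAt hε ht' v))
    simp_rw [map_smul, heatCLM_kernelAt hε ht' hs', NNReal.coe_add]
  strongly_continuous := continuous_heatCLM hε

theorem diffusionGraph_eq (hε : 0 < ε) :
    diffusionGraph ε = generatorGraph fun t v => (heatSemigroup hε).op t v := by
  rw [diffusionGraph]
  congr 1
  funext t v
  exact heatOp_eq hε t v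

theorem integralL1_heatCLM (hε : 0 < ε) (t : ℝ≥0) (v : L1) :
    integralL1 (heatCLM hε t v) = integralL1 v := by
  rw [heatCLM_apply, ← ContinuousLinearMap.integral_comp_comm _
    (integrable_heatKernel_smul_translate hε v 1 _ one_pos)]
  simp_rw [map_smul, integralL1_translate, smul_eq_mul]
  rw [integral_mul_const, integral_heatKernel hε one_pos, one_mul]

/-- Averages of translations cannot create negative mass. Taking `S` to be the set where the image
is negative shows that `negInt` does not increase. -/
theorem neg_negInt_le_setIntegralL1_heatCLM (hε : 0 < ε) (t : ℝ≥0) (v : L1) (S : Set Plane) :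
    -negInt v ≤ setIntegralL1 S (heatCLM hε t v) := by
  rw [heatCLM_apply, ← ContinuousLinearMap.integral_comp_comm _
    (integrable_heatKernel_smul_translate hε v 1 _ one_pos)]
  simp_rw [map_smul, smul_eq_mul]
  have e : -negInt v = ∫ z, heatKernel ε 1 z * -negInt v := by
    rw [integral_mul_const, integral_heatKernel hε one_pos, one_mul]
  rw [e]
  refine integral_mono ((integrable_heatKernel hε one_pos).mul_const _) ?_ fun z => ?_
  · have := (setIntegralL1 S).integrable_comp
      (integrable_heatKernel_smul_translate hε v 1 (Real.sqrt t) one_pos)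
    simpa using this
  · refine mul_le_mul_of_nonneg_left ?_ (heatKernel_nonneg ε zero_le_one z)
    rw [← negInt_translate (Real.sqrt t • z) v]
    exact neg_negInt_le_setIntegralL1 S _

end Heat

end ReturnHome

namespace ReturnHome

/-! ### Laplace transforms of semigroups -/

section Laplace

variable {X : Type*} [NormedAddCommGroup X] [NormedSpace ℝ X]

/-- The Laplace transform `∫₀^∞ e^{- l s} T(s) f ds`. -/
noncomputable def laplace (T : C0Semigroup X) (l : ℝ) (f : X) : X :=
  ∫ s in Set.Ioi (0 : ℝ), Real.exp (-l * s) • T.op s.toNNReal f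

theorem continuous_exp_smul_op (T : C0Semigroup X) (l : ℝ) (f : X) :
    Continuous fun s : ℝ => Real.exp (-l * s) • T.op s.toNNReal f := by
  have := T.continuous_real f
  fun_prop

theorem integrableOn_exp_smul_op {T : C0Semigroup X} (hT : ∀ t x, ‖T.op t x‖ ≤ ‖x‖) {l : ℝ}
    (hl : 0 < l) (f : X) :
    IntegrableOn (fun s : ℝ => Real.exp (-l * s) • T.op s.toNNReal f) (Set.Ioi 0) := by
  refine Integrable.mono' ((exp_neg_integrableOn_Ioi 0 hl).mul_const ‖f‖)
    (continuous_exp_smul_op T l f).aestronglyMeasurable (Eventually.of_forall fun s => ?_)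
  rw [norm_smul, Real.norm_of_nonneg (Real.exp_pos _).le]
  exact mul_le_mul_of_nonneg_left (hT _ _) (Real.exp_pos _).le

/-- Shifting the integration variable gives `T(t) R f = e^{lt} (R f - ∫₀^t e^{-ls} T(s) f ds)`,
which is differentiated at `t = 0`. -/
theorem laplace_mem_generatorGraph [CompleteSpace X] {T : C0Semigroup X}
    (hT : ∀ t x, ‖T.op t x‖ ≤ ‖x‖) {l : ℝ} (hl : 0 < l) (f : X) :
    (laplace T l f, l • laplace T l f - f) ∈ generatorGraph fun t x => T.op t x := by
  have hint := integrableOn_exp_smul_op hT hl f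
  have hcont := continuous_exp_smul_op T l f
  rw [mem_generatorGraph_iff_hasDerivWithinAt (T.op_zero_apply _)]
  have e : ∀ t : ℝ, 0 ≤ t → T.op t.toNNReal (laplace T l f) = Real.exp (l * t) •
      (laplace T l f - ∫ s in (0 : ℝ)..t, Real.exp (-l * s) • T.op s.toNNReal f) := by
    intro t ht
    rw [laplace, ← ContinuousLinearMap.integral_comp_comm _ hint]
    have h1 : ∀ s ∈ Set.Ioi (0 : ℝ), T.op t.toNNReal (Real.exp (-l * s) • T.op s.toNNReal f) =
        Real.exp (l * t) • (Real.exp (-l * (s + t)) • T.op (s + t).toNNReal f) := by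
      intro s (hs : 0 < s)
      rw [map_smul, ← T.op_add_apply, ← Real.toNNReal_add ht hs.le, smul_smul, ← Real.exp_add,
        add_comm t s]
      congr 2; ring
    rw [setIntegral_congr_fun measurableSet_Ioi h1, integral_smul]
    congr 1
    have h2 := intervalIntegral.integral_interval_add_Ioi hint (hint.mono_set
      (Set.Ioi_subset_Ioi ht))
    rw [← h2, add_sub_cancel_left, ← integral_indicator measurableSet_Ioi,
      ← integral_indicator measurableSet_Ioi, ← integral_add_right_eq_self ((Set.Ioi t).indicator
        fun s => Real.exp (-l * s) • T.op s.toNNReal f) t]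
    congr 1; ext s
    simp only [Set.indicator, Set.mem_Ioi, lt_add_iff_pos_left]
  have h1 : HasDerivAt (fun t : ℝ => Real.exp (l * t)) l 0 := by
    have : HasDerivAt (fun t : ℝ => Real.exp (l * t)) (Real.exp (l * 0) * (l * 1)) 0 :=
      ((hasDerivAt_id (0 : ℝ)).const_mul l).exp
    simpa using this
  have h2 := (intervalIntegral.integral_hasDerivAt_right (hcont.intervalIntegrable 0 0)
    (hcont.stronglyMeasurableAtFilter _ _) hcont.continuousAt).const_sub (laplace T l f)
  have h3 := h1.fun_smul h2
  have e2 : l • laplace T l f - f = Real.exp (l * 0) • -(Real.exp (-l * 0) •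
      T.op (Real.toNNReal 0) f) + l • (laplace T l f -
        ∫ s in (0 : ℝ)..0, Real.exp (-l * s) • T.op s.toNNReal f) := by
    simp [T.op_zero_apply]; abel
  rw [e2]
  exact h3.hasDerivWithinAt.congr (fun t (ht : 0 < t) => e t ht.le) (e 0 le_rfl)

/-- After the substitution `r = l s` the weight no longer depends on `l`, and `T(r / l) f → f` under
dominated convergence. This will show that the domain of `A + B` is dense. -/
theorem tendsto_smul_laplace [CompleteSpace X] {T : C0Semigroup X}
    (hT : ∀ t x, ‖T.op t x‖ ≤ ‖x‖) (f : X) :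
    Tendsto (fun l : ℝ => l • laplace T l f) atTop (𝓝 f) := by
  have e : ∀ l : ℝ, 0 < l → ∫ r in Set.Ioi (0 : ℝ), Real.exp (-1 * r) • T.op (l⁻¹ * r).toNNReal f =
      l • laplace T l f := by
    intro l hl
    have h := integral_comp_mul_left_Ioi
      (fun s => Real.exp (-l * s) • T.op s.toNNReal f) 0 (inv_pos.2 hl)
    rw [inv_inv, mul_zero] at h
    rw [laplace, ← h]
    refine setIntegral_congr_fun measurableSet_Ioi fun r _ => ?_
    simp only [← mul_assoc, neg_mul, mul_inv_cancel₀ hl.ne']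
  have hf : ∫ r in Set.Ioi (0 : ℝ), Real.exp (-1 * r) • f = f := by
    rw [integral_smul_const]
    simp only [neg_mul, one_mul, integral_exp_neg_Ioi_zero, one_smul]
  have h : Tendsto (fun l : ℝ => ∫ r in Set.Ioi (0 : ℝ), Real.exp (-1 * r) •
      T.op (l⁻¹ * r).toNNReal f) atTop (𝓝 (∫ r in Set.Ioi (0 : ℝ), Real.exp (-1 * r) • f)) := by
    refine tendsto_integral_filter_of_dominated_convergence
      (fun r => Real.exp (-1 * r) * ‖f‖) ?_ ?_ ((exp_neg_integrableOn_Ioi 0 one_pos).mul_const _) ?_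
    · refine Eventually.of_forall fun l => Continuous.aestronglyMeasurable ?_
      have := (T.continuous_real f).comp (continuous_const_mul l⁻¹)
      exact (by fun_prop : Continuous fun r : ℝ => Real.exp (-1 * r)).smul this
    · refine Eventually.of_forall fun l => Eventually.of_forall fun r => ?_
      rw [norm_smul, Real.norm_of_nonneg (Real.exp_pos _).le]
      exact mul_le_mul_of_nonneg_left (hT _ _) (Real.exp_pos _).le
    · refine Eventually.of_forall fun r => Tendsto.const_smul ?_ _
      have h1 : Tendsto (fun l : ℝ => l⁻¹ * r) atTop (𝓝 0) := by
        simpa using tendsto_inv_atTop_zero.mul_const r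
      have h2 := ((T.continuous_real f).tendsto 0).comp h1
      simpa [Function.comp_def, T.op_zero_apply] using h2
  rw [hf] at h
  refine h.congr' ?_
  filter_upwards [eventually_gt_atTop 0] with l hl using e l hl

/-- The generator graph of a family of bounded operators is closed under dominated integrals. -/
theorem exists_integral_mem_generatorGraph [CompleteSpace X] {F : ℝ≥0 → X → X}
    {L : ℝ≥0 → X →L[ℝ] X} (hF : ∀ᶠ t in 𝓝[>] (0 : ℝ≥0), ∀ x, F t x = L t x)
    {α : Type*} [MeasurableSpace α] {μ : Measure α} {h : α → X} (hh : Integrable h μ)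
    (hb : ∀ᵐ a ∂μ, ∃ b, (h a, b) ∈ generatorGraph F) {β : α → ℝ} (hβ : Integrable β μ)
    (hhβ : ∀ᶠ t in 𝓝[>] (0 : ℝ≥0), ∀ᵐ a ∂μ, ‖L t (h a) - h a‖ ≤ t * β a) :
    ∃ c, (∫ a, h a ∂μ, c) ∈ generatorGraph F ∧ ‖c‖ ≤ ∫ a, β a ∂μ := by
  obtain ⟨b, hb⟩ : ∃ b : α → X, ∀ᵐ a ∂μ, (h a, b a) ∈ generatorGraph F :=
    ⟨fun a => Classical.epsilon fun b => (h a, b) ∈ generatorGraph F,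
      hb.mono fun a ha => Classical.epsilon_spec ha⟩
  have hlim : ∀ᵐ a ∂μ, Tendsto (fun t : ℝ≥0 => (t : ℝ)⁻¹ • (L t (h a) - h a)) (𝓝[>] 0) (𝓝 (b a)) := by
    filter_upwards [hb] with a ha
    refine Tendsto.congr' ?_ ha
    filter_upwards [hF] with t ht
    simp only [ht]
  have hbound : ∀ᶠ t : ℝ≥0 in 𝓝[>] 0, ∀ᵐ a ∂μ, ‖(t : ℝ)⁻¹ • (L t (h a) - h a)‖ ≤ β a := by
    filter_upwards [hhβ, self_mem_nhdsWithin] with t ht (ht0 : 0 < t)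
    filter_upwards [ht] with a ha
    have ht0' : (0 : ℝ) < t := ht0
    rw [norm_smul, norm_inv, Real.norm_of_nonneg ht0'.le, inv_mul_le_iff₀ ht0']
    exact ha
  have hint : ∀ t : ℝ≥0, Integrable (fun a => (t : ℝ)⁻¹ • (L t (h a) - h a)) μ := fun t =>
    (((L t).integrable_comp hh).sub hh).smul _
  have h1 := tendsto_integral_filter_of_dominated_convergence β
    (Eventually.of_forall fun t => (hint t).aestronglyMeasurable) hbound hβ hlim
  have h2 : ∀ t : ℝ≥0, ∫ a, (t : ℝ)⁻¹ • (L t (h a) - h a) ∂μ =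
      (t : ℝ)⁻¹ • (L t (∫ a, h a ∂μ) - ∫ a, h a ∂μ) := by
    intro t
    rw [integral_smul, integral_sub ((L t).integrable_comp hh) hh,
      ContinuousLinearMap.integral_comp_comm _ hh]
  refine ⟨_, h1.congr' ?_, le_of_tendsto h1.norm ?_⟩
  · filter_upwards [hF] with t ht
    rw [h2, ht]
  · filter_upwards [hbound] with t ht using norm_integral_le_of_norm_le hβ ht

end Laplace

end ReturnHome

/-! ### Flows of velocity fields, their Jacobians and the transport operators. -/

namespace ReturnHome

/-! ### Velocity fields and their flows -/

section Velocity

variable {c : Plane → Plane}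

theorem plane_eq_sum (v : Plane) :
    v = v 0 • EuclideanSpace.single 0 (1 : ℝ) + v 1 • EuclideanSpace.single 1 (1 : ℝ) := by
  ext i
  fin_cases i <;> simp

/-- Carries boundedness and uniform continuity from the partial derivatives to the full derivative.
-/
theorem fderiv_eq_smulRight (c : Plane → Plane) (x : Plane) : fderiv ℝ c x =
    ContinuousLinearMap.smulRightL ℝ Plane Plane (EuclideanSpace.proj 0)
      (fderiv ℝ c x (EuclideanSpace.single 0 1)) +
    ContinuousLinearMap.smulRightL ℝ Plane Plane (EuclideanSpace.proj 1)
      (fderiv ℝ c x (EuclideanSpace.single 1 1)) := by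
  refine ContinuousLinearMap.ext fun v => ?_
  conv_lhs => rw [plane_eq_sum v]
  simp

theorem RegularVelocity.uniformContinuous_fderiv (hc : RegularVelocity c) :
    UniformContinuous (fderiv ℝ c) := by
  rw [funext (fderiv_eq_smulRight c)]
  exact ((ContinuousLinearMap.uniformContinuous _).comp (hc.partial_uniformContinuous 0)).add
    ((ContinuousLinearMap.uniformContinuous _).comp (hc.partial_uniformContinuous 1))

theorem RegularVelocity.exists_norm_fderiv_le (hc : RegularVelocity c) :
    ∃ L : ℝ≥0, ∀ x, ‖fderiv ℝ c x‖ ≤ L := by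
  obtain ⟨A, hA⟩ := hc.partial_bounded 0
  obtain ⟨B, hB⟩ := hc.partial_bounded 1
  set p := ContinuousLinearMap.smulRightL ℝ Plane Plane (EuclideanSpace.proj 0)
  set q := ContinuousLinearMap.smulRightL ℝ Plane Plane (EuclideanSpace.proj 1)
  refine ⟨(‖p‖ * A + ‖q‖ * B).toNNReal, fun x => (?_ : _ ≤ _).trans (Real.le_coe_toNNReal _)⟩
  rw [fderiv_eq_smulRight]
  exact (norm_add_le _ _).trans (add_le_add
    ((p.le_opNorm _).trans (mul_le_mul_of_nonneg_left (hA x) (norm_nonneg _)))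
    ((q.le_opNorm _).trans (mul_le_mul_of_nonneg_left (hB x) (norm_nonneg _))))

/-- Bounds for a velocity field: `M` for its size, `L` for its derivative. -/
structure VelocityBounds (c : Plane → Plane) (M L : ℝ≥0) : Prop where
  regular : RegularVelocity c
  norm_le : ∀ x, ‖c x‖ ≤ M
  norm_fderiv_le : ∀ x, ‖fderiv ℝ c x‖ ≤ L

theorem RegularVelocity.exists_bounds (hc : RegularVelocity c) :
    ∃ M L : ℝ≥0, VelocityBounds c M L := by
  obtain ⟨M, hM⟩ := hc.bounded
  obtain ⟨L, hL⟩ := hc.exists_norm_fderiv_le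
  exact ⟨M.toNNReal, L, hc, fun x => (hM x).trans (Real.le_coe_toNNReal _), hL⟩

variable {M L : ℝ≥0}

theorem VelocityBounds.differentiable (h : VelocityBounds c M L) : Differentiable ℝ c :=
  h.regular.contDiff.differentiable one_ne_zero

theorem VelocityBounds.lipschitz (h : VelocityBounds c M L) : LipschitzWith L c :=
  lipschitzWith_of_nnnorm_fderiv_le h.differentiable fun x => h.norm_fderiv_le x

theorem VelocityBounds.exists_local_solution (h : VelocityBounds c M L) (z : Plane) (n : ℕ) :
    ∃ ζ : ℝ → Plane, ζ 0 = z ∧ ∀ t ∈ Set.Ioo (-(n : ℝ)) n, HasDerivAt ζ (c (ζ t)) t := by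
  have hn : (0 : ℝ) ∈ Set.Icc (-(n : ℝ)) n := by simp
  -- At speed at most `M`, a solution cannot leave the ball of radius `M n` during `[-n, n]`, so no
  -- smallness of the interval is needed.
  have hp : IsPicardLindelof (fun _ => c) (⟨0, hn⟩ : Set.Icc (-(n : ℝ)) n) z (M * n) 0 M L :=
    IsPicardLindelof.of_time_independent (fun x _ => h.norm_le x) h.lipschitz.lipschitzOnWith
      (by simp)
  obtain ⟨ζ, h0, h1⟩ := hp.exists_eq_forall_mem_Icc_hasDerivWithinAt₀
  exact ⟨ζ, h0, fun t ht => (h1 t (Set.Ioo_subset_Icc_self ht)).hasDerivAt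
    (Icc_mem_nhds ht.1 ht.2)⟩

theorem VelocityBounds.exists_solution (h : VelocityBounds c M L) (z : Plane) :
    ∃ ζ : ℝ → Plane, ζ 0 = z ∧ ∀ t, HasDerivAt ζ (c (ζ t)) t := by
  choose α h0 h1 using h.exists_local_solution z
  have huniq : ∀ n m : ℕ, n ≤ m → ∀ t ∈ Set.Ioo (-(n : ℝ)) n, α n t = α m t := by
    intro n m hnm t ht
    have hnm' : (n : ℝ) ≤ m := by exact_mod_cast hnm
    have hn : (0 : ℝ) < n := by linarith [ht.1, ht.2]
    refine ODE_solution_unique_of_mem_Ioo (v := fun _ => c) (s := fun _ => Set.univ) (K := L)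
      (t₀ := 0) (fun _ _ => h.lipschitz.lipschitzOnWith) ⟨by linarith, hn⟩
      (fun s hs => ⟨h1 n s hs, trivial⟩)
      (fun s hs => ⟨h1 m s ⟨by linarith [hs.1], by linarith [hs.2]⟩, trivial⟩)
      ((h0 n).trans (h0 m).symm) ht
  -- The `+ 1` puts `t` strictly inside the interval of the local solution. Near `t` the varying
  -- index is dominated by `⌈|t|⌉₊ + 2`, and by uniqueness that one solution represents the function
  -- there.
  refine ⟨fun t => α (⌈|t|⌉₊ + 1) t, h0 _, fun t => ?_⟩
  have hmem : ∀ s : ℝ, s ∈ Set.Ioo (-((⌈|s|⌉₊ + 1 : ℕ) : ℝ)) (⌈|s|⌉₊ + 1 : ℕ) := fun s => by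
    have := Nat.le_ceil |s|
    rw [Set.mem_Ioo, ← abs_lt]; push_cast; linarith
  have hev : (fun t => α (⌈|t|⌉₊ + 1) t) =ᶠ[𝓝 t] α (⌈|t|⌉₊ + 2) := by
    have hlt : |t| < ⌈|t|⌉₊ + 1 := by linarith [Nat.le_ceil |t|]
    filter_upwards [continuous_abs.continuousAt.eventually_lt_const hlt] with s hs
    refine huniq _ _ ?_ s (hmem s)
    have : ⌈|s|⌉₊ ≤ ⌈|t|⌉₊ + 1 := Nat.ceil_le.2 (by push_cast; exact hs.le)
    omega
  have hd : HasDerivAt (α (⌈|t|⌉₊ + 2)) (c (α (⌈|t|⌉₊ + 2) t)) t := by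
    refine h1 _ t ?_
    have := hmem t
    push_cast at this ⊢
    exact ⟨by linarith [this.1], by linarith [this.2]⟩
  have := hd.congr_of_eventuallyEq hev
  rwa [← hev.eq_of_nhds] at this

theorem VelocityBounds.flow_zero (h : VelocityBounds c M L) (z : Plane) : flow c 0 z = z :=
  (Classical.epsilon_spec (h.exists_solution z)).1

theorem VelocityBounds.hasDerivAt_flow (h : VelocityBounds c M L) (z : Plane) (t : ℝ) :
    HasDerivAt (fun s => flow c s z) (c (flow c t z)) t :=
  (Classical.epsilon_spec (h.exists_solution z)).2 t

theorem VelocityBounds.flow_flow (h : VelocityBounds c M L) (s t : ℝ) (z : Plane) :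
    flow c s (flow c t z) = flow c (s + t) z := by
  have := ODE_solution_unique_univ (v := fun _ => c) (s := fun _ => Set.univ) (K := L) (t₀ := 0)
    (f := fun s => flow c s (flow c t z)) (g := fun s => flow c (s + t) z)
    (fun _ => h.lipschitz.lipschitzOnWith)
    (fun s => ⟨h.hasDerivAt_flow _ s, trivial⟩)
    (fun s => ⟨(h.hasDerivAt_flow z (s + t)).comp_add_const s t, trivial⟩)
    (by simp [h.flow_zero])
  exact congrFun this s

theorem VelocityBounds.flow_neg_flow (h : VelocityBounds c M L) (t : ℝ) (z : Plane) :
    flow c (-t) (flow c t z) = z := by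
  rw [h.flow_flow, neg_add_cancel, h.flow_zero]

theorem VelocityBounds.flow_flow_neg (h : VelocityBounds c M L) (t : ℝ) (z : Plane) :
    flow c t (flow c (-t) z) = z := by
  rw [h.flow_flow, add_neg_cancel, h.flow_zero]

theorem VelocityBounds.norm_flow_sub_flow_le (h : VelocityBounds c M L) (s t : ℝ) (z : Plane) :
    ‖flow c s z - flow c t z‖ ≤ M * |s - t| :=
  convex_univ.norm_image_sub_le_of_norm_hasDerivWithin_le
    (fun r _ => (h.hasDerivAt_flow z r).hasDerivWithinAt) (fun _ _ => h.norm_le _) trivial trivial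

theorem VelocityBounds.dist_flow_le (h : VelocityBounds c M L) (t : ℝ) (x y : Plane) :
    dist (flow c t x) (flow c t y) ≤ Real.exp (L * |t|) * dist x y := by
  have hcont : ∀ z, Continuous fun s => flow c s z := fun z =>
    continuous_iff_continuousAt.2 fun s => (h.hasDerivAt_flow z s).continuousAt
  rcases le_total 0 t with ht | ht
  · have := dist_le_of_trajectories_ODE (v := fun _ => c) (K := L) (a := 0) (b := t)
      (f := fun s => flow c s x) (g := fun s => flow c s y) (δ := dist x y)
      (fun _ => h.lipschitz) (hcont x).continuousOn
      (fun s _ => (h.hasDerivAt_flow x s).hasDerivWithinAt) (hcont y).continuousOn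
      (fun s _ => (h.hasDerivAt_flow y s).hasDerivWithinAt) (by simp [h.flow_zero])
      t ⟨ht, le_rfl⟩
    rw [abs_of_nonneg ht]
    rwa [sub_zero, mul_comm] at this
  · have hd : ∀ z s, HasDerivAt (fun s => flow c (-s) z) (-c (flow c (-s) z)) s := fun z s => by
      have := (h.hasDerivAt_flow z (-s)).scomp s (hasDerivAt_neg s)
      simpa [Function.comp_def] using this
    have := dist_le_of_trajectories_ODE (v := fun _ z => -c z) (K := L) (a := 0) (b := -t)
      (f := fun s => flow c (-s) x) (g := fun s => flow c (-s) y) (δ := dist x y)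
      (fun _ => h.lipschitz.neg) ((hcont x).comp continuous_neg).continuousOn
      (fun s _ => (hd x s).hasDerivWithinAt) ((hcont y).comp continuous_neg).continuousOn
      (fun s _ => (hd y s).hasDerivWithinAt) (by simp [h.flow_zero])
      (-t) ⟨by linarith, le_rfl⟩
    rwa [sub_zero, mul_comm, neg_neg, ← abs_of_nonpos ht] at this

theorem VelocityBounds.lipschitz_flow (h : VelocityBounds c M L) (t : ℝ) :
    LipschitzWith (Real.exp (L * |t|)).toNNReal (flow c t) :=
  LipschitzWith.of_dist_le_mul fun x y => by
    rw [Real.coe_toNNReal _ (Real.exp_pos _).le]; exact h.dist_flow_le t x y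

theorem VelocityBounds.continuous_flow (h : VelocityBounds c M L) :
    Continuous fun p : ℝ × Plane => flow c p.1 p.2 := by
  refine continuous_iff_continuousAt.2 fun p => tendsto_iff_dist_tendsto_zero.2 ?_
  refine squeeze_zero (g := fun q : ℝ × Plane =>
    Real.exp (L * |q.1|) * dist q.2 p.2 + M * |q.1 - p.1|) (fun _ => dist_nonneg) (fun q => ?_) ?_
  · refine (dist_triangle _ (flow c q.1 p.2) _).trans (add_le_add (h.dist_flow_le _ _ _) ?_)
    rw [dist_eq_norm]; exact h.norm_flow_sub_flow_le _ _ _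
  · have : Continuous fun q : ℝ × Plane =>
      Real.exp (L * |q.1|) * dist q.2 p.2 + M * |q.1 - p.1| := by fun_prop
    simpa using this.tendsto p

/-- First order expansion of the backward flow, in Lipschitz norm. -/
theorem VelocityBounds.exists_flow_expansion (h : VelocityBounds c M L) {e : ℝ} (he : 0 < e) :
    ∃ t₀ > 0, ∀ t : ℝ, 0 ≤ t → t ≤ t₀ → ∀ x y,
      ‖(flow c (-t) x - x + t • c x) - (flow c (-t) y - y + t • c y)‖ ≤ e * ‖x - y‖ * t := by
  obtain ⟨d, hd, hdc⟩ := Metric.uniformContinuous_iff.1 h.regular.uniformContinuous_fderiv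
    (e / (2 * Real.exp L)) (by positivity)
  -- The three bounds ensure, respectively: `e^{Ls} ≤ e^L`; displacements `M s` below the modulus
  -- `d` of uniform continuity; and `L² e^L s ≤ e / 2`.
  set t₀ : ℝ := min 1 (min (d / (2 * (M + 1))) (e / (2 * (L * L * Real.exp L + 1)))) with ht₀
  have ht1 : t₀ ≤ 1 := min_le_left _ _
  have ht2 : t₀ ≤ d / (2 * (M + 1)) := (min_le_right _ _).trans (min_le_left _ _)
  have ht3 : t₀ ≤ e / (2 * (L * L * Real.exp L + 1)) := (min_le_right _ _).trans (min_le_right _ _)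
  refine ⟨t₀, by positivity, fun t ht htt x y => ?_⟩
  have hderiv : ∀ z s, HasDerivAt (fun s => flow c (-s) z) (-c (flow c (-s) z)) s := fun z s => by
    have := (h.hasDerivAt_flow z (-s)).scomp s (hasDerivAt_neg s)
    simpa [Function.comp_def] using this
  have hexp : ∀ s, 0 ≤ s → s ≤ t → Real.exp (L * |-s|) ≤ Real.exp L := fun s hs hst => by
    rw [Real.exp_le_exp, abs_neg, abs_of_nonneg hs]
    exact mul_le_of_le_one_right L.2 (by linarith)
  have hlip : ∀ s, 0 ≤ s → s ≤ t → ‖flow c (-s) x - flow c (-s) y‖ ≤ Real.exp L * ‖x - y‖ :=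
    fun s hs hst => by
      rw [← dist_eq_norm, ← dist_eq_norm]
      exact (h.dist_flow_le _ _ _).trans (mul_le_mul_of_nonneg_right (hexp s hs hst) dist_nonneg)
  have hlip2 : ∀ s, 0 ≤ s → s ≤ t → ‖(flow c (-s) x - flow c (-s) y) - (x - y)‖ ≤
      L * (Real.exp L * ‖x - y‖) * s := by
    intro s hs hst
    have := norm_image_sub_le_of_norm_deriv_le_segment' (a := 0) (b := s)
      (f := fun r => flow c (-r) x - flow c (-r) y) (C := L * (Real.exp L * ‖x - y‖))
      (fun r _ => ((hderiv x r).sub (hderiv y r)).hasDerivWithinAt) (fun r hr => ?_) s ⟨hs, le_rfl⟩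
    · simpa [h.flow_zero] using this
    · rw [neg_sub_neg, norm_sub_rev]
      exact (h.lipschitz.norm_sub_le _ _).trans
        (mul_le_mul_of_nonneg_left (hlip r hr.1 (hr.2.le.trans hst)) L.2)
  have hsecond : ∀ s, 0 ≤ s → s ≤ t →
      ‖(c (flow c (-s) x) - c (flow c (-s) y)) - (c x - c y)‖ ≤ e * ‖x - y‖ := by
    intro s hs hst
    set p := flow c (-s) x
    set q := flow c (-s) y
    have hpx : ‖p - x‖ ≤ M * s := by
      have := h.norm_flow_sub_flow_le (-s) 0 x
      rwa [h.flow_zero, sub_zero, abs_neg, abs_of_nonneg hs] at this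
    have hqy : ‖q - y‖ ≤ M * s := by
      have := h.norm_flow_sub_flow_le (-s) 0 y
      rwa [h.flow_zero, sub_zero, abs_neg, abs_of_nonneg hs] at this
    have hMs : M * s < d := by
      have h1 : (M : ℝ) * s ≤ (M + 1) * (d / (2 * (M + 1))) :=
        mul_le_mul (by linarith) (hst.trans (htt.trans ht2)) hs (by positivity)
      have h2 : ((M : ℝ) + 1) * (d / (2 * (M + 1))) = d / 2 := by field_simp
      linarith
    have hg : ∀ (a b : Plane) (θ : ℝ), HasDerivAt (fun θ : ℝ => c (b + θ • (a - b)))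
        (fderiv ℝ c (b + θ • (a - b)) (a - b)) θ := by
      intro a b θ
      have h1 : HasDerivAt (fun θ : ℝ => b + θ • (a - b)) (a - b) θ := by
        simpa using ((hasDerivAt_id θ).smul_const (a - b)).const_add b
      exact (h.differentiable _).hasFDerivAt.comp_hasDerivAt θ h1
    -- The segments from `q` to `p` and from `y` to `x` are run through simultaneously. The
    -- derivative splits into `(D - D')(p - q)`, small by uniform continuity, and `D'((p - q) - (x -
    -- y))`, small because the flow has barely changed the difference.
    have := norm_image_sub_le_of_norm_deriv_le_segment' (a := 0) (b := 1)
      (f := fun θ : ℝ => c (q + θ • (p - q)) - c (y + θ • (x - y))) (C := e * ‖x - y‖)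
      (fun θ _ => ((hg p q θ).sub (hg x y θ)).hasDerivWithinAt) (fun θ hθ => ?_) 1 (by simp)
    · simp only [one_smul, add_sub_cancel, zero_smul, add_zero, sub_zero, mul_one] at this
      rwa [sub_sub_sub_comm] at this
    · set D := fderiv ℝ c (q + θ • (p - q))
      set D' := fderiv ℝ c (y + θ • (x - y))
      have e1 : D (p - q) - D' (x - y) = (D - D') (p - q) + D' ((p - q) - (x - y)) := by
        simp only [sub_apply, map_sub]; abel
      have hdist : dist (q + θ • (p - q)) (y + θ • (x - y)) < d := by
        rw [dist_eq_norm]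
        have e2 : q + θ • (p - q) - (y + θ • (x - y)) = (1 - θ) • (q - y) + θ • (p - x) := by
          module
        rw [e2]
        refine lt_of_le_of_lt (norm_add_le _ _) ?_
        rw [norm_smul, norm_smul, Real.norm_of_nonneg hθ.1, Real.norm_of_nonneg
          (by linarith [hθ.2])]
        have h3 := mul_le_mul_of_nonneg_left hqy (by linarith [hθ.2] : (0 : ℝ) ≤ 1 - θ)
        have h4 := mul_le_mul_of_nonneg_left hpx hθ.1
        linarith
      have hDD := hdc hdist
      rw [dist_eq_norm] at hDD
      rw [e1]
      have b1 : ‖(D - D') (p - q)‖ ≤ e / 2 * ‖x - y‖ := by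
        calc _ ≤ ‖D - D'‖ * ‖p - q‖ := (D - D').le_opNorm _
          _ ≤ e / (2 * Real.exp L) * (Real.exp L * ‖x - y‖) :=
            mul_le_mul hDD.le (hlip s hs hst) (norm_nonneg _) (by positivity)
          _ = e / 2 * ‖x - y‖ := by field_simp
      have b2 : ‖D' ((p - q) - (x - y))‖ ≤ e / 2 * ‖x - y‖ := by
        calc _ ≤ ‖D'‖ * ‖(p - q) - (x - y)‖ := D'.le_opNorm _
          _ ≤ L * (L * (Real.exp L * ‖x - y‖) * s) :=
            mul_le_mul (h.norm_fderiv_le _) (hlip2 s hs hst) (norm_nonneg _) L.2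
          _ = (L * L * Real.exp L) * s * ‖x - y‖ := by ring
          _ ≤ e / 2 * ‖x - y‖ := by
            refine mul_le_mul_of_nonneg_right ?_ (norm_nonneg _)
            calc (L : ℝ) * L * Real.exp L * s ≤ (L * L * Real.exp L + 1) *
                (e / (2 * (L * L * Real.exp L + 1))) :=
                  mul_le_mul (by linarith) (hst.trans (htt.trans ht3)) hs (by positivity)
              _ = e / 2 := by field_simp
      linarith [norm_add_le ((D - D') (p - q)) (D' ((p - q) - (x - y)))]
  have := norm_image_sub_le_of_norm_deriv_le_segment' (a := 0) (b := t)
    (f := fun r => (flow c (-r) x - x + r • c x) - (flow c (-r) y - y + r • c y))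
    (C := e * ‖x - y‖) (f' := fun r => (-c (flow c (-r) x) + c x) - (-c (flow c (-r) y) + c y))
    (fun r _ => ?_) (fun r hr => ?_) t ⟨ht, le_rfl⟩
  · simpa [h.flow_zero] using this
  · have h1 : ∀ z, HasDerivAt (fun r => flow c (-r) z - z + r • c z)
        (-c (flow c (-r) z) + c z) r := fun z => by
      have h2 : HasDerivAt (fun r : ℝ => r • c z) (c z) r := by
        simpa using (hasDerivAt_id r).smul_const (c z)
      exact ((hderiv z r).sub_const z).add h2
    exact ((h1 x).sub (h1 y)).hasDerivWithinAt
  · have e1 : (-c (flow c (-r) x) + c x) - (-c (flow c (-r) y) + c y) =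
        -((c (flow c (-r) x) - c (flow c (-r) y)) - (c x - c y)) := by abel
    rw [e1, norm_neg]
    exact hsecond r hr.1 hr.2.le

end Velocity

end ReturnHome

namespace ReturnHome

/-! ### The Jacobian of the backward flow -/

section Jacobian

theorem det_plane (A : Plane →L[ℝ] Plane) : A.det =
    (A (EuclideanSpace.single 0 1)) 0 * (A (EuclideanSpace.single 1 1)) 1 -
    (A (EuclideanSpace.single 1 1)) 0 * (A (EuclideanSpace.single 0 1)) 1 := by
  rw [ContinuousLinearMap.det, ← LinearMap.det_toMatrix
    (EuclideanSpace.basisFun (Fin 2) ℝ).toBasis, Matrix.det_fin_two]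
  simp [LinearMap.toMatrix_apply]

theorem abs_apply_single_le (A : Plane →L[ℝ] Plane) (i j : Fin 2) :
    |(A (EuclideanSpace.single i 1)) j| ≤ ‖A‖ := by
  refine (PiLp.norm_apply_le (A (EuclideanSpace.single i 1)) j).trans ?_
  simpa using A.le_opNorm (EuclideanSpace.single i (1 : ℝ))

/-- In the plane `det (1 + N) = 1 + tr N + det N`. The trace of `N = R - t D` gives the divergence
term with error `2r`, and `det N` is quadratic in `‖N‖ ≤ r + t L`. -/
theorem abs_det_sub_le (A D : Plane →L[ℝ] Plane) {r t L : ℝ} (ht : 0 ≤ t) (hD : ‖D‖ ≤ L)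
    (h : ‖A - 1 + t • D‖ ≤ r) :
    |A.det - (1 - t * ∑ i : Fin 2, (D (EuclideanSpace.single i 1)) i)| ≤
      2 * r + 2 * (r + t * L) ^ 2 := by
  set R := A - 1 + t • D with hR
  set N := A - 1 with hN
  have hNn : ‖N‖ ≤ r + t * L := by
    have e1 : N = R - t • D := by rw [hR]; abel
    rw [e1]
    refine (norm_sub_le _ _).trans (add_le_add h ?_)
    rw [norm_smul, Real.norm_of_nonneg ht]
    exact mul_le_mul_of_nonneg_left hD ht
  have hA : A = 1 + N := by rw [hN]; abel
  have hRr : ∀ i, |(R (EuclideanSpace.single i 1)) i| ≤ r := fun i =>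
    (abs_apply_single_le R i i).trans h
  have hNr : ∀ i j, |(N (EuclideanSpace.single i 1)) j| ≤ r + t * L := fun i j =>
    (abs_apply_single_le N i j).trans hNn
  have hRN : ∀ i, (R (EuclideanSpace.single i 1)) i =
      (N (EuclideanSpace.single i 1)) i + t * (D (EuclideanSpace.single i 1)) i := fun i => by
    simp [hR]
  have key : A.det - (1 - t * ∑ i : Fin 2, (D (EuclideanSpace.single i 1)) i) =
      ((R (EuclideanSpace.single 0 1)) 0 + (R (EuclideanSpace.single 1 1)) 1) +
      ((N (EuclideanSpace.single 0 1)) 0 * (N (EuclideanSpace.single 1 1)) 1 -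
      (N (EuclideanSpace.single 1 1)) 0 * (N (EuclideanSpace.single 0 1)) 1) := by
    rw [det_plane, hA, hRN, hRN, Fin.sum_univ_two]
    simp
    ring
  have hmul : ∀ i j k l, |(N (EuclideanSpace.single i 1)) j * (N (EuclideanSpace.single k 1)) l| ≤
      (r + t * L) ^ 2 := fun i j k l => by
    rw [abs_mul, sq]
    exact mul_le_mul (hNr _ _) (hNr _ _) (abs_nonneg _) ((abs_nonneg _).trans (hNr i j))
  rw [key]
  have h1 := hmul 0 0 1 1
  have h2 := hmul 1 0 0 1
  have h3 := hRr 0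
  have h4 := hRr 1
  rw [abs_le] at *
  constructor <;> linarith [h1.1, h1.2, h2.1, h2.2, h3.1, h3.2, h4.1, h4.2]

/-- The Jacobian of the backward flow. -/
noncomputable def jac (c : Plane → Plane) (t : ℝ) (x : Plane) : ℝ :=
  |(fderiv ℝ (flow c (-t)) x).det|

/-- The density factor in the transport semigroup. -/
noncomputable def weight (c : Plane → Plane) (t : ℝ) (x : Plane) : ℝ :=
  Real.exp (-∫ s in (0 : ℝ)..t, divergence c (flow c (-s) x))

variable {c : Plane → Plane} {M L : ℝ≥0}

theorem VelocityBounds.abs_divergence_le (h : VelocityBounds c M L) (x : Plane) :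
    |divergence c x| ≤ 2 * L := by
  rw [divergence, Fin.sum_univ_two]
  have h0 := (abs_apply_single_le (fderiv ℝ c x) 0 0).trans (h.norm_fderiv_le x)
  have h1 := (abs_apply_single_le (fderiv ℝ c x) 1 1).trans (h.norm_fderiv_le x)
  linarith [abs_add_le ((fderiv ℝ c x) (EuclideanSpace.single 0 1) 0)
    ((fderiv ℝ c x) (EuclideanSpace.single 1 1) 1)]

theorem abs_divergence_sub_le (c : Plane → Plane) (x y : Plane) :
    |divergence c x - divergence c y| ≤ 2 * ‖fderiv ℝ c x - fderiv ℝ c y‖ := by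
  rw [divergence, divergence, Fin.sum_univ_two, Fin.sum_univ_two]
  have h0 := abs_apply_single_le (fderiv ℝ c x - fderiv ℝ c y) 0 0
  have h1 := abs_apply_single_le (fderiv ℝ c x - fderiv ℝ c y) 1 1
  simp only [sub_apply, PiLp.sub_apply] at h0 h1
  rw [abs_le] at *
  constructor <;> linarith [h0.1, h0.2, h1.1, h1.2]

theorem VelocityBounds.continuous_divergence (h : VelocityBounds c M L) :
    Continuous (divergence c) := by
  have h1 : Continuous (fderiv ℝ c) := h.regular.uniformContinuous_fderiv.continuous
  unfold divergence
  fun_prop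

theorem VelocityBounds.continuous_divergence_flow (h : VelocityBounds c M L) :
    Continuous fun p : Plane × ℝ => divergence c (flow c (-p.2) p.1) :=
  h.continuous_divergence.comp (h.continuous_flow.comp (by fun_prop : Continuous
    fun p : Plane × ℝ => (-p.2, p.1)))

theorem VelocityBounds.continuous_weight (h : VelocityBounds c M L) (t : ℝ) :
    Continuous (weight c t) :=
  Real.continuous_exp.comp (intervalIntegral.continuous_parametric_intervalIntegral_of_continuous'
    h.continuous_divergence_flow 0 t).neg

theorem VelocityBounds.abs_integral_divergence_le (h : VelocityBounds c M L) {t : ℝ} (ht : 0 ≤ t)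
    (x : Plane) : |∫ s in (0 : ℝ)..t, divergence c (flow c (-s) x)| ≤ 2 * L * t := by
  have := intervalIntegral.norm_integral_le_of_norm_le_const (a := 0) (b := t)
    (f := fun s => divergence c (flow c (-s) x)) (C := 2 * L)
    (fun s _ => h.abs_divergence_le _)
  rwa [sub_zero, abs_of_nonneg ht] at this

theorem VelocityBounds.norm_flow_neg_sub_le (h : VelocityBounds c M L) {t : ℝ} (ht : 0 ≤ t)
    (x : Plane) : ‖flow c (-t) x - x‖ ≤ M * t := by
  have := h.norm_flow_sub_flow_le (-t) 0 x
  rwa [h.flow_zero, sub_zero, abs_neg, abs_of_nonneg ht] at this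

theorem VelocityBounds.exists_weight_expansion (h : VelocityBounds c M L) {e : ℝ} (he : 0 < e) :
    ∃ t₀ > 0, ∀ t : ℝ, 0 ≤ t → t ≤ t₀ → ∀ x,
      |weight c t x - (1 - t * divergence c x)| ≤ e * t := by
  obtain ⟨d, hd, hdc⟩ := Metric.uniformContinuous_iff.1 h.regular.uniformContinuous_fderiv
    (e / 4) (by positivity)
  refine ⟨min (1 / (2 * L + 1)) (min (d / (2 * (M + 1))) (e / (2 * (4 * L ^ 2 + 1)))),
    by positivity, fun t ht htt x => ?_⟩
  have ht1 := htt.trans (min_le_left _ _)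
  have ht2 := (htt.trans (min_le_right _ _)).trans (min_le_left _ _)
  have ht3 := (htt.trans (min_le_right _ _)).trans (min_le_right _ _)
  rw [le_div_iff₀ (by positivity)] at ht1 ht2 ht3
  set I := ∫ s in (0 : ℝ)..t, divergence c (flow c (-s) x) with hI
  have hI1 : |I| ≤ 2 * L * t := h.abs_integral_divergence_le ht x
  have hI2 : |I - t * divergence c x| ≤ e / 2 * t := by
    have e1 : I - t * divergence c x =
        ∫ s in (0 : ℝ)..t, (divergence c (flow c (-s) x) - divergence c x) := by
      rw [intervalIntegral.integral_sub, intervalIntegral.integral_const, sub_zero, smul_eq_mul]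
      · exact (h.continuous_divergence_flow.comp (by fun_prop : Continuous
          fun s : ℝ => (x, s))).intervalIntegrable _ _
      · exact intervalIntegrable_const
    rw [e1]
    have := intervalIntegral.norm_integral_le_of_norm_le_const (a := 0) (b := t)
      (f := fun s => divergence c (flow c (-s) x) - divergence c x) (C := e / 2) (fun s hs => ?_)
    · rwa [sub_zero, abs_of_nonneg ht] at this
    · rw [Set.uIoc_of_le ht] at hs
      refine (abs_divergence_sub_le _ _ _).trans ?_
      have hdist : dist (flow c (-s) x) x < d := by
        rw [dist_eq_norm]
        refine (h.norm_flow_neg_sub_le hs.1.le x).trans_lt ?_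
        have : (M : ℝ) * s ≤ M * t := mul_le_mul_of_nonneg_left hs.2 M.2
        nlinarith
      have := hdc hdist
      rw [dist_eq_norm] at this
      linarith
  have hexp : |weight c t x - 1 - -I| ≤ I ^ 2 := by
    have := Real.abs_exp_sub_one_sub_id_le (x := -I) (by
      rw [abs_neg]; refine hI1.trans ?_; linarith)
    rwa [neg_sq] at this
  have hsq : I ^ 2 ≤ e / 2 * t := by
    calc I ^ 2 = |I| ^ 2 := (sq_abs I).symm
      _ ≤ (2 * L * t) ^ 2 := pow_le_pow_left₀ (abs_nonneg _) hI1 2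
      _ = 4 * L ^ 2 * t * t := by ring
      _ ≤ e / 2 * t := mul_le_mul_of_nonneg_right (by linarith) ht
  have e2 : weight c t x - (1 - t * divergence c x) =
      (weight c t x - 1 - -I) - (I - t * divergence c x) := by ring
  rw [e2]
  refine (abs_sub _ _).trans ?_
  linarith

/-- The remainder of the flow expansion has Lipschitz constant `(e / 4) t`, which bounds its
derivative at every point where the flow is differentiable. -/
theorem VelocityBounds.exists_det_expansion (h : VelocityBounds c M L) {e : ℝ} (he : 0 < e) :
    ∃ t₀ > 0, ∀ t : ℝ, 0 ≤ t → t ≤ t₀ → ∀ x, DifferentiableAt ℝ (flow c (-t)) x →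
      |(fderiv ℝ (flow c (-t)) x).det - (1 - t * divergence c x)| ≤ e * t := by
  obtain ⟨t₀, ht₀, hexp⟩ := h.exists_flow_expansion (e := e / 4) (by positivity)
  refine ⟨min t₀ (e / (4 * (e / 4 + L) ^ 2)), by positivity, fun t ht htt x hx => ?_⟩
  have ht1 := htt.trans (min_le_left _ _)
  have ht2 := htt.trans (min_le_right _ _)
  rw [le_div_iff₀ (by positivity)] at ht2
  have hn : ‖fderiv ℝ (flow c (-t)) x - 1 + t • fderiv ℝ c x‖ ≤ e / 4 * t := by
    have hd : HasFDerivAt (fun z => flow c (-t) z - z + t • c z)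
        (fderiv ℝ (flow c (-t)) x - 1 + t • fderiv ℝ c x) x :=
      (hx.hasFDerivAt.sub (hasFDerivAt_id x)).add
        ((h.differentiable x).hasFDerivAt.const_smul t)
    refine hd.le_of_lip' (by positivity) (Eventually.of_forall fun z => ?_)
    refine (hexp t ht ht1 z x).trans (le_of_eq (by ring))
  refine (abs_det_sub_le _ _ ht (h.norm_fderiv_le x) hn).trans ?_
  have e1 : 2 * (e / 4 * t) + 2 * (e / 4 * t + t * L) ^ 2 =
    e / 2 * t + (t * (4 * (e / 4 + L) ^ 2)) / 2 * t := by ring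
  rw [e1]
  nlinarith

/-- A first order substitute for Liouville's formula: both quantities are `1 - t div c + o(t)`
uniformly in `x`. The error is measured relative to the Jacobian so that it can be integrated by
change of variables. -/
theorem VelocityBounds.exists_abs_weight_sub_jac_le (h : VelocityBounds c M L) {e : ℝ}
    (he : 0 < e) :
    ∃ t₀ > 0, ∀ t : ℝ, 0 ≤ t → t ≤ t₀ → ∀ x, DifferentiableAt ℝ (flow c (-t)) x →
      |weight c t x - jac c t x| ≤ t * e * jac c t x := by
  obtain ⟨t₁, ht₁, h1⟩ := h.exists_det_expansion (e := e / 4) (by positivity)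
  obtain ⟨t₂, ht₂, h2⟩ := h.exists_weight_expansion (e := e / 4) (by positivity)
  -- The last entry forces the determinant to be at least `1 / 2`, which turns the absolute error
  -- `(e / 2) t` into a relative one.
  refine ⟨min (min t₁ t₂) (1 / (2 * (2 * L + e / 4))), by positivity, fun t ht htt x hx => ?_⟩
  have hta := htt.trans (min_le_left _ _)
  have htb := htt.trans (min_le_right _ _)
  rw [le_div_iff₀ (by positivity)] at htb
  have a1 := abs_le.1 (h1 t ht (hta.trans (min_le_left _ _)) x hx)
  have a2 := abs_le.1 (h2 t ht (hta.trans (min_le_right _ _)) x)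
  have a3 := abs_le.1 (h.abs_divergence_le x)
  have hdiv : t * divergence c x ≤ t * (2 * L) := mul_le_mul_of_nonneg_left a3.2 ht
  set d := (fderiv ℝ (flow c (-t)) x).det
  have hd : 1 / 2 ≤ d := by nlinarith [a1.1]
  have hj : jac c t x = d := abs_of_nonneg (by linarith)
  rw [hj]
  have hb : e / 2 * t ≤ t * e * d := by nlinarith [mul_nonneg ht he.le]
  refine (abs_le.2 ⟨?_, ?_⟩ : |_| ≤ e / 2 * t).trans hb <;>
    linarith [a1.1, a1.2, a2.1, a2.2]

end Jacobian

end ReturnHome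

namespace ReturnHome

/-! ### The change of variables along the flow -/

section ChangeOfVariables

/-- Lebesgue measure and two-dimensional Hausdorff measure have the same null sets, and a Lipschitz
map enlarges the latter at most by a constant factor. -/
theorem volume_image_eq_zero {K : ℝ≥0} {f : Plane → Plane} (hf : LipschitzWith K f)
    {s : Set Plane} (hs : volume s = 0) : volume (f '' s) = 0 := by
  have h0 : Measure.hausdorffMeasure (Module.finrank ℝ Plane : ℝ) s = 0 :=
    Measure.absolutelyContinuous_isAddHaarMeasure
      (Measure.hausdorffMeasure (Module.finrank ℝ Plane : ℝ)) (volume : Measure Plane) hs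
  refine Measure.absolutelyContinuous_isAddHaarMeasure (volume : Measure Plane)
    (Measure.hausdorffMeasure (Module.finrank ℝ Plane : ℝ)) ?_
  have := hf.hausdorffMeasure_image_le (d := Module.finrank ℝ Plane) (Nat.cast_nonneg _) s
  rw [h0, mul_zero] at this
  exact le_antisymm this zero_le

variable {c : Plane → Plane} {M L : ℝ≥0}

theorem VelocityBounds.preimage_flow (h : VelocityBounds c M L) (t : ℝ) (s : Set Plane) :
    flow c (-t) ⁻¹' s = flow c t '' s := by
  ext x
  constructor
  · exact fun hx => ⟨_, hx, h.flow_flow_neg t x⟩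
  · rintro ⟨z, hz, rfl⟩
    rwa [Set.mem_preimage, h.flow_neg_flow]

theorem VelocityBounds.quasiMeasurePreserving_flow (h : VelocityBounds c M L) (t : ℝ) :
    Measure.QuasiMeasurePreserving (flow c (-t)) volume volume := by
  have hm := (h.lipschitz_flow (-t)).continuous.measurable
  refine ⟨hm, Measure.AbsolutelyContinuous.mk fun s hs h0 => ?_⟩
  rw [Measure.map_apply hm hs, h.preimage_flow]
  exact volume_image_eq_zero (h.lipschitz_flow t) h0

theorem VelocityBounds.ae_differentiableAt_flow (h : VelocityBounds c M L) (t : ℝ) :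
    ∀ᵐ x, DifferentiableAt ℝ (flow c (-t)) x := (h.lipschitz_flow (-t)).ae_differentiableAt

theorem VelocityBounds.injective_flow (h : VelocityBounds c M L) (t : ℝ) :
    Function.Injective (flow c (-t)) := fun x y hxy => by
  rw [← h.flow_flow_neg t x, hxy, h.flow_flow_neg]

theorem VelocityBounds.restrict_differentiableAt (h : VelocityBounds c M L) (t : ℝ) :
    (volume : Measure Plane).restrict {x | DifferentiableAt ℝ (flow c (-t)) x} = volume :=
  Measure.restrict_eq_self_of_ae_mem (h.ae_differentiableAt_flow t)

/-- The points of non-differentiability are null by Rademacher and have null image, so the change of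
variables over the differentiability set covers the whole plane. -/
theorem VelocityBounds.restrict_image (h : VelocityBounds c M L) (t : ℝ) :
    (volume : Measure Plane).restrict (flow c (-t) '' {x | DifferentiableAt ℝ (flow c (-t)) x}) =
      volume := by
  refine Measure.restrict_eq_self_of_ae_mem ?_
  have h0 : volume (flow c (-t) '' {x | ¬DifferentiableAt ℝ (flow c (-t)) x}) = 0 :=
    volume_image_eq_zero (h.lipschitz_flow (-t)) (h.ae_differentiableAt_flow t)
  rw [ae_iff]
  refine measure_mono_null (fun x hx => ?_) h0
  exact ⟨flow c t x, fun hd => hx ⟨_, hd, h.flow_neg_flow t x⟩, h.flow_neg_flow t x⟩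

theorem VelocityBounds.integrable_jac_mul (h : VelocityBounds c M L) (t : ℝ) {g : Plane → ℝ}
    (hg : Integrable g volume) :
    Integrable (fun x => jac c t x * g (flow c (-t) x)) volume := by
  have := (integrableOn_image_iff_integrableOn_abs_det_fderiv_smul (volume : Measure Plane)
    (measurableSet_of_differentiableAt ℝ (flow c (-t)))
    (fun x hx => (DifferentiableAt.hasFDerivAt hx).hasFDerivWithinAt)
    (h.injective_flow t).injOn g).1 hg.integrableOn
  rwa [IntegrableOn, h.restrict_differentiableAt] at this

theorem VelocityBounds.integral_jac_mul (h : VelocityBounds c M L) (t : ℝ) (g : Plane → ℝ) :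
    ∫ x, jac c t x * g (flow c (-t) x) = ∫ x, g x := by
  have := integral_image_eq_integral_abs_det_fderiv_smul (volume : Measure Plane)
    (measurableSet_of_differentiableAt ℝ (flow c (-t)))
    (fun x hx => (DifferentiableAt.hasFDerivAt hx).hasFDerivWithinAt)
    (h.injective_flow t).injOn g
  rw [h.restrict_image, h.restrict_differentiableAt] at this
  exact this.symm

theorem jac_nonneg (c : Plane → Plane) (t : ℝ) (x : Plane) : 0 ≤ jac c t x := abs_nonneg _

theorem integralL1_classL1 {f : Plane → ℝ} (hf : Integrable f volume) :
    integralL1 (classL1 f) = ∫ x, f x := integral_congr_ae (coeFn_classL1 hf)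

theorem norm_classL1 {f : Plane → ℝ} (hf : Integrable f volume) : ‖classL1 f‖ = ∫ x, |f x| := by
  rw [L1_norm_eq]
  refine integral_congr_ae ?_
  filter_upwards [coeFn_classL1 hf] with x hx
  rw [hx]

theorem negInt_classL1 {f : Plane → ℝ} (hf : Integrable f volume) :
    negInt (classL1 f) = ∫ x, max (-f x) 0 := by
  refine integral_congr_ae ?_
  filter_upwards [coeFn_classL1 hf] with x hx
  rw [hx]

theorem classL1_sub {f g : Plane → ℝ} (hf : Integrable f volume) (hg : Integrable g volume) :
    classL1 f - classL1 g = classL1 fun x => f x - g x := by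
  refine eq_classL1_of_ae_eq ?_
  filter_upwards [Lp.coeFn_sub (classL1 f) (classL1 g), coeFn_classL1 hf, coeFn_classL1 hg]
    with x h1 h2 h3
  rw [h1, Pi.sub_apply, h2, h3]

theorem classL1_smul {f : Plane → ℝ} (r : ℝ) (hf : Integrable f volume) :
    r • classL1 f = classL1 fun x => r * f x := by
  refine eq_classL1_of_ae_eq ?_
  filter_upwards [Lp.coeFn_smul r (classL1 f), coeFn_classL1 hf] with x h1 h2
  rw [h1, Pi.smul_apply, h2, smul_eq_mul]

/-- The transport operators are close to push-forwards along the flow. -/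
theorem VelocityBounds.exists_transport_estimate (h : VelocityBounds c M L) {e : ℝ} (he : 0 < e) :
    ∃ t₀ > 0, ∀ t : ℝ≥0, t ≤ t₀ → ∀ v : L1,
      Integrable (fun x => weight c t x * v (flow c (-(t : ℝ)) x)) volume ∧
      ∃ Q : L1, integralL1 Q = integralL1 v ∧ negInt Q = negInt v ∧ ‖Q‖ = ‖v‖ ∧
        ‖transportOp c t v - Q‖ ≤ t * e * ‖v‖ := by
  obtain ⟨t₀, ht₀, hw⟩ := h.exists_abs_weight_sub_jac_le he
  refine ⟨⟨t₀, ht₀.le⟩, ht₀, fun t ht v => ?_⟩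
  have hj := h.integrable_jac_mul t (L1_integrable v)
  have hja := h.integrable_jac_mul t (L1_integrable v).abs
  have hpt : ∀ᵐ x, |weight c t x * v (flow c (-(t : ℝ)) x) - jac c t x * v (flow c (-(t : ℝ)) x)| ≤
      t * e * (jac c t x * |v (flow c (-(t : ℝ)) x)|) := by
    filter_upwards [h.ae_differentiableAt_flow t] with x hx
    rw [← sub_mul, abs_mul, ← mul_assoc]
    exact mul_le_mul_of_nonneg_right (hw t t.coe_nonneg ht x hx) (abs_nonneg _)
  have hmeas : AEStronglyMeasurable (fun x => weight c t x * v (flow c (-(t : ℝ)) x)) volume :=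
    (h.continuous_weight t).aestronglyMeasurable.mul
      ((L1_integrable v).aestronglyMeasurable.comp_quasiMeasurePreserving
        (h.quasiMeasurePreserving_flow t))
  have hd : Integrable (fun x => weight c t x * v (flow c (-(t : ℝ)) x) -
      jac c t x * v (flow c (-(t : ℝ)) x)) volume :=
    (hja.const_mul (t * e)).mono' (hmeas.sub hj.aestronglyMeasurable) hpt
  have hi : Integrable (fun x => weight c t x * v (flow c (-(t : ℝ)) x)) volume := by
    have := hd.add hj
    refine this.congr (Eventually.of_forall fun x => ?_)
    simp
  -- With the exact Jacobian as density, composition with the flow preserves mass, negative part and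
  -- norm exactly.
  refine ⟨hi, classL1 fun x => jac c t x * v (flow c (-(t : ℝ)) x), ?_, ?_, ?_, ?_⟩
  · rw [integralL1_classL1 hj, h.integral_jac_mul]; rfl
  · rw [negInt_classL1 hj, negInt, ← h.integral_jac_mul t fun x => max (-v x) 0]
    congr 1; ext x
    rw [mul_max_of_nonneg _ _ (jac_nonneg c t x), mul_zero, mul_neg]
  · rw [norm_classL1 hj, L1_norm_eq, ← h.integral_jac_mul t fun x => |v x|]
    congr 1; ext x
    rw [abs_mul, abs_of_nonneg (jac_nonneg c t x)]
  · change ‖classL1 (fun x => weight c t x * v (flow c (-(t : ℝ)) x)) - _‖ ≤ _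
    rw [classL1_sub hi hj, norm_classL1 hd, L1_norm_eq, ← h.integral_jac_mul t fun x => |v x|,
      ← integral_const_mul]
    exact integral_mono_ae hd.abs (hja.const_mul _) hpt

/-- For small times the transport operators are bounded and linear. -/
theorem VelocityBounds.exists_transport_clm (h : VelocityBounds c M L) :
    ∃ t₀ > 0, ∃ A : ℝ≥0 → L1 →L[ℝ] L1, ∀ t : ℝ≥0, t ≤ t₀ → ∀ v,
      transportOp c t v = A t v ∧ ‖A t v‖ ≤ 2 * ‖v‖ := by
  obtain ⟨t₀, ht₀, hw⟩ := h.exists_transport_estimate one_pos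
  have key : ∀ t : ℝ≥0, t ≤ min t₀ 1 → ∃ A : L1 →L[ℝ] L1, ∀ v,
      transportOp c t v = A v ∧ ‖A v‖ ≤ 2 * ‖v‖ := by
    intro t ht
    have hi : ∀ v : L1, _ := fun v => (hw t (ht.trans (min_le_left _ _)) v).1
    have hq := h.quasiMeasurePreserving_flow t
    have hb : ∀ v : L1, ‖transportOp c t v‖ ≤ 2 * ‖v‖ := fun v => by
      obtain ⟨Q, -, -, hQ, hd⟩ := (hw t (ht.trans (min_le_left _ _)) v).2
      have ht1 : (t : ℝ) ≤ 1 := by exact_mod_cast ht.trans (min_le_right _ _)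
      have h1 : (t : ℝ) * 1 * ‖v‖ ≤ 1 * ‖v‖ :=
        mul_le_mul_of_nonneg_right (by linarith) (norm_nonneg _)
      have h2 := norm_add_le (transportOp c t v - Q) Q
      rw [sub_add_cancel] at h2
      linarith
    refine ⟨LinearMap.mkContinuous
      { toFun := transportOp c t
        map_add' := fun v w => (eq_classL1_of_ae_eq ?_).symm
        map_smul' := fun r v => (eq_classL1_of_ae_eq ?_).symm } 2 hb, fun v => ⟨rfl, hb v⟩⟩
    · filter_upwards [Lp.coeFn_add (transportOp c t v) (transportOp c t w), coeFn_classL1 (hi v),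
        coeFn_classL1 (hi w), hq.ae (Lp.coeFn_add v w)] with x h1 h2 h3 h4
      rw [h1, Pi.add_apply]
      refine (congrArg₂ (· + ·) h2 h3).trans ?_
      rw [h4, Pi.add_apply, ← mul_add]; rfl
    · filter_upwards [Lp.coeFn_smul r (transportOp c t v), coeFn_classL1 (hi v),
        hq.ae (Lp.coeFn_smul r v)] with x h1 h2 h4
      rw [RingHom.id_apply, h1, Pi.smul_apply]
      refine (congrArg (r • ·) h2).trans ?_
      rw [h4, Pi.smul_apply, smul_eq_mul, smul_eq_mul, mul_left_comm]; rfl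
  choose! A hA using key
  exact ⟨min t₀ 1, lt_min ht₀ one_pos, A, hA⟩

theorem eventually_le_nhdsGT {t₀ : ℝ≥0} (ht₀ : 0 < t₀) : ∀ᶠ t : ℝ≥0 in 𝓝[>] 0, t ≤ t₀ :=
  eventually_nhdsWithin_of_eventually_nhds (eventually_le_nhds ht₀)

/-- Over `{v < 0}` the integral of `v` is exactly `-negInt v`, while that of `Q` is at least
`-negInt Q ≥ -negInt v`. Thus the difference quotient has integral at least `-e` there, and total
integral of size at most `e`; errors of order `o(t)` disappear in the limit. -/
theorem generatorGraph_sign {F : ℝ≥0 → L1 → L1} {v b : L1} (hvb : (v, b) ∈ generatorGraph F)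
    (hF : ∀ e > 0, ∀ᶠ t : ℝ≥0 in 𝓝[>] 0, ∃ Q : L1, integralL1 Q = integralL1 v ∧
      negInt Q ≤ negInt v ∧ ‖F t v - Q‖ ≤ t * e) :
    0 ≤ (∫ x in {x | v x < 0}, b x) ∧ integralL1 b = 0 := by
  have hlim : Tendsto (fun t : ℝ≥0 => (t : ℝ)⁻¹ • (F t v - v)) (𝓝[>] 0) (𝓝 b) := hvb
  constructor
  · refine le_of_forall_pos_sub_le fun e he => ?_
    rw [zero_sub]
    refine ge_of_tendsto (((setIntegralL1 {x | v x < 0}).continuous.tendsto b).comp hlim) ?_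
    filter_upwards [hF e he, self_mem_nhdsWithin] with t ⟨Q, _, hQ, hd⟩ (ht : 0 < t)
    have ht' : (0 : ℝ) < t := ht
    have h1 := neg_negInt_le_setIntegralL1 {x | v x < 0} Q
    have h2 : setIntegralL1 {x | v x < 0} v = -negInt v := by
      rw [negInt_eq_setIntegral, integral_neg, neg_neg]; rfl
    have h3 : |setIntegralL1 {x | v x < 0} (F t v - Q)| ≤ ‖F t v - Q‖ := by
      rw [setIntegralL1_apply, L1_norm_eq]
      exact abs_integral_le_integral_abs.trans (setIntegral_le_integral (L1_integrable _).abs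
        (Eventually.of_forall fun x => abs_nonneg _))
    rw [map_sub] at h3
    have h4 := (abs_le.1 h3).1
    simp only [Function.comp_apply, map_smul, map_sub, smul_eq_mul]
    rw [inv_mul_eq_div, le_div_iff₀ ht']
    linarith
  · have h0 : ∀ e > 0, |integralL1 b| ≤ e := fun e he => by
      refine le_of_tendsto (((continuous_abs.comp integralL1.continuous).tendsto b).comp hlim) ?_
      filter_upwards [hF e he, self_mem_nhdsWithin] with t ⟨Q, hQ, _, hd⟩ (ht : 0 < t)
      have ht' : (0 : ℝ) < t := ht
      have h3 := abs_integralL1_le (F t v - Q)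
      rw [map_sub, hQ] at h3
      simp only [Function.comp_apply, map_smul, map_sub, smul_eq_mul, abs_mul, abs_inv,
        abs_of_pos ht']
      rw [inv_mul_eq_div, div_le_iff₀ ht']
      linarith
    exact abs_eq_zero.1 (le_antisymm (le_of_forall_pos_le_add fun e he => by
      rw [zero_add]; exact h0 e he) (abs_nonneg _))

theorem VelocityBounds.convectionGraph_sign (h : VelocityBounds c M L) {v b : L1}
    (hvb : (v, b) ∈ convectionGraph c) :
    0 ≤ (∫ x in {x | v x < 0}, b x) ∧ integralL1 b = 0 := by
  refine generatorGraph_sign hvb fun e he => ?_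
  have hv : 0 < ‖v‖ + 1 := by positivity
  obtain ⟨t₀, ht₀, hw⟩ := h.exists_transport_estimate (e := e / (‖v‖ + 1)) (by positivity)
  filter_upwards [eventually_le_nhdsGT ht₀] with t ht
  obtain ⟨Q, h1, h2, -, h3⟩ := (hw t ht v).2
  refine ⟨Q, h1, h2.le, h3.trans ?_⟩
  rw [mul_assoc]
  refine mul_le_mul_of_nonneg_left ?_ t.coe_nonneg
  rw [div_mul_eq_mul_div, div_le_iff₀ hv]
  exact mul_le_mul_of_nonneg_left (by linarith) he.le

theorem diffusionGraph_sign {ε : ℝ} (hε : 0 < ε) {v a : L1} (hva : (v, a) ∈ diffusionGraph ε) :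
    0 ≤ (∫ x in {x | v x < 0}, a x) ∧ integralL1 a = 0 := by
  refine generatorGraph_sign hva fun e he => Eventually.of_forall fun t =>
    ⟨heatCLM hε t v, integralL1_heatCLM hε t v, ?_, ?_⟩
  · have := neg_negInt_le_setIntegralL1_heatCLM hε t v {x | heatCLM hε t v x < 0}
    rw [negInt_eq_setIntegral (heatCLM hε t v), integral_neg]
    rw [setIntegralL1_apply] at this
    linarith
  · rw [heatOp_eq hε, sub_self, norm_zero]
    positivity

end ChangeOfVariables

end ReturnHome

/-! ### Smallness of transport relative to diffusion, and assembly of the full system. -/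

namespace ReturnHome

/-! ### Transport of Gaussians -/

section Gaussian

theorem le_exp_half_sq (u : ℝ) : u ≤ Real.exp (u ^ 2 / 2) := by
  nlinarith [Real.add_one_le_exp (u ^ 2 / 2), sq_nonneg (u - 1)]

/-- From `|x - z|² ≤ 2|y - z|² + 2m²`: evaluating at a point displaced by at most `m` costs a
constant factor and half of the decay rate. -/
theorem gaussian_shift_le {b m : ℝ} (hb : 0 ≤ b) {x y z : Plane} (h : ‖y - x‖ ≤ m) :
    Real.exp (-(b / 2) * ‖y - z‖ ^ 2) ≤
      Real.exp (b * m ^ 2 / 2) * Real.exp (-(b / 4) * ‖x - z‖ ^ 2) := by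
  rw [← Real.exp_add, Real.exp_le_exp]
  have h1 : ‖x - z‖ ≤ ‖y - z‖ + m := by
    have e : x - z = (y - z) - (y - x) := by abel
    rw [e]
    exact (norm_sub_le _ _).trans (by linarith)
  have h2 : ‖x - z‖ ^ 2 ≤ 2 * ‖y - z‖ ^ 2 + 2 * m ^ 2 := by
    have := pow_le_pow_left₀ (norm_nonneg _) h1 2
    nlinarith [sq_nonneg (‖y - z‖ - m)]
  nlinarith

variable {c : Plane → Plane} {M L : ℝ≥0}

theorem VelocityBounds.hasDerivAt_flow_neg (h : VelocityBounds c M L) (x : Plane) (r : ℝ) :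
    HasDerivAt (fun r => flow c (-r) x) (-c (flow c (-r) x)) r := by
  have := (h.hasDerivAt_flow x (-r)).scomp r (hasDerivAt_neg r)
  simpa [Function.comp_def] using this

theorem VelocityBounds.hasDerivAt_weight (h : VelocityBounds c M L) (x : Plane) (r : ℝ) :
    HasDerivAt (fun r => weight c r x) (weight c r x * -divergence c (flow c (-r) x)) r := by
  have hc : Continuous fun s : ℝ => divergence c (flow c (-s) x) :=
    h.continuous_divergence_flow.comp (by fun_prop : Continuous fun s : ℝ => (x, s))
  exact (hc.integral_hasStrictDerivAt 0 r).hasDerivAt.neg.exp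

theorem VelocityBounds.weight_le (h : VelocityBounds c M L) {t : ℝ} (ht : 0 ≤ t)
    (ht1 : 2 * L * t ≤ 1) (x : Plane) : weight c t x ≤ Real.exp 1 := by
  refine Real.exp_le_exp.2 ((neg_le_abs _).trans ?_)
  exact (h.abs_integral_divergence_le ht x).trans ht1

theorem weight_zero (c : Plane → Plane) (x : Plane) : weight c 0 x = 1 := by simp [weight]

theorem VelocityBounds.hasDerivAt_transport_gaussian (h : VelocityBounds c M L) (a b : ℝ)
    (z x : Plane) (r : ℝ) :
    HasDerivAt (fun r => weight c r x * (a * Real.exp (-b * ‖flow c (-r) x - z‖ ^ 2)))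
      (weight c r x * a * Real.exp (-b * ‖flow c (-r) x - z‖ ^ 2) *
        (2 * b * inner ℝ (flow c (-r) x - z) (c (flow c (-r) x)) -
          divergence c (flow c (-r) x))) r := by
  have h1 := (h.hasDerivAt_weight x r).mul
    ((((h.hasDerivAt_flow_neg x r).sub_const z).norm_sq.const_mul (-b)).exp.const_mul a)
  refine h1.congr_deriv ?_
  rw [inner_neg_right]
  ring

/-- The Gaussian is split into two equal factors. One absorbs the linear growth of the inner
product, leaving only `√b`; the other is moved back from the flowed point to `x`. Since `b` will be
of order `1 / s`, this is the source of the rate `s^(-1/2)`. -/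
theorem VelocityBounds.abs_deriv_transport_gaussian_le (h : VelocityBounds c M L) {a b : ℝ}
    (ha : 0 ≤ a) (hb : 0 ≤ b) (z x : Plane) {r t : ℝ} (hr : 0 ≤ r) (hrt : r ≤ t)
    (ht : 2 * L * t ≤ 1) :
    |weight c r x * a * Real.exp (-b * ‖flow c (-r) x - z‖ ^ 2) *
        (2 * b * inner ℝ (flow c (-r) x - z) (c (flow c (-r) x)) -
          divergence c (flow c (-r) x))| ≤
      Real.exp 1 * (2 * L + 2 * M * Real.sqrt b) * Real.exp (b * (M * t) ^ 2 / 2) *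
        (a * Real.exp (-(b / 4) * ‖x - z‖ ^ 2)) := by
  set y := flow c (-r) x
  have hMr : ‖y - x‖ ≤ M * t :=
    (h.norm_flow_neg_sub_le hr x).trans (mul_le_mul_of_nonneg_left hrt M.2)
  have hw : weight c r x ≤ Real.exp 1 := h.weight_le hr
    ((mul_le_mul_of_nonneg_left hrt (by positivity)).trans ht) x
  have hw0 : 0 ≤ weight c r x := (Real.exp_pos _).le
  set E := Real.exp (-(b / 2) * ‖y - z‖ ^ 2) with hE
  have hE1 : E ≤ 1 := Real.exp_le_one_iff.2 (by nlinarith [sq_nonneg ‖y - z‖])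
  have hE2 : Real.exp (-b * ‖y - z‖ ^ 2) = E * E := by
    rw [hE, ← Real.exp_add]; congr 1; ring
  have hE0 : 0 ≤ E := (Real.exp_pos _).le
  have hE3 : E * (Real.sqrt b * ‖y - z‖) ≤ 1 := by
    have h1 := le_exp_half_sq (Real.sqrt b * ‖y - z‖)
    rw [mul_pow, Real.sq_sqrt hb] at h1
    refine (mul_le_mul_of_nonneg_left h1 hE0).trans (le_of_eq ?_)
    rw [hE, ← Real.exp_add, ← Real.exp_zero]; congr 1; ring
  have hbr : E * |2 * b * inner ℝ (y - z) (c y) - divergence c y| ≤ 2 * L + 2 * M * Real.sqrt b := by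
    have i1 : |inner ℝ (y - z) (c y)| ≤ ‖y - z‖ * M :=
      (abs_real_inner_le_norm _ _).trans
        (mul_le_mul_of_nonneg_left (h.norm_le y) (norm_nonneg _))
    have i2 : |2 * b * inner ℝ (y - z) (c y) - divergence c y| ≤
        2 * b * (‖y - z‖ * M) + 2 * L := by
      refine (abs_sub _ _).trans (add_le_add ?_ (h.abs_divergence_le y))
      rw [abs_mul, abs_of_nonneg (by positivity : 0 ≤ 2 * b)]
      exact mul_le_mul_of_nonneg_left i1 (by positivity)
    refine (mul_le_mul_of_nonneg_left i2 hE0).trans ?_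
    have i3 : E * (2 * b * (‖y - z‖ * M) + 2 * L) =
        2 * M * Real.sqrt b * (E * (Real.sqrt b * ‖y - z‖)) + E * (2 * L) := by
      have := Real.mul_self_sqrt hb
      linear_combination (-(2 * M * ‖y - z‖ * E)) * this
    rw [i3]
    have i4 := mul_le_mul_of_nonneg_left hE3 (by positivity : 0 ≤ 2 * M * Real.sqrt b)
    have i5 := mul_le_mul_of_nonneg_right hE1 (by positivity : (0 : ℝ) ≤ 2 * L)
    linarith
  rw [abs_mul, abs_of_nonneg (by positivity : 0 ≤ weight c r x * a *
    Real.exp (-b * ‖y - z‖ ^ 2)), hE2]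
  calc weight c r x * a * (E * E) * |2 * b * inner ℝ (y - z) (c y) - divergence c y|
      = weight c r x * (a * (E * (E * |2 * b * inner ℝ (y - z) (c y) - divergence c y|))) := by
        ring
    _ ≤ Real.exp 1 * (a * ((Real.exp (b * (M * t) ^ 2 / 2) *
          Real.exp (-(b / 4) * ‖x - z‖ ^ 2)) * (2 * L + 2 * M * Real.sqrt b))) := by
        refine mul_le_mul hw (mul_le_mul_of_nonneg_left (mul_le_mul (gaussian_shift_le hb hMr) hbr
          (by positivity) (by positivity)) ha) (by positivity) (by positivity)
    _ = _ := by ring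

theorem VelocityBounds.abs_transport_gaussian_sub_le (h : VelocityBounds c M L) {a b : ℝ}
    (ha : 0 ≤ a) (hb : 0 ≤ b) (z x : Plane) {r t : ℝ} (hr : 0 ≤ r) (hrt : r ≤ t)
    (ht : 2 * L * t ≤ 1) :
    |weight c r x * (a * Real.exp (-b * ‖flow c (-r) x - z‖ ^ 2)) -
      a * Real.exp (-b * ‖x - z‖ ^ 2)| ≤
      r * (Real.exp 1 * (2 * L + 2 * M * Real.sqrt b) * Real.exp (b * (M * t) ^ 2 / 2) *
        (a * Real.exp (-(b / 4) * ‖x - z‖ ^ 2))) := by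
  have := norm_image_sub_le_of_norm_deriv_le_segment' (a := 0) (b := r)
    (fun s _ => (h.hasDerivAt_transport_gaussian a b z x s).hasDerivWithinAt)
    (fun s hs => h.abs_deriv_transport_gaussian_le ha hb z x hs.1 (hs.2.le.trans hrt) ht)
    r ⟨hr, le_rfl⟩
  rwa [weight_zero, neg_zero, h.flow_zero, one_mul, sub_zero, mul_comm _ r] at this

variable {ε : ℝ}

theorem VelocityBounds.transportOp_kernelAt (h : VelocityBounds c M L) (hε : 0 < ε) {s : ℝ}
    (hs : 0 < s) (z : Plane) (t : ℝ≥0) : transportOp c t (kernelAt ε s z) =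
      classL1 fun x => weight c t x * heatKernel ε s (flow c (-(t : ℝ)) x - z) := by
  refine classL1_congr ?_
  filter_upwards [(h.quasiMeasurePreserving_flow t).ae (coeFn_kernelAt hε hs z)] with x hx
  rw [hx]; rfl

/-- The bound for the difference quotients of transported heat kernels. -/
noncomputable def kernelRate (M L : ℝ≥0) (ε s t : ℝ) : ℝ :=
  Real.exp 1 * (2 * L + 2 * M * Real.sqrt (1 / (4 * ε ^ 2 * s))) *
    Real.exp (1 / (4 * ε ^ 2 * s) * (M * t) ^ 2 / 2)

theorem VelocityBounds.abs_transport_heatKernel_sub_le (h : VelocityBounds c M L) {s : ℝ}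
    (hs : 0 < s) (z x : Plane) {r t : ℝ} (hr : 0 ≤ r) (hrt : r ≤ t)
    (ht : 2 * L * t ≤ 1) :
    |weight c r x * heatKernel ε s (flow c (-r) x - z) - heatKernel ε s (x - z)| ≤
      r * (kernelRate M L ε s t * (1 / (4 * Real.pi * ε ^ 2 * s) *
        Real.exp (-(1 / (4 * ε ^ 2 * s) / 4) * ‖x - z‖ ^ 2))) := by
  have := Real.pi_pos
  rw [heatKernel_eq, heatKernel_eq]
  exact h.abs_transport_gaussian_sub_le (by positivity) (by positivity) z x hr hrt ht

theorem integrable_wide_gaussian (hε : 0 < ε) {s : ℝ} (hs : 0 < s) (z : Plane) :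
    Integrable (fun x : Plane => 1 / (4 * Real.pi * ε ^ 2 * s) *
      Real.exp (-(1 / (4 * ε ^ 2 * s) / 4) * ‖x - z‖ ^ 2)) volume :=
  ((integrable_exp_neg_mul_sq (b := 1 / (4 * ε ^ 2 * s) / 4)
    (by positivity)).comp_sub_right z).const_mul _

theorem integral_wide_gaussian (hε : 0 < ε) {s : ℝ} (hs : 0 < s) (z : Plane) :
    ∫ x : Plane, 1 / (4 * Real.pi * ε ^ 2 * s) *
      Real.exp (-(1 / (4 * ε ^ 2 * s) / 4) * ‖x - z‖ ^ 2) = 4 := by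
  have := Real.pi_pos
  rw [integral_const_mul, integral_sub_right_eq_self (fun x : Plane =>
    Real.exp (-(1 / (4 * ε ^ 2 * s) / 4) * ‖x‖ ^ 2)), integral_exp_neg_mul_sq (by positivity)]
  field_simp

theorem VelocityBounds.continuous_transport_heatKernel (h : VelocityBounds c M L) (ε s t : ℝ)
    (z : Plane) : Continuous fun x => weight c t x * heatKernel ε s (flow c (-t) x - z) :=
  (h.continuous_weight t).mul ((continuous_heatKernel ε s).comp
    ((h.lipschitz_flow (-t)).continuous.sub continuous_const))

theorem VelocityBounds.integrable_transport_heatKernel (h : VelocityBounds c M L) (hε : 0 < ε)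
    {s : ℝ} (hs : 0 < s) (z : Plane) {t : ℝ} (ht : 0 ≤ t) (ht1 : 2 * L * t ≤ 1) :
    Integrable (fun x => weight c t x * heatKernel ε s (flow c (-t) x - z)) volume := by
  have hk : Integrable (fun x => heatKernel ε s (x - z)) volume :=
    (integrable_heatKernel hε hs).comp_sub_right z
  have hd : Integrable (fun x => weight c t x * heatKernel ε s (flow c (-t) x - z) -
      heatKernel ε s (x - z)) volume := by
    refine (((integrable_wide_gaussian hε hs z).const_mul _).const_mul t).mono'
      ((h.continuous_transport_heatKernel ε s t z).aestronglyMeasurable.sub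
        hk.aestronglyMeasurable)
      (Eventually.of_forall fun x => h.abs_transport_heatKernel_sub_le hs z x ht le_rfl ht1)
  refine (hd.add hk).congr (Eventually.of_forall fun x => ?_)
  simp

theorem VelocityBounds.norm_transportOp_kernelAt_sub_le (h : VelocityBounds c M L) (hε : 0 < ε)
    {s : ℝ} (hs : 0 < s) (z : Plane) {t : ℝ≥0} (ht : 2 * L * (t : ℝ) ≤ 1) :
    ‖transportOp c t (kernelAt ε s z) - kernelAt ε s z‖ ≤ t * (kernelRate M L ε s t * 4) := by
  have hk : Integrable (fun x => heatKernel ε s (x - z)) volume :=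
    (integrable_heatKernel hε hs).comp_sub_right z
  have hi := h.integrable_transport_heatKernel hε hs z t.coe_nonneg ht
  have hd : Integrable (fun x => weight c t x * heatKernel ε s (flow c (-(t : ℝ)) x - z) -
      heatKernel ε s (x - z)) volume := hi.sub hk
  rw [h.transportOp_kernelAt hε hs, kernelAt_eq hε hs, classL1_sub hi hk, norm_classL1 hd,
    ← integral_wide_gaussian hε hs z, ← integral_const_mul, ← integral_const_mul]
  exact integral_mono hd.abs (((integrable_wide_gaussian hε hs z).const_mul _).const_mul _)
    fun x => h.abs_transport_heatKernel_sub_le hs z x t.coe_nonneg le_rfl ht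

theorem eventually_mul_le_one (r : ℝ) : ∀ᶠ t : ℝ≥0 in 𝓝[>] 0, r * (t : ℝ) ≤ 1 := by
  have : Continuous fun t : ℝ≥0 => r * (t : ℝ) := by fun_prop
  refine eventually_nhdsWithin_of_eventually_nhds
    (((this.tendsto 0).eventually_lt_const ?_).mono fun t ht => ht.le)
  simp

/-- The difference quotients converge pointwise along characteristics and are dominated by a single
wider Gaussian, hence converge in `L¹`. -/
theorem VelocityBounds.exists_kernelAt_mem_convectionGraph (h : VelocityBounds c M L) (hε : 0 < ε)
    {s : ℝ} (hs : 0 < s) (z : Plane) : ∃ b, (kernelAt ε s z, b) ∈ convectionGraph c := by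
  obtain ⟨T, hT, hT0⟩ : ∃ T : ℝ≥0, 2 * L * (T : ℝ) ≤ 1 ∧ 0 < T :=
    ((eventually_mul_le_one (2 * L)).and self_mem_nhdsWithin).exists
  set k := fun x => heatKernel ε s (x - z) with hkd
  have hk : Integrable k volume := (integrable_heatKernel hε hs).comp_sub_right z
  set f := fun (t : ℝ≥0) x => weight c t x * heatKernel ε s (flow c (-(t : ℝ)) x - z) with hfd
  have hlt : ∀ t : ℝ≥0, t ≤ T → 2 * L * (t : ℝ) ≤ 1 := fun t ht =>
    (mul_le_mul_of_nonneg_left (NNReal.coe_le_coe.2 ht) (by positivity)).trans hT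
  have hf : ∀ t : ℝ≥0, t ≤ T → Integrable (f t) volume := fun t ht =>
    h.integrable_transport_heatKernel hε hs z t.coe_nonneg (hlt t ht)
  set w := fun x : Plane => kernelRate M L ε s T * (1 / (4 * Real.pi * ε ^ 2 * s) *
    Real.exp (-(1 / (4 * ε ^ 2 * s) / 4) * ‖x - z‖ ^ 2)) with hwd
  have hw : Integrable w volume := (integrable_wide_gaussian hε hs z).const_mul _
  have hbound : ∀ t : ℝ≥0, 0 < t → t ≤ T → ∀ x, |(t : ℝ)⁻¹ * (f t x - k x)| ≤ w x := by
    intro t ht0 ht x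
    have ht0' : (0 : ℝ) < t := ht0
    rw [abs_mul, abs_inv, abs_of_pos ht0', inv_mul_le_iff₀ ht0']
    exact h.abs_transport_heatKernel_sub_le hs z x t.coe_nonneg (NNReal.coe_le_coe.2 ht) hT
  have hlim : ∀ x, ∃ g, Tendsto (fun t : ℝ≥0 => (t : ℝ)⁻¹ * (f t x - k x)) (𝓝[>] 0) (𝓝 g) := by
    intro x
    have h1 := (h.hasDerivAt_transport_gaussian (1 / (4 * Real.pi * ε ^ 2 * s))
      (1 / (4 * ε ^ 2 * s)) z x 0).tendsto_slope_zero_right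
    have h2 := h1.comp (NNReal.map_coe_nhdsGT 0).le
    refine ⟨_, h2.congr fun t => ?_⟩
    simp only [Function.comp_apply, zero_add, smul_eq_mul, neg_zero, weight_zero, one_mul,
      h.flow_zero, hfd, hkd, heatKernel_eq]
  choose g hg using hlim
  have hev : ∀ᶠ t : ℝ≥0 in 𝓝[>] 0, 0 < t ∧ t ≤ T :=
    (eventually_mem_nhdsWithin).and (eventually_le_nhdsGT hT0)
  have hquot : ∀ t : ℝ≥0, t ≤ T → Integrable (fun x => (t : ℝ)⁻¹ * (f t x - k x)) volume :=
    fun t ht => ((hf t ht).sub hk).const_mul _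
  have hgm : AEStronglyMeasurable g volume := by
    refine aestronglyMeasurable_of_tendsto_ae (𝓝[>] (0 : ℝ≥0))
      (f := fun (t : ℝ≥0) x => (t : ℝ)⁻¹ * (f t x - k x)) (fun t => ?_)
      (Eventually.of_forall fun x => hg x)
    exact ((h.continuous_transport_heatKernel ε s t z).aestronglyMeasurable.sub
      hk.aestronglyMeasurable).const_mul _
  have hgw : ∀ x, |g x| ≤ w x := fun x =>
    le_of_tendsto (hg x).abs (hev.mono fun t ht => hbound t ht.1 ht.2 x)
  have hgi : Integrable g volume := hw.mono' hgm (Eventually.of_forall hgw)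
  refine ⟨classL1 g, ?_⟩
  change Tendsto _ _ _
  rw [tendsto_iff_norm_sub_tendsto_zero]
  have h3 : Tendsto (fun t : ℝ≥0 => ∫ x, |(t : ℝ)⁻¹ * (f t x - k x) - g x|) (𝓝[>] 0) (𝓝 0) := by
    have := tendsto_integral_filter_of_dominated_convergence (μ := (volume : Measure Plane))
      (l := 𝓝[>] (0 : ℝ≥0)) (F := fun t x => |(t : ℝ)⁻¹ * (f t x - k x) - g x|)
      (f := fun _ => 0) (fun x => w x + w x)
      (hev.mono fun t ht => ((hquot t ht.2).sub hgi).abs.aestronglyMeasurable)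
      (hev.mono fun t ht => Eventually.of_forall fun x => ?_) (hw.add hw)
      (Eventually.of_forall fun x => ?_)
    · simpa using this
    · rw [Real.norm_eq_abs, abs_abs]
      exact (abs_sub _ _).trans (add_le_add (hbound t ht.1 ht.2 x) (hgw x))
    · simpa using ((hg x).sub_const (g x)).abs
  refine h3.congr' (hev.mono fun t ht => ?_)
  have hd : Integrable (fun x => f t x - k x) volume := (hf t ht.2).sub hk
  have hd' : Integrable (fun x => (t : ℝ)⁻¹ * (f t x - k x) - g x) volume := (hquot t ht.2).sub hgi
  dsimp only
  rw [h.transportOp_kernelAt hε hs, kernelAt_eq hε hs, classL1_sub (hf t ht.2) hk,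
    classL1_smul _ hd, classL1_sub (hquot t ht.2) hgi, norm_classL1 hd']

/-- The point is that `t₀` does not depend on `s`. If `t ≤ √s`, the derivative estimate applies and
its exponential factor stays bounded. If `t ≥ √s`, the trivial bound `2 + 1 = 3` is already at most
`3 t / √s`. -/
theorem VelocityBounds.exists_transport_kernelAt_bound (h : VelocityBounds c M L) (hε : 0 < ε) :
    ∃ C : ℝ, 0 ≤ C ∧ ∃ t₀ > 0, ∀ t : ℝ≥0, t ≤ t₀ → ∀ s > 0, ∀ z,
      ‖transportOp c t (kernelAt ε s z) - kernelAt ε s z‖ ≤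
        t * (C * (1 + (Real.sqrt s)⁻¹)) := by
  obtain ⟨t₁, ht₁, A, hA⟩ := h.exists_transport_clm
  obtain ⟨T, hT, hT0⟩ : ∃ T : ℝ≥0, 2 * L * (T : ℝ) ≤ 1 ∧ 0 < T :=
    ((eventually_mul_le_one (2 * L)).and self_mem_nhdsWithin).exists
  set C := Real.exp 1 * (2 * L + M / ε) * Real.exp (1 / (4 * ε ^ 2) * M ^ 2 / 2) * 4 with hC
  have hC0 : 0 ≤ C := by positivity
  refine ⟨C + 3, by positivity, min t₁ T, lt_min ht₁ hT0, fun t ht s hs z => ?_⟩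
  have hs' : 0 < Real.sqrt s := Real.sqrt_pos.2 hs
  have hss : Real.sqrt s * Real.sqrt s = s := Real.mul_self_sqrt hs.le
  have hi : 0 < (Real.sqrt s)⁻¹ := inv_pos.2 hs'
  rcases le_total (t : ℝ) (Real.sqrt s) with hts | hts
  · have ht2 : 2 * L * (t : ℝ) ≤ 1 := (mul_le_mul_of_nonneg_left
      (NNReal.coe_le_coe.2 (ht.trans (min_le_right _ _))) (by positivity)).trans hT
    refine (h.norm_transportOp_kernelAt_sub_le hε hs z ht2).trans
      (mul_le_mul_of_nonneg_left ?_ t.coe_nonneg)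
    have e1 : Real.sqrt (1 / (4 * ε ^ 2 * s)) = (Real.sqrt s)⁻¹ / (2 * ε) := by
      rw [Real.sqrt_eq_iff_mul_self_eq (by positivity) (by positivity), div_mul_div_comm,
        ← mul_inv, hss]
      field_simp
      norm_num
    have e2 : 1 / (4 * ε ^ 2 * s) * (M * t) ^ 2 / 2 ≤ 1 / (4 * ε ^ 2) * M ^ 2 / 2 := by
      have : (t : ℝ) ^ 2 ≤ s := by rw [← Real.sq_sqrt hs.le]; gcongr
      have e3 : 1 / (4 * ε ^ 2 * s) * (M * t) ^ 2 / 2 =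
          1 / (4 * ε ^ 2) * M ^ 2 / 2 * ((t : ℝ) ^ 2 / s) := by field_simp
      rw [e3]
      exact mul_le_of_le_one_right (by positivity) ((div_le_one hs).2 this)
    have e4 : (2 * L + 2 * M * Real.sqrt (1 / (4 * ε ^ 2 * s)) : ℝ) ≤
        (2 * L + M / ε) * (1 + (Real.sqrt s)⁻¹) := by
      rw [e1]
      have e5 : (2 : ℝ) * M * ((Real.sqrt s)⁻¹ / (2 * ε)) = M / ε * (Real.sqrt s)⁻¹ := by
        field_simp
      rw [e5]
      have : 0 ≤ (M : ℝ) / ε := by positivity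
      have : 0 ≤ (2 : ℝ) * L * (Real.sqrt s)⁻¹ := by positivity
      nlinarith
    calc kernelRate M L ε s t * 4 ≤ Real.exp 1 * ((2 * L + M / ε) * (1 + (Real.sqrt s)⁻¹)) *
          Real.exp (1 / (4 * ε ^ 2) * M ^ 2 / 2) * 4 := by
          unfold kernelRate; gcongr
      _ = C * (1 + (Real.sqrt s)⁻¹) := by rw [hC]; ring
      _ ≤ (C + 3) * (1 + (Real.sqrt s)⁻¹) := by gcongr; linarith
  · have h1 := hA t (ht.trans (min_le_left _ _)) (kernelAt ε s z)
    rw [norm_kernelAt hε hs] at h1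
    have h2 := norm_sub_le (transportOp c t (kernelAt ε s z)) (kernelAt ε s z)
    rw [norm_kernelAt hε hs, h1.1] at h2
    rw [h1.1]
    have h3 : 1 ≤ t * (Real.sqrt s)⁻¹ := by
      rw [← div_eq_mul_inv, one_le_div hs']; exact hts
    have h4 : 0 ≤ (t : ℝ) * C * (1 + (Real.sqrt s)⁻¹) := by positivity
    have h5 := t.coe_nonneg
    nlinarith [h1.2]

end Gaussian

end ReturnHome

namespace ReturnHome

/-! ### The sum of diffusion and convection -/

section Sum

variable {c : Plane → Plane} {M L : ℝ≥0} {ε : ℝ}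

theorem heatCLM_transport_bound {A : ℝ≥0 → L1 →L[ℝ] L1} (hε : 0 < ε) {C : ℝ}
    {s t : ℝ≥0} (hs : 0 < s) (hA : ∀ v, transportOp c t v = A t v)
    (hC : ∀ z, ‖transportOp c t (kernelAt ε s z) - kernelAt ε s z‖ ≤ t * C) (v : L1) :
    ‖A t (heatCLM hε s v) - heatCLM hε s v‖ ≤ t * (C * ‖v‖) := by
  have hs' : (0 : ℝ) < s := hs
  have hi := integrable_smul_kernelAt hε hs' v
  rw [heatCLM_eq_integral_kernelAt hε hs, ← ContinuousLinearMap.integral_comp_comm _ hi,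
    ← integral_sub ((A t).integrable_comp hi) hi, L1_norm_eq v, ← integral_const_mul,
    ← integral_const_mul]
  refine norm_integral_le_of_norm_le (((L1_integrable v).abs.const_mul _).const_mul _)
    (Eventually.of_forall fun z => ?_)
  rw [map_smul, ← smul_sub, norm_smul, ← hA, Real.norm_eq_abs]
  exact (mul_le_mul_of_nonneg_left (hC z) (abs_nonneg _)).trans (le_of_eq (by ring))

theorem VelocityBounds.eventually_transport_eq (h : VelocityBounds c M L) :
    ∃ A : ℝ≥0 → L1 →L[ℝ] L1, ∀ᶠ t in 𝓝[>] (0 : ℝ≥0), ∀ v, transportOp c t v = A t v := by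
  obtain ⟨t₁, ht₁, A, hA⟩ := h.exists_transport_clm
  exact ⟨A, (eventually_le_nhdsGT ht₁).mono fun t ht v => (hA t ht v).1⟩

/-- The singularity at zero is that of the Gamma integral at `1 / 2`; for `l ≥ 1` the case `l = 1`
dominates. -/
theorem integrableOn_exp_mul_rate {l : ℝ} (hl : 1 ≤ l) :
    IntegrableOn (fun s : ℝ => Real.exp (-l * s) * (1 + (Real.sqrt s)⁻¹)) (Set.Ioi 0) := by
  have h1 : IntegrableOn (fun s : ℝ => Real.exp (-1 * s) * (1 + (Real.sqrt s)⁻¹))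
      (Set.Ioi 0) := by
    refine ((exp_neg_integrableOn_Ioi 0 one_pos).add (Real.GammaIntegral_convergent
      (s := 1 / 2) (by norm_num))).congr_fun (fun s (hs : 0 < s) => ?_) measurableSet_Ioi
    have e : (Real.sqrt s)⁻¹ = s ^ ((1 : ℝ) / 2 - 1) := by
      rw [Real.sqrt_eq_rpow, ← Real.rpow_neg hs.le]; norm_num
    simp only [Pi.add_apply, e]
    rw [neg_one_mul, mul_add, mul_one]
  refine h1.mono' ?_ ((ae_restrict_iff' measurableSet_Ioi).2
    (Eventually.of_forall fun s (hs : 0 < s) => ?_))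
  · exact (by fun_prop : Measurable fun s : ℝ => Real.exp (-l * s) *
      (1 + (Real.sqrt s)⁻¹)).aestronglyMeasurable
  · rw [Real.norm_of_nonneg (by positivity)]
    refine mul_le_mul_of_nonneg_right (Real.exp_le_exp.2 ?_) (by positivity)
    nlinarith

theorem tendsto_integral_exp_mul_rate :
    Tendsto (fun l : ℝ => ∫ s in Set.Ioi (0 : ℝ), Real.exp (-l * s) * (1 + (Real.sqrt s)⁻¹))
      atTop (𝓝 0) := by
  have := tendsto_integral_filter_of_dominated_convergence
    (μ := (volume : Measure ℝ).restrict (Set.Ioi 0)) (l := atTop)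
    (F := fun (l : ℝ) (s : ℝ) => Real.exp (-l * s) * (1 + (Real.sqrt s)⁻¹)) (f := fun _ => 0)
    (fun s => Real.exp (-1 * s) * (1 + (Real.sqrt s)⁻¹))
    ((eventually_ge_atTop 1).mono fun l hl => (integrableOn_exp_mul_rate hl).aestronglyMeasurable)
    ((eventually_ge_atTop 1).mono fun l hl => (ae_restrict_iff' measurableSet_Ioi).2
      (Eventually.of_forall fun s (hs : 0 < s) => ?_)) (integrableOn_exp_mul_rate le_rfl)
    ((ae_restrict_iff' measurableSet_Ioi).2 (Eventually.of_forall fun s (hs : 0 < s) => ?_))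
  · simpa using this
  · rw [Real.norm_of_nonneg (by positivity)]
    refine mul_le_mul_of_nonneg_right (Real.exp_le_exp.2 ?_) (by positivity)
    nlinarith
  · have h1 : Tendsto (fun l : ℝ => Real.exp (-(l * s))) atTop (𝓝 0) :=
      Real.tendsto_exp_neg_atTop_nhds_zero.comp (tendsto_id.atTop_mul_const hs)
    simpa using h1.mul_const (1 + (Real.sqrt s)⁻¹)

/-- The resolvent of the heat semigroup maps into the domain of the transport generator, and the
composition is small for large parameters. -/
theorem VelocityBounds.exists_laplace_mem_convectionGraph (h : VelocityBounds c M L)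
    (hε : 0 < ε) : ∃ κ : ℝ → ℝ, Tendsto κ atTop (𝓝 0) ∧ ∀ l, 1 ≤ l → ∀ f, ∃ b,
      (laplace (heatSemigroup hε) l f, b) ∈ convectionGraph c ∧ ‖b‖ ≤ κ l * ‖f‖ := by
  obtain ⟨C, hC0, t₀, ht₀, hC⟩ := h.exists_transport_kernelAt_bound hε
  obtain ⟨A, hA⟩ := h.eventually_transport_eq
  refine ⟨fun l => C * ∫ s in Set.Ioi (0 : ℝ), Real.exp (-l * s) * (1 + (Real.sqrt s)⁻¹),
    by simpa using tendsto_integral_exp_mul_rate.const_mul C, fun l hl f => ?_⟩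
  have hl0 : 0 < l := by linarith
  -- Closedness of the graph under dominated integrals is used twice: here over the centres `z` of
  -- the kernels, and below over the time `s` in the resolvent.
  have hheat : ∀ s : ℝ≥0, 0 < s → ∃ b, (heatCLM hε s f, b) ∈ convectionGraph c := by
    intro s hs
    have hs' : (0 : ℝ) < s := hs
    rw [heatCLM_eq_integral_kernelAt hε hs]
    have hb : ∀ z, ∃ b, (f z • kernelAt ε s z, b) ∈ convectionGraph c := fun z => by
      obtain ⟨b, hb⟩ := h.exists_kernelAt_mem_convectionGraph hε hs' z
      refine ⟨f z • b, smul_mem_generatorGraph _ ?_ hb⟩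
      filter_upwards [hA] with t ht
      rw [ht, ht, map_smul]
    have hd : ∀ᶠ t in 𝓝[>] (0 : ℝ≥0), ∀ᵐ z, ‖A t (f z • kernelAt ε s z) - f z • kernelAt ε s z‖ ≤
        t * (|f z| * (C * (1 + (Real.sqrt s)⁻¹))) := by
      filter_upwards [hA, eventually_le_nhdsGT ht₀] with t ht htt
      refine Eventually.of_forall fun z => ?_
      rw [map_smul, ← smul_sub, norm_smul, ← ht, Real.norm_eq_abs]
      exact (mul_le_mul_of_nonneg_left (hC t htt s hs' z) (abs_nonneg _)).trans
        (le_of_eq (by ring))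
    obtain ⟨b, hb, -⟩ := exists_integral_mem_generatorGraph hA
      (integrable_smul_kernelAt hε hs' f) (Eventually.of_forall hb)
      ((L1_integrable f).abs.mul_const _) hd
    exact ⟨b, hb⟩
  have hT : ∀ t x, ‖(heatSemigroup hε).op t x‖ ≤ ‖x‖ := norm_heatCLM_le hε
  have hb : ∀ᵐ s ∂(volume : Measure ℝ).restrict (Set.Ioi 0), ∃ b,
      (Real.exp (-l * s) • (heatSemigroup hε).op s.toNNReal f, b) ∈ convectionGraph c := by
    refine (ae_restrict_iff' measurableSet_Ioi).2 (Eventually.of_forall fun s (hs : 0 < s) => ?_)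
    obtain ⟨b, hb⟩ := hheat s.toNNReal (Real.toNNReal_pos.2 hs)
    refine ⟨Real.exp (-l * s) • b, smul_mem_generatorGraph _ ?_ hb⟩
    filter_upwards [hA] with t ht
    rw [ht, ht, map_smul]
  have hd : ∀ᶠ t in 𝓝[>] (0 : ℝ≥0), ∀ᵐ s ∂(volume : Measure ℝ).restrict (Set.Ioi 0),
      ‖A t (Real.exp (-l * s) • (heatSemigroup hε).op s.toNNReal f) -
        Real.exp (-l * s) • (heatSemigroup hε).op s.toNNReal f‖ ≤
      t * (C * (Real.exp (-l * s) * (1 + (Real.sqrt s)⁻¹)) * ‖f‖) := by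
    filter_upwards [hA, eventually_le_nhdsGT ht₀] with t ht htt
    refine (ae_restrict_iff' measurableSet_Ioi).2 (Eventually.of_forall fun s (hs : 0 < s) => ?_)
    have hs' := Real.toNNReal_pos.2 hs
    have h1 := heatCLM_transport_bound hε hs' ht (hC t htt s.toNNReal hs') f
    rw [Real.coe_toNNReal _ hs.le] at h1
    rw [map_smul, ← smul_sub, norm_smul, Real.norm_of_nonneg (Real.exp_pos _).le]
    exact (mul_le_mul_of_nonneg_left h1 (Real.exp_pos _).le).trans (le_of_eq (by ring))
  obtain ⟨b, hb, hbn⟩ := exists_integral_mem_generatorGraph hA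
    (integrableOn_exp_smul_op hT hl0 f) hb
    (((integrableOn_exp_mul_rate hl).const_mul C).mul_const _) hd
  refine ⟨b, hb, hbn.trans (le_of_eq ?_)⟩
  rw [integral_mul_const, integral_const_mul]

variable {X : Type*} [NormedAddCommGroup X] [NormedSpace ℝ X]

/-- The generator of a family that is linear for small times, as a subspace of `X × X`. -/
def generatorSubmodule (F : ℝ≥0 → X → X)
    (hF : ∃ A : ℝ≥0 → X →L[ℝ] X, ∀ᶠ t in 𝓝[>] (0 : ℝ≥0), ∀ x, F t x = A t x) :
    Submodule ℝ (X × X) where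
  carrier := generatorGraph F
  add_mem' {p q} hp hq := by
    obtain ⟨A, hA⟩ := hF
    exact add_mem_generatorGraph (hA.mono fun t ht => by rw [ht, ht, ht, map_add]) hp hq
  zero_mem' := by
    obtain ⟨A, hA⟩ := hF
    refine tendsto_const_nhds.congr' (hA.mono fun t ht => ?_)
    simp [ht]
  smul_mem' r p hp := by
    obtain ⟨A, hA⟩ := hF
    exact smul_mem_generatorGraph r (hA.mono fun t ht => by rw [ht, ht, map_smul]) hp

/-- The sum of two linear operators, defined on the intersection of their domains. -/
def sumSubmodule (G H : Submodule ℝ (X × X)) : Submodule ℝ (X × X) where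
  carrier := {p | ∃ a b, (p.1, a) ∈ G ∧ (p.1, b) ∈ H ∧ p.2 = a + b}
  add_mem' := by
    rintro p q ⟨a, b, ha, hb, hp⟩ ⟨a', b', ha', hb', hq⟩
    refine ⟨a + a', b + b', G.add_mem ha ha', H.add_mem hb hb', ?_⟩
    rw [Prod.snd_add, hp, hq, add_add_add_comm]
  zero_mem' := ⟨0, 0, G.zero_mem, H.zero_mem, by simp⟩
  smul_mem' := by
    rintro r p ⟨a, b, ha, hb, hp⟩
    exact ⟨r • a, r • b, G.smul_mem r ha, H.smul_mem r hb, by rw [Prod.smul_snd, hp, smul_add]⟩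

theorem laplace_add {T : C0Semigroup X} (hT : ∀ t x, ‖T.op t x‖ ≤ ‖x‖) {l : ℝ} (hl : 0 < l)
    (f g : X) : laplace T l (f + g) = laplace T l f + laplace T l g := by
  rw [laplace, laplace, laplace, ← integral_add (integrableOn_exp_smul_op hT hl f)
    (integrableOn_exp_smul_op hT hl g)]
  simp only [map_add, smul_add]

theorem laplace_smul (T : C0Semigroup X) (l r : ℝ) (f : X) :
    laplace T l (r • f) = r • laplace T l f := by
  rw [laplace, laplace, ← integral_smul]
  simp only [map_smul, smul_comm r]

theorem exists_heat_clm (hε : 0 < ε) :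
    ∃ A : ℝ≥0 → L1 →L[ℝ] L1, ∀ᶠ t in 𝓝[>] (0 : ℝ≥0), ∀ v, heatOp ε t v = A t v :=
  ⟨heatCLM hε, Eventually.of_forall fun t v => heatOp_eq hε t v⟩

/-- The operator `A + B` on `D(A) ∩ D(B)`. -/
noncomputable def advectionDiffusion (hε : 0 < ε) (h : VelocityBounds c M L) :
    Submodule ℝ (L1 × L1) :=
  sumSubmodule (generatorSubmodule (heatOp ε) (exists_heat_clm hε))
    (generatorSubmodule (transportOp c) h.eventually_transport_eq)

theorem mem_advectionDiffusion (hε : 0 < ε) (h : VelocityBounds c M L) (p : L1 × L1) :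
    p ∈ advectionDiffusion hε h ↔ ∃ a b, (p.1, a) ∈ diffusionGraph ε ∧
      (p.1, b) ∈ convectionGraph c ∧ p.2 = a + b := Iff.rfl

/-- The sign conditions are additive. For the range, `(l - A - B) R_l k = k - B R_l k`, and `1 - B
R_l` is invertible once `‖B R_l‖ < 1`. For density, `l R_l f` lies in `D(A) ∩ D(B)` and tends to
`f`. -/
theorem markovGenerator_advectionDiffusion (hε : 0 < ε) (h : VelocityBounds c M L) :
    MarkovGenerator (advectionDiffusion hε h) := by
  have hT : ∀ t x, ‖(heatSemigroup hε).op t x‖ ≤ ‖x‖ := norm_heatCLM_le hε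
  obtain ⟨κ, hκ, hB⟩ := h.exists_laplace_mem_convectionGraph hε
  have hR : ∀ l, 0 < l → ∀ f, (laplace (heatSemigroup hε) l f,
      l • laplace (heatSemigroup hε) l f - f) ∈ diffusionGraph ε := fun l hl f => by
    rw [diffusionGraph_eq hε]
    exact laplace_mem_generatorGraph hT hl f
  refine ⟨?_, ?_, ?_, ?_⟩
  · rintro p ⟨a, b, ha, hb, hp⟩
    have e : ∫ x in {x | p.1 x < 0}, p.2 x =
        (∫ x in {x | p.1 x < 0}, a x) + ∫ x in {x | p.1 x < 0}, b x := by
      rw [hp]; exact map_add (setIntegralL1 {x | p.1 x < 0}) a b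
    rw [e]
    exact add_nonneg (diffusionGraph_sign hε ha).1 (h.convectionGraph_sign hb).1
  · rintro p ⟨a, b, ha, hb, hp⟩
    rw [hp, map_add, (diffusionGraph_sign hε ha).2, (h.convectionGraph_sign hb).2, add_zero]
  · obtain ⟨l₀, hl₀⟩ := eventually_atTop.1 (hκ.eventually_lt_const one_pos)
    refine ⟨max l₀ 1, by positivity, fun l hl f => ?_⟩
    have hl1 : 1 ≤ l := (le_max_right _ _).trans hl.le
    have hlpos : 0 < l := by linarith
    choose b hb hbn using hB l hl1
    let B : L1 →L[ℝ] L1 := LinearMap.mkContinuous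
      { toFun := b
        map_add' := fun f g => generatorGraph_unique (hb (f + g)) (by
          rw [laplace_add hT hlpos]
          exact (generatorSubmodule (transportOp c) h.eventually_transport_eq).add_mem
            (hb f) (hb g))
        map_smul' := fun r f => generatorGraph_unique (hb (r • f)) (by
          rw [laplace_smul]
          exact (generatorSubmodule (transportOp c) h.eventually_transport_eq).smul_mem
            r (hb f)) } (κ l) hbn
    have hBn : ‖B‖ < 1 := by
      refine lt_of_le_of_lt (ContinuousLinearMap.opNorm_le_bound' B (le_max_right (κ l) 0)
        fun f _ => (hbn f).trans (mul_le_mul_of_nonneg_right (le_max_left _ _) (norm_nonneg _)))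
        (max_lt (hl₀ l ((le_max_left _ _).trans hl.le)) one_pos)
    obtain ⟨U, hU⟩ := isUnit_one_sub_of_norm_lt_one hBn
    set k := (↑U⁻¹ : L1 →L[ℝ] L1) f with hk
    have hk1 : k - b k = f := by
      have h1 : ((U : L1 →L[ℝ] L1) * (↑U⁻¹ : L1 →L[ℝ] L1)) f = f := by
        rw [Units.mul_inv]; rfl
      rw [hU] at h1
      exact h1
    refine ⟨(laplace (heatSemigroup hε) l k, (l • laplace (heatSemigroup hε) l k - k) + b k),
      ⟨_, _, hR l hlpos k, hb k, rfl⟩, ?_⟩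
    rw [← sub_sub, sub_sub_cancel, hk1]
  · refine fun f => mem_closure_of_tendsto (tendsto_smul_laplace hT f) ?_
    filter_upwards [eventually_ge_atTop 1] with l hl
    obtain ⟨b, hb, -⟩ := hB l hl f
    have hm : (laplace (heatSemigroup hε) l f, (l • laplace (heatSemigroup hε) l f - f) + b) ∈
        advectionDiffusion hε h :=
      (mem_advectionDiffusion hε h _).2 ⟨_, _, hR l (by linarith) f, hb, rfl⟩
    have hm' := (advectionDiffusion hε h).smul_mem l hm
    rw [Prod.smul_mk] at hm'
    exact ⟨_, hm'⟩

end Sum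

/-! ### The full system -/

section Full

variable {σ : ℝ}

theorem gaussian_eq (σ : ℝ) (x : Plane) : gaussian σ x =
    1 / (2 * Real.pi * σ ^ 2) * Real.exp (-(1 / (2 * σ ^ 2)) * ‖x‖ ^ 2) := by
  rw [gaussian, EuclideanSpace.real_norm_sq_eq, Fin.sum_univ_two]
  congr 2; ring

theorem integrable_gaussian (hσ : 0 < σ) : Integrable (gaussian σ) volume := by
  rw [funext (gaussian_eq σ)]
  exact (integrable_exp_neg_mul_sq (by positivity)).const_mul _

theorem integral_gaussian_eq_one (hσ : 0 < σ) : ∫ x, gaussian σ x = 1 := by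
  have := Real.pi_pos
  simp_rw [gaussian_eq]
  rw [integral_const_mul, integral_exp_neg_mul_sq (by positivity)]
  field_simp

theorem gaussian_nonneg (σ : ℝ) (x : Plane) : 0 ≤ gaussian σ x := by
  have := Real.pi_pos
  unfold gaussian
  positivity

theorem classL1_gaussian_nonneg (hσ : 0 < σ) (y : Plane) :
    0 ≤ classL1 fun x => gaussian σ (x - y) := by
  rw [← Lp.coeFn_nonneg]
  filter_upwards [coeFn_classL1 ((integrable_gaussian hσ).comp_sub_right y)] with x hx
  rw [hx]
  exact gaussian_nonneg _ _

theorem integralL1_classL1_gaussian (hσ : 0 < σ) (y : Plane) :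
    integralL1 (classL1 fun x => gaussian σ (x - y)) = 1 := by
  rw [integralL1_classL1 ((integrable_gaussian hσ).comp_sub_right y),
    integral_sub_right_eq_self (gaussian σ) y, integral_gaussian_eq_one hσ]

theorem systemGraph_eq {c : Plane → Plane} {M L : ℝ≥0} {ε : ℝ} (hε : 0 < ε)
    (h : VelocityBounds c M L) (σ α γ χ : ℝ) (y : Plane) :
    systemGraph ε σ α γ χ c y = (systemSubmodule (advectionDiffusion hε h) α γ χ
      (couplingCLM γ χ (classL1 fun x => gaussian σ (x - y))) : Set (State × State)) := by
  have hL : ∀ p, couplingOp σ γ χ y p =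
      couplingCLM γ χ (classL1 fun x => gaussian σ (x - y)) p := fun p => by
    rw [couplingCLM_apply]; rfl
  ext p
  rw [SetLike.mem_coe, mem_systemSubmodule]
  constructor
  · rintro ⟨q, ⟨u, v, w, a, b, ha, hb, hq⟩, hp⟩
    obtain ⟨h1, h2⟩ := Prod.ext_iff.1 hq
    simp only at h1 h2
    refine ⟨u, v, w, a + b, ⟨a, b, ha, hb, rfl⟩, Prod.ext h1 ?_⟩
    rw [hp, h2, h1, hL]
  · rintro ⟨u, v, w, a, ⟨a', b', ha, hb, hab⟩, rfl⟩
    simp only at hab ha hb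
    refine ⟨_, ⟨u, v, w, a', b', ha, hb, rfl⟩, ?_⟩
    rw [hL, hab]

end Full

end ReturnHome
theorem mainTheorem11 (ε σ α γ χ : ℝ) (hε : 0 < ε) (hσ : 0 < σ)
    (hα : 0 < α) (hγ : 0 < γ) (hχ : 0 < χ)
    (C : ReturnHome.Plane → ReturnHome.Plane → ReturnHome.Plane)
    (n : ReturnHome.Plane → ℝ) (y : ReturnHome.Plane)
    (hC : ReturnHome.RegularVelocity (C y)) :
    (∃ T : ReturnHome.C0Semigroup ReturnHome.State,
      T.IsGeneratedBy (ReturnHome.systemGraph ε σ α γ χ (C y) y)) ∧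
    ∀ T : ReturnHome.C0Semigroup ReturnHome.State,
      T.IsGeneratedBy (ReturnHome.systemGraph ε σ α γ χ (C y) y) →
      ∀ x₀ : ReturnHome.State,
        (ReturnHome.omegaLimitSet T x₀).Nonempty ∧
        IsCompact (ReturnHome.omegaLimitSet T x₀) ∧
        (x₀ ∈ ReturnHome.positiveCone → ReturnHome.totalMass x₀ = n y →
          ReturnHome.omegaLimitSet T x₀ ⊆
            {p | p ∈ ReturnHome.positiveCone ∧ ReturnHome.totalMass p = n y}) := by
  obtain ⟨M, L, h⟩ := hC.exists_bounds
  rw [ReturnHome.systemGraph_eq hε h]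
  obtain ⟨hex, hall⟩ := ReturnHome.exists_semigroup_and_omegaLimitSet
    (ReturnHome.markovGenerator_advectionDiffusion hε h) hα hγ hχ
    (ReturnHome.classL1_gaussian_nonneg hσ y) (ReturnHome.integralL1_classL1_gaussian hσ y)
  refine ⟨hex, fun T hT x₀ => ?_⟩
  obtain ⟨h1, h2, h3⟩ := hall T hT x₀
  exact ⟨h1, h2, fun hx hm => h3 hx (n y) hm⟩
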